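/- Let $\Gamma\subset SL_2(\mathbb R)$ be a lattice (a discrete subgroup of finite covolume), acting on the upper half-plane $\mathfrak H$, and write $(f|_k\gamma)(\tau)=(c\tau+d)^{-k}f\bigl(\frac{a\tau+b}{c\tau+d}\bigr)$ for $\gamma=\begin{pmatrix}a&b\\c&d\end{pmatrix}$ and $D=\frac1{2\pi i}\frac{d}{d\tau}$. A function $F$ on $\mathfrak H$ has moderate growth if $|F(\tau)|\le C\bigl((1+|\tau|^2)/\operatorname{Im}\tau\bigr)^N$ on $\mathfrak H$ for some $C,N$. For $K\in\mathbb Z$ let $\widetilde M_K(\Gamma)$ be the space of quasimodular forms of weight $K$ on $\Gamma$: holomorphic functions $F$ on $\mathfrak H$ of moderate growth such that, for some $n\ge 0$ and some functions $F_0,\dots,F_n$ on $\mathfrak H$, one has $(F|_K\gamma)(\tau)=\sum_{r=0}^nF_r(\tau)\bigl(\frac1{2\pi i}\frac{c}{c\tau+d}\bigr)^r$ for all $\gamma\in\Gamma$ and $\tau\in\mathfrak H$; one then says that $F$ has depth $\le n$. Its completion is $\widehat F(\tau)=\sum_{r}F_r(\tau)/(2\pi i(\tau-\bar\tau))^r$.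 For $k\in\mathbb Z$ let $\mathrm{MLDO}_{k,k+K}(\Gamma)$ be the space of modular linear differential operators of type $(k,k+K)$: the operators $L=\sum_{r=0}^na_r(\tau)D^r$ on the holomorphic functions on $\mathfrak H$, with holomorphic coefficients $a_r$ of moderate growth, such that $L(f|_k\gamma)=L(f)|_{k+K}\gamma$ for all $\gamma\in\Gamma$ and all holomorphic $f$ on $\mathfrak H$; one then says that $L$ has order $\le n$. For $w\in\mathbb Z$ the extended holomorphic projection $\pi^{\mathrm{hol}}_w$ is the linear operator, defined on sums of functions of the following two kinds, which maps a function $\Psi$ on $\mathfrak H$ for which the integral converges absolutely for every $\tau\in\mathfrak H$ to its Bergman projection $$\pi^{\mathrm{hol}}_w(\Psi)(\tau)=\frac{w-1}{4\pi}\iint_{\mathfrak H}\Psi(z)\Bigl(\frac{z-\bar z}{\tau-\bar z}\Bigr)^w\frac{dx\,dy}{y^2}\qquad(z=x+iy),$$ and maps an almost holomorphic function $\sum_{0\le m\le\max(w-2,0)}h_m(\tau)/(\tau-\bar\tau)^m$ with holomorphic $h_m$ to $\sum_m\frac{(-1)^m}{(w-m-1)_m}\frac{d^mh_m}{d\tau^m}$,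 where $(x)_m=x(x+1)\cdots(x+m-1)$. **Theorem.** Let $k$ be a positive integer. For every $K\in\mathbb Z$, every $F\in\widetilde M_K(\Gamma)$ and every holomorphic function $f$ on $\mathfrak H$, the function $f\widehat F$ lies in the domain of $\pi^{\mathrm{hol}}_{k+K}$, its projection does not depend on the chosen decomposition into a sum as above, and $$\mathcal L_{F,k}(f)=\pi^{\mathrm{hol}}_{k+K}(f\,\widehat F)$$ defines an operator $\mathcal L_{F,k}\in\mathrm{MLDO}_{k,k+K}(\Gamma)$. The map $F\mapsto\mathcal L_{F,k}$ is a linear isomorphism $\widetilde M_K(\Gamma)\cong\mathrm{MLDO}_{k,k+K}(\Gamma)$ for every $K$, hence an isomorphism of graded vector spaces $\widetilde M_*(\Gamma)\cong\mathrm{MLDO}_{k,k+*}(\Gamma)$, and it respects the filtrations: $F$ has depth $\le n$ if and only if $\mathcal L_{F,k}$ has order $\le n$. -/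

import Mathlib

open UpperHalfPlane MeasureTheory
open scoped MatrixGroups ModularForm Manifold ComplexConjugate

noncomputable section

namespace ModularDiffOp

/-- A lattice in `SL(2, ℝ)`: a discrete subgroup of finite covolume, that is, some measurable set of
finite hyperbolic area `∫ dx dy / y ^ 2` meets every orbit of the subgroup on the upper
half-plane. -/
structure IsLattice (Γ : Subgroup SL(2, ℝ)) : Prop where
  discrete : DiscreteTopology Γ
  finite_covolume : ∃ S : Set ℍ, MeasurableSet S ∧ volume S < ⊤ ∧ ∀ τ : ℍ, ∃ γ ∈ Γ, γ • τ ∈ S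

/-- Moderate growth: `|F τ|` is bounded by a power of `(1 + |τ|²) / Im τ`. -/
def ModerateGrowth (F : ℍ → ℂ) : Prop :=
  ∃ (C : ℝ) (N : ℕ), ∀ τ : ℍ, ‖F τ‖ ≤ C * ((1 + ‖(τ : ℂ)‖ ^ 2) / τ.im) ^ N

/-- The space of holomorphic functions on the upper half-plane. -/
def Hol : Submodule ℂ (ℍ → ℂ) where
  carrier := {f | MDiff f}
  zero_mem' := mdifferentiable_const
  add_mem' hf hg := hf.add hg
  smul_mem' c _ hf := hf.const_smul c

/-- The weight `k` slash action of `SL(2, ℝ)`,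
`(f ∣ₖ γ) τ = (c τ + d) ^ (-k) f ((a τ + b) / (c τ + d))`. -/
def slash (k : ℤ) (γ : SL(2, ℝ)) (f : ℍ → ℂ) : ℍ → ℂ := f ∣[k] (γ : GL (Fin 2) ℝ)

theorem slash_apply (k : ℤ) (γ : SL(2, ℝ)) (f : ℍ → ℂ) (τ : ℍ) :
    slash k γ f τ = ((γ 1 0 : ℂ) * τ + (γ 1 1 : ℂ)) ^ (-k) * f (γ • τ) := by
  have h : γ • τ = (γ : GL (Fin 2) ℝ) • τ := rfl
  rw [h]
  simp [slash, ModularForm.slash_apply, σ, denom, mul_comm]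

/-- The slash action on holomorphic functions. -/
def holSlash (k : ℤ) (γ : SL(2, ℝ)) (f : Hol) : Hol :=
  ⟨slash k γ f, f.2.slash k (γ : GL (Fin 2) ℝ)⟩

/-- The normalized derivative `D = (2πi)⁻¹ d/dτ`. -/
abbrev D (f : ℍ → ℂ) : ℍ → ℂ := Derivative.normalizedDerivOfComplex f

/-! ### Quasimodular forms -/

/-- The quantity `(2πi)⁻¹ c / (c τ + d)`, where `(c, d)` is the bottom row of `γ`. -/
def qmVar (γ : SL(2, ℝ)) (τ : ℍ) : ℂ :=
  (2 * Real.pi * Complex.I)⁻¹ * ((γ 1 0 : ℂ) / ((γ 1 0 : ℂ) * τ + (γ 1 1 : ℂ)))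

/-- `P` is the polynomial that describes the values `(F ∣_K γ) τ`, `γ ∈ Γ`, at the point `τ`. -/
def IsTransfPoly (Γ : Subgroup SL(2, ℝ)) (K : ℤ) (F : ℍ → ℂ) (τ : ℍ) (P : Polynomial ℂ) : Prop :=
  ∀ γ ∈ Γ, slash K γ F τ = P.eval (qmVar γ τ)

/-- At each point `τ` the map `γ ↦ (F ∣_K γ) τ` on `Γ` is a polynomial of degree at most `n` in
`c / (c τ + d)`. -/
def HasDepthLE (Γ : Subgroup SL(2, ℝ)) (K : ℤ) (n : ℕ) (F : ℍ → ℂ) : Prop :=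
  ∀ τ : ℍ, ∃ P : Polynomial ℂ, P.natDegree ≤ n ∧ IsTransfPoly Γ K F τ P

theorem ModerateGrowth.zero : ModerateGrowth 0 := ⟨0, 0, fun τ => by simp⟩

theorem one_le_growth (τ : ℍ) : 1 ≤ (1 + ‖(τ : ℂ)‖ ^ 2) / τ.im := by
  rw [one_le_div τ.im_pos]
  have h : τ.im ≤ ‖(τ : ℂ)‖ := (le_abs_self _).trans (Complex.abs_im_le_norm (τ : ℂ))
  nlinarith [sq_nonneg (‖(τ : ℂ)‖ - 1)]

theorem ModerateGrowth.add {F G : ℍ → ℂ} (hF : ModerateGrowth F) (hG : ModerateGrowth G) :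
    ModerateGrowth (F + G) := by
  obtain ⟨C, N, hC⟩ := hF
  obtain ⟨C', N', hC'⟩ := hG
  refine ⟨|C| + |C'|, N + N', fun τ => ?_⟩
  have h1 := one_le_growth τ
  set t := (1 + ‖(τ : ℂ)‖ ^ 2) / τ.im
  have hF : ‖F τ‖ ≤ |C| * t ^ (N + N') := (hC τ).trans <|
    mul_le_mul (le_abs_self C) (pow_le_pow_right₀ h1 (by omega)) (by positivity) (abs_nonneg C)
  have hG : ‖G τ‖ ≤ |C'| * t ^ (N + N') := (hC' τ).trans <|
    mul_le_mul (le_abs_self C') (pow_le_pow_right₀ h1 (by omega)) (by positivity) (abs_nonneg C')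
  calc ‖(F + G) τ‖ ≤ ‖F τ‖ + ‖G τ‖ := norm_add_le _ _
    _ ≤ _ := by linarith

theorem ModerateGrowth.smul {F : ℍ → ℂ} (c : ℂ) (hF : ModerateGrowth F) :
    ModerateGrowth (c • F) := by
  obtain ⟨C, N, hC⟩ := hF
  refine ⟨‖c‖ * C, N, fun τ => ?_⟩
  rw [Pi.smul_apply, norm_smul, mul_assoc]
  exact mul_le_mul_of_nonneg_left (hC τ) (norm_nonneg c)

/-- The space of quasimodular forms of weight `K` on `Γ`: holomorphic functions of moderate growth
for which `γ ↦ (F ∣_K γ) τ` is a polynomial in `c / (c τ + d)` of bounded degree. -/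
def QuasimodularForms (Γ : Subgroup SL(2, ℝ)) (K : ℤ) : Submodule ℂ (ℍ → ℂ) where
  carrier := {F | MDiff F ∧ ModerateGrowth F ∧ ∃ n, HasDepthLE Γ K n F}
  zero_mem' := ⟨mdifferentiable_const, .zero, 0, fun τ => ⟨0, by simp, fun γ _ => by simp [slash_apply]⟩⟩
  add_mem' := by
    rintro F G ⟨hF, hF', n, hn⟩ ⟨hG, hG', m, hm⟩
    refine ⟨hF.add hG, hF'.add hG', max n m, fun τ => ?_⟩
    obtain ⟨P, hP, hP'⟩ := hn τ
    obtain ⟨Q, hQ, hQ'⟩ := hm τ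
    refine ⟨P + Q, (Polynomial.natDegree_add_le P Q).trans (max_le_max hP hQ), fun γ hγ => ?_⟩
    rw [Polynomial.eval_add, ← hP' γ hγ, ← hQ' γ hγ]
    simp [slash_apply, mul_add]
  smul_mem' := by
    rintro c F ⟨hF, hF', n, hn⟩
    refine ⟨hF.const_smul c, hF'.smul c, n, fun τ => ?_⟩
    obtain ⟨P, hP, hP'⟩ := hn τ
    refine ⟨c • P, (Polynomial.natDegree_smul_le c P).trans hP, fun γ hγ => ?_⟩
    rw [Polynomial.eval_smul, ← hP' γ hγ]
    simp [slash_apply, mul_left_comm]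

open Classical in
/-- The polynomial `∑ r, F_r(τ) X ^ r` with `(F ∣_K γ) τ = ∑ r, F_r(τ) ((2πi)⁻¹ c / (c τ + d)) ^ r`
for all `γ ∈ Γ`. On a lattice there is at most one; the value is `0` if there is none. -/
def transfPoly (Γ : Subgroup SL(2, ℝ)) (K : ℤ) (F : ℍ → ℂ) (τ : ℍ) : Polynomial ℂ :=
  if h : ∃ P, IsTransfPoly Γ K F τ P then h.choose else 0

/-- The completion `∑ r, F_r(τ) / (2πi (τ - conj τ)) ^ r` of a quasimodular form, an almost
holomorphic modular form. -/
def completion (Γ : Subgroup SL(2, ℝ)) (K : ℤ) (F : ℍ → ℂ) (τ : ℍ) : ℂ :=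
  (transfPoly Γ K F τ).eval (2 * Real.pi * Complex.I * ((τ : ℂ) - conj (τ : ℂ)))⁻¹

/-! ### Modular linear differential operators -/

/-- `L` is the differential operator `∑ r ≤ n, a r * D ^ r`, with coefficients that are holomorphic
in the upper half-plane and at the cusps (moderate growth). -/
def HasOrderLE (n : ℕ) (L : Hol →ₗ[ℂ] Hol) : Prop :=
  ∃ a : ℕ → ℍ → ℂ, (∀ r, MDiff (a r) ∧ ModerateGrowth (a r)) ∧
    ∀ (f : Hol) (τ : ℍ), (L f : ℍ → ℂ) τ = ∑ r ∈ Finset.range (n + 1), a r τ * (D^[r] f) τ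

theorem HasOrderLE.mono {n m : ℕ} (h : n ≤ m) {L : Hol →ₗ[ℂ] Hol} (hL : HasOrderLE n L) :
    HasOrderLE m L := by
  obtain ⟨a, ha, haL⟩ := hL
  refine ⟨fun r => if r < n + 1 then a r else 0, fun r => ?_, fun f τ => ?_⟩
  · beta_reduce
    split_ifs
    · exact ha r
    · exact ⟨mdifferentiable_const, .zero⟩
  · rw [haL, ← Finset.sum_subset (Finset.range_mono (Nat.succ_le_succ h))]
    · refine Finset.sum_congr rfl fun r hr => ?_
      simp [Finset.mem_range.1 hr]
    · intro r _ hr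
      simp [Finset.mem_range.not.1 hr]

/-- The space of modular linear differential operators of type `(k, k + K)` on `Γ`: linear
differential operators `L` of finite order on holomorphic functions, with coefficients that are
holomorphic also at the cusps, such that `L (f ∣ₖ γ) = (L f) ∣_{k + K} γ` for all `γ ∈ Γ`. -/
def MLDO (Γ : Subgroup SL(2, ℝ)) (k K : ℤ) : Submodule ℂ (Hol →ₗ[ℂ] Hol) where
  carrier := {L | (∃ n, HasOrderLE n L) ∧
    ∀ γ ∈ Γ, ∀ f : Hol, L (holSlash k γ f) = holSlash (k + K) γ (L f)}
  zero_mem' := by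
    refine ⟨⟨0, fun _ => 0, fun _ => ⟨mdifferentiable_const, .zero⟩, fun f τ => by simp⟩, ?_⟩
    intro γ _ f
    ext τ
    simp [holSlash, slash_apply]
  add_mem' := by
    rintro L M ⟨⟨n, hn⟩, hL⟩ ⟨⟨m, hm⟩, hM⟩
    refine ⟨⟨max n m, ?_⟩, fun γ hγ f => ?_⟩
    · obtain ⟨a, ha, haL⟩ := hn.mono (le_max_left n m)
      obtain ⟨b, hb, hbM⟩ := hm.mono (le_max_right n m)
      refine ⟨fun r => a r + b r, fun r => ⟨(ha r).1.add (hb r).1, (ha r).2.add (hb r).2⟩, ?_⟩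
      intro f τ
      simp [haL, hbM, add_mul, Finset.sum_add_distrib]
    · rw [LinearMap.add_apply, hL γ hγ, hM γ hγ, LinearMap.add_apply]
      ext τ
      simp [holSlash, slash_apply, mul_add]
  smul_mem' := by
    rintro c L ⟨⟨n, a, ha, haL⟩, hL⟩
    refine ⟨⟨n, fun r => c • a r, fun r => ⟨(ha r).1.const_smul c, (ha r).2.smul c⟩, ?_⟩, ?_⟩
    · intro f τ
      simp [haL, Finset.mul_sum, mul_assoc]
    · intro γ hγ f
      rw [LinearMap.smul_apply, hL γ hγ, LinearMap.smul_apply]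
      ext τ
      simp [holSlash, slash_apply, mul_left_comm]

/-! ### Holomorphic projection -/

/-- The integrand `Φ(z) ((z - conj z) / (τ - conj z)) ^ k` of the weight `k` Bergman projection. -/
def bergmanIntegrand (k : ℤ) (Φ : ℍ → ℂ) (τ z : ℍ) : ℂ :=
  Φ z * (((z : ℂ) - conj (z : ℂ)) / ((τ : ℂ) - conj (z : ℂ))) ^ k

/-- The weight `k` Bergman projection
`(k - 1) / 4π * ∫ Φ(z) ((z - conj z) / (τ - conj z)) ^ k dV`, `dV = dx dy / y ^ 2`. -/
def bergmanProj (k : ℤ) (Φ : ℍ → ℂ) (τ : ℍ) : ℂ :=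
  ((k : ℂ) - 1) / (4 * Real.pi) * ∫ z : ℍ, bergmanIntegrand k Φ τ z

/-- The almost holomorphic function `∑ m ≤ N, h_m(τ) / (τ - conj τ) ^ m`. -/
def almostHol (N : ℕ) (h : ℕ → Hol) (τ : ℍ) : ℂ :=
  ∑ m ∈ Finset.range (N + 1), (h m : ℍ → ℂ) τ / ((τ : ℂ) - conj (τ : ℂ)) ^ m

/-- The weight `k` holomorphic projection of `almostHol N h`, where the projection of
`h(τ) / (τ - conj τ) ^ m` is `(-1) ^ m / (k - m - 1)_m * (d/dτ) ^ m h`. -/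
def almostHolProj (k : ℤ) (N : ℕ) (h : ℕ → Hol) (τ : ℍ) : ℂ :=
  ∑ m ∈ Finset.range (N + 1), (-1) ^ m / (ascPochhammer ℂ m).eval ((k : ℂ) - m - 1) *
    iteratedDeriv m ((h m : ℍ → ℂ) ∘ ofComplex) (τ : ℂ)

/-- `g` is the extended weight `k` holomorphic projection of `Φ`: here `Φ` is the sum of a function
`Ψ` with absolutely convergent Bergman integrals and an almost holomorphic function with no powers
of `1 / (τ - conj τ)` beyond `max (k - 2) 0`, and `g` is the sum of the Bergman projection of `Ψ`
and the projection of the almost holomorphic function. -/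
def IsHolProj (k : ℤ) (Φ g : ℍ → ℂ) : Prop :=
  ∃ (Ψ : ℍ → ℂ) (h : ℕ → Hol),
    (∀ τ : ℍ, Integrable (bergmanIntegrand k Ψ τ)) ∧
    (∀ τ : ℍ, Φ τ = Ψ τ + almostHol (k - 2).toNat h τ) ∧
    ∀ τ : ℍ, g τ = bergmanProj k Ψ τ + almostHolProj k (k - 2).toNat h τ

end ModularDiffOp

end

open UpperHalfPlane MeasureTheory
open scoped MatrixGroups ModularForm Manifold ComplexConjugate

noncomputable section

namespace ModularDiffOp

/-! Put `w = k + K`, `N = max (w - 2) 0`, and expand the completion of `F` as `∑ G_m / (τ - conj τ)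
^ m`. The projection of `∑ h_m / (τ - conj τ) ^ m` is `∑ c_m h_m^(m)` (`projOp`, with `c_m` =
`projCoeff w m`), so the operator attached to `F` is `f ↦ ∑ c_m (f G_m)^(m)`. As `c_m ≠ 0` for `m ≤
N`, testing on powers of `z - τ₀` shows that the operator determines the `G_m`
(`eq_zero_of_sum_derivH_eq_zero`), and triangular elimination brings every operator of order at most
`N` to this form (`exists_eq_projOp`). The largest `m` with `G_m ≠ 0` is both the depth of `F` and
the order of the operator.

The two invariance conditions correspond as well. The transformation law of `F` is a law for the
vector `(G_m)` (`quasiTransform`), and a binomial identity (`sum_projCoeff_mul_mobiusCoeff`) shows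
that `projOp` turns this law in weight `w` into the slash action. Conversely, uniqueness of the
`G_m` turns equivariance of the operator into the law for `(G_m)`, whose zeroth component already
makes `G_0` quasimodular with coefficients `G_m`.

Three analytic facts support this algebra. First, a lattice has infinitely many pairwise
non-proportional bottom rows (`IsLattice.exists_seq`), so the `G_m` are unique and, by Lagrange
interpolation, holomorphic of moderate growth. Second, depth and order are at most `K / 2`, hence at
most `N` because `k > 0`: the top coefficient is a modular form of weight `K - 2n`, and forms of
negative weight vanish (`IsLattice.eq_zero_of_neg_weight`). The vanishing is proved without cusps:
Jensen's inequality makes `|G|² y^(-m)` large on average over large hyperbolic circles, moderate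
growth then forces a fixed proportion of each circle into the part of the quotient far from the base
point, and finite covolume makes that part arbitrarily small. Third, the extended projection is well
defined, since on almost holomorphic functions with convergent integrals the Bergman projection
agrees with the formula (`bergmanProj_almostHol`). In disc coordinates this reduces to Taylor
coefficients and Beta integrals. -/

/-! ### Iterated derivatives on the upper half-plane -/

/-- The `m`-th derivative of a function on the upper half-plane. -/
def derivH (m : ℕ) (f : ℍ → ℂ) (τ : ℍ) : ℂ := iteratedDeriv m (f ∘ ofComplex) (τ : ℂ)

theorem analyticAt_comp_ofComplex {f : ℍ → ℂ} (hf : MDiff f) {z : ℂ} (hz : 0 < z.im) :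
    AnalyticAt ℂ (f ∘ ofComplex) z :=
  (UpperHalfPlane.mdifferentiable_iff.1 hf).analyticAt (isOpen_upperHalfPlaneSet.mem_nhds hz)

theorem contDiffAt_comp_ofComplex {f : ℍ → ℂ} (hf : MDiff f) (τ : ℍ) (n : WithTop ℕ∞) :
    ContDiffAt ℂ n (f ∘ ofComplex) (τ : ℂ) :=
  (analyticAt_comp_ofComplex hf τ.im_pos).contDiffAt

theorem derivH_zero (f : ℍ → ℂ) : derivH 0 f = f := by
  ext τ
  simp [derivH]

theorem derivH_comp_ofComplex (m : ℕ) (f : ℍ → ℂ) {z : ℂ} (hz : 0 < z.im) :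
    (derivH m f ∘ ofComplex) z = iteratedDeriv m (f ∘ ofComplex) z := by
  simp [derivH, ofComplex_apply_of_im_pos hz]

theorem derivH_comp_ofComplex_eventuallyEq (m : ℕ) (f : ℍ → ℂ) {z : ℂ} (hz : 0 < z.im) :
    (derivH m f ∘ ofComplex) =ᶠ[nhds z] iteratedDeriv m (f ∘ ofComplex) := by
  filter_upwards [isOpen_upperHalfPlaneSet.mem_nhds hz] with w hw
  exact derivH_comp_ofComplex m f hw

theorem derivH_succ (m : ℕ) (f : ℍ → ℂ) : derivH (m + 1) f = derivH 1 (derivH m f) := by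
  ext τ
  rw [derivH, derivH, iteratedDeriv_succ, iteratedDeriv_one,
    (derivH_comp_ofComplex_eventuallyEq m f τ.im_pos).deriv_eq]

theorem mdiff_derivH {f : ℍ → ℂ} (hf : MDiff f) (m : ℕ) : MDiff (derivH m f) := by
  rw [mdifferentiable_iff]
  intro z hz
  refine DifferentiableAt.differentiableWithinAt ?_
  refine DifferentiableAt.congr_of_eventuallyEq ?_ (derivH_comp_ofComplex_eventuallyEq m f hz)
  rw [iteratedDeriv_eq_iterate]
  exact ((analyticAt_comp_ofComplex hf hz).iterated_deriv m).differentiableAt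

theorem derivH_add {f g : ℍ → ℂ} (hf : MDiff f) (hg : MDiff g) (m : ℕ) :
    derivH m (f + g) = derivH m f + derivH m g := by
  ext τ
  exact iteratedDeriv_add (contDiffAt_comp_ofComplex hf τ m) (contDiffAt_comp_ofComplex hg τ m)

theorem derivH_smul (c : ℂ) (f : ℍ → ℂ) (m : ℕ) : derivH m (c • f) = c • derivH m f := by
  ext τ
  exact iteratedDeriv_const_smul_field c (f ∘ ofComplex)

theorem derivH_sum {ι : Type*} (s : Finset ι) {f : ι → ℍ → ℂ} (hf : ∀ i ∈ s, MDiff (f i)) (m : ℕ) :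
    derivH m (∑ i ∈ s, f i) = ∑ i ∈ s, derivH m (f i) := by
  classical
  induction s using Finset.induction_on with
  | empty =>
    have := derivH_smul 0 (0 : ℍ → ℂ) m
    simpa using this
  | insert a s ha ih =>
    rw [Finset.sum_insert ha, Finset.sum_insert ha, derivH_add, ih]
    · exact fun i hi => hf i (Finset.mem_insert_of_mem hi)
    · exact hf a (Finset.mem_insert_self a s)
    · have h : ∑ i ∈ s, f i ∈ Hol :=
        sum_mem fun i hi => hf i (Finset.mem_insert_of_mem hi)
      exact h

theorem derivH_mul {f g : ℍ → ℂ} (hf : MDiff f) (hg : MDiff g) (m : ℕ) (τ : ℍ) :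
    derivH m (f * g) τ =
      ∑ i ∈ Finset.range (m + 1), (m.choose i : ℂ) * derivH i f τ * derivH (m - i) g τ :=
  iteratedDeriv_mul (contDiffAt_comp_ofComplex hf τ m) (contDiffAt_comp_ofComplex hg τ m)

/-- Strips the powers of `2πi` from `D`, so that all later computations can use the plain
derivative. -/
theorem iterate_D_eq_derivH (r : ℕ) (f : ℍ → ℂ) :
    D^[r] f = ((2 * Real.pi * Complex.I : ℂ)⁻¹) ^ r • derivH r f := by
  induction r with
  | zero => simp [derivH_zero]
  | succ r ih =>
    rw [Function.iterate_succ_apply', ih, derivH_succ, pow_succ', mul_smul]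
    ext τ
    have h : deriv ((((2 * Real.pi * Complex.I : ℂ)⁻¹) ^ r • derivH r f) ∘ ofComplex) (τ : ℂ)
        = derivH 1 (((2 * Real.pi * Complex.I : ℂ)⁻¹) ^ r • derivH r f) τ := by
      rw [derivH, iteratedDeriv_one]
    change (2 * Real.pi * Complex.I : ℂ)⁻¹ * deriv _ _ = _
    rw [h, derivH_smul]
    rfl

/-! ### Derivatives along Möbius transformations -/

/-- The coefficients in the derivatives of `(c u + d) ^ (-s) * g ((a u + b) / (c u + d))`. -/
def mobiusCoeff (s : ℂ) (m l : ℕ) : ℂ :=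
  (m.choose l : ℂ) * (ascPochhammer ℂ (m - l)).eval (s + l)

theorem mobiusCoeff_succ_zero (s : ℂ) (m : ℕ) :
    mobiusCoeff s (m + 1) 0 = mobiusCoeff s m 0 * (s + m) := by
  simp [mobiusCoeff, ascPochhammer_succ_eval]

theorem mobiusCoeff_of_lt (s : ℂ) {m l : ℕ} (h : m < l) : mobiusCoeff s m l = 0 := by
  simp [mobiusCoeff, Nat.choose_eq_zero_of_lt h]

/-- Pascal's rule, after both Pochhammer symbols are reduced to a common one by removing their last
and first factor respectively. -/
theorem mobiusCoeff_succ_succ (s : ℂ) (m l : ℕ) :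
    mobiusCoeff s (m + 1) (l + 1) =
      mobiusCoeff s m (l + 1) * (s + m + (l + 1)) + mobiusCoeff s m l := by
  rcases lt_trichotomy m l with h | rfl | h
  · rw [mobiusCoeff_of_lt s h, mobiusCoeff_of_lt s (by omega : m < l + 1),
      mobiusCoeff_of_lt s (by omega : m + 1 < l + 1)]
    simp
  · simp [mobiusCoeff]
  · obtain ⟨t, rfl⟩ : ∃ t, m = l + 1 + t := ⟨m - l - 1, by omega⟩
    have h1 : l + 1 + t + 1 - (l + 1) = t + 1 := by omega
    have h2 : l + 1 + t - (l + 1) = t := by omega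
    have h3 : l + 1 + t - l = t + 1 := by omega
    have e1 : (ascPochhammer ℂ (t + 1)).eval (s + (l + 1 : ℕ)) =
        (ascPochhammer ℂ t).eval (s + (l + 1 : ℕ)) * (s + (l + 1 : ℕ) + t) :=
      ascPochhammer_succ_eval t _
    have e2 : (ascPochhammer ℂ (t + 1)).eval (s + l) =
        (s + l) * (ascPochhammer ℂ t).eval (s + (l + 1 : ℕ)) := by
      rw [ascPochhammer_succ_left]
      simp [Polynomial.eval_comp, add_assoc]
    have e3 : ((l + 1 + t).choose (l + 1) : ℂ) * (l + 1) = (l + 1 + t).choose l * (t + 1) := by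
      have := Nat.choose_succ_right_eq (l + 1 + t) l
      rw [h3] at this
      exact_mod_cast this
    simp only [mobiusCoeff, h1, h2, h3]
    rw [e1, e2, Nat.choose_succ_succ' (l + 1 + t) l]
    push_cast at e3 ⊢
    linear_combination -(Polynomial.eval (s + (l + 1)) (ascPochhammer ℂ t)) * e3

theorem isOpen_mobius_domain (a b c d : ℂ) :
    IsOpen {u : ℂ | c * u + d ≠ 0 ∧ 0 < ((a * u + b) / (c * u + d)).im} := by
  rw [isOpen_iff_mem_nhds]
  rintro u ⟨h1, h2⟩
  have h3 : ContinuousAt (fun u : ℂ => ((a * u + b) / (c * u + d)).im) u :=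
    Complex.continuous_im.continuousAt.comp (by fun_prop (disch := assumption))
  have h4 : ContinuousAt (fun u : ℂ => c * u + d) u := by fun_prop
  filter_upwards [h4.eventually_ne h1, h3.eventually (lt_mem_nhds h2)] with v hv hv'
  exact ⟨hv, hv'⟩

/-- A further derivative hits either the power of `c u + d`, giving the factor `-c (s + m + l)`, or
the composite, giving the determinant over `(c u + d) ^ 2`. The entries are arbitrary complex
numbers because the formula serves both real `γ` and the map `discMap` from the disc. -/
theorem iteratedDeriv_mobius {f : ℍ → ℂ} (hf : MDiff f) (a b c d : ℂ) (s : ℤ) (m : ℕ) {u : ℂ}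
    (hu : c * u + d ≠ 0) (hu' : 0 < ((a * u + b) / (c * u + d)).im) :
    iteratedDeriv m (fun u => (c * u + d) ^ (-s) * (f ∘ ofComplex) ((a * u + b) / (c * u + d))) u =
      ∑ l ∈ Finset.range (m + 1), mobiusCoeff s m l * (-c) ^ (m - l) * (a * d - b * c) ^ l *
        (c * u + d) ^ (-s - m - l) * (derivH l f ∘ ofComplex) ((a * u + b) / (c * u + d)) := by
  induction m generalizing u with
  | zero => simp [mobiusCoeff, derivH_zero]
  | succ m ih =>
    rw [iteratedDeriv_succ]
    have hev : iteratedDeriv m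
        (fun u => (c * u + d) ^ (-s) * (f ∘ ofComplex) ((a * u + b) / (c * u + d))) =ᶠ[nhds u]
        fun u => ∑ l ∈ Finset.range (m + 1), mobiusCoeff s m l * (-c) ^ (m - l) *
          (a * d - b * c) ^ l * (c * u + d) ^ (-s - m - l) *
          (derivH l f ∘ ofComplex) ((a * u + b) / (c * u + d)) := by
      filter_upwards [(isOpen_mobius_domain a b c d).mem_nhds ⟨hu, hu'⟩] with v hv
      exact ih hv.1 hv.2
    rw [hev.deriv_eq]
    set z := (a * u + b) / (c * u + d) with hz
    have hj : HasDerivAt (fun u => c * u + d) c u := by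
      simpa using ((hasDerivAt_id u).const_mul c).add_const d
    have hM : HasDerivAt (fun u => (a * u + b) / (c * u + d))
        ((a * d - b * c) / (c * u + d) ^ 2) u := by
      have h := (((hasDerivAt_id u).const_mul a).add_const b).div hj hu
      refine h.congr_deriv ?_
      simp
      ring
    have hterm : ∀ l ∈ Finset.range (m + 1), HasDerivAt
        (fun u => mobiusCoeff s m l * (-c) ^ (m - l) * (a * d - b * c) ^ l *
          (c * u + d) ^ (-s - m - l) * (derivH l f ∘ ofComplex) ((a * u + b) / (c * u + d)))
        (mobiusCoeff s m l * (s + m + l) * (-c) ^ (m + 1 - l) * (a * d - b * c) ^ l *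
            (c * u + d) ^ (-s - (m + 1 : ℕ) - l) * (derivH l f ∘ ofComplex) z +
          mobiusCoeff s m l * (-c) ^ (m + 1 - (l + 1)) * (a * d - b * c) ^ (l + 1) *
            (c * u + d) ^ (-s - (m + 1 : ℕ) - (l + 1 : ℕ)) * (derivH (l + 1) f ∘ ofComplex) z) u := by
      intro l hl
      have hl' : l ≤ m := Nat.lt_succ_iff.1 (Finset.mem_range.1 hl)
      have h1 : HasDerivAt (fun u => (c * u + d) ^ (-s - m - l : ℤ))
          (((-s - m - l : ℤ) : ℂ) * (c * u + d) ^ (-s - m - l - 1 : ℤ) * c) u :=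
        HasDerivAt.comp u (h₂ := fun x : ℂ => x ^ (-s - m - l : ℤ))
          (hasDerivAt_zpow (-s - m - l) (c * u + d) (Or.inl hu)) hj
      have h2 : HasDerivAt (fun u => (derivH l f ∘ ofComplex) ((a * u + b) / (c * u + d)))
          ((derivH (l + 1) f ∘ ofComplex) z * ((a * d - b * c) / (c * u + d) ^ 2)) u := by
        refine HasDerivAt.comp u (h₂ := derivH l f ∘ ofComplex) ?_ hM
        have h3 := (analyticAt_comp_ofComplex (mdiff_derivH hf l) hu').differentiableAt.hasDerivAt
        refine h3.congr_deriv ?_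
        rw [derivH_succ, derivH_comp_ofComplex 1 _ hu', iteratedDeriv_one]
      have h4 := (h1.mul h2).const_mul (mobiusCoeff s m l * (-c) ^ (m - l) * (a * d - b * c) ^ l)
      have h5 : m + 1 - l = (m - l) + 1 := by omega
      refine (h4.congr_deriv ?_).congr_of_eventuallyEq (Filter.Eventually.of_forall fun v => ?_)
      · have e1 : (c * u + d) ^ (-s - (m + 1 : ℕ) - l : ℤ) = (c * u + d) ^ (-s - m - l - 1 : ℤ) := by
          congr 1; push_cast; ring
        have e2 : (c * u + d) ^ (-s - (m + 1 : ℕ) - (l + 1 : ℕ) : ℤ) =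
            (c * u + d) ^ (-s - m - l : ℤ) / (c * u + d) ^ 2 := by
          rw [← zpow_natCast (c * u + d) 2, ← zpow_sub₀ hu]
          congr 1; push_cast; ring
        rw [e1, e2, h5, Nat.succ_sub_succ, ← hz]
        push_cast
        ring
      · simp only [Pi.mul_apply]
        ring
    rw [(HasDerivAt.fun_sum hterm).deriv, Finset.sum_add_distrib, ← Nat.succ_eq_add_one (m + 1),
      Finset.sum_range_succ' _ (m + 1)]
    -- The first sum is padded by the vanishing term `l = m + 1`, so that both sums can be merged
    -- after the shift of index.
    have h0 : mobiusCoeff s m (m + 1) = 0 := mobiusCoeff_of_lt s (Nat.lt_succ_self m)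
    have hext : ∑ l ∈ Finset.range (m + 1), mobiusCoeff s m l * (s + m + l) * (-c) ^ (m + 1 - l) *
          (a * d - b * c) ^ l * (c * u + d) ^ (-s - (m + 1 : ℕ) - l) * (derivH l f ∘ ofComplex) z =
        ∑ l ∈ Finset.range (m + 2), mobiusCoeff s m l * (s + m + l) * (-c) ^ (m + 1 - l) *
          (a * d - b * c) ^ l * (c * u + d) ^ (-s - (m + 1 : ℕ) - l) *
          (derivH l f ∘ ofComplex) z := by
      rw [Finset.sum_range_succ _ (m + 1), h0]
      simp
    rw [hext, Finset.sum_range_succ' _ (m + 1), add_right_comm, ← Finset.sum_add_distrib]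
    congr 1
    · refine Finset.sum_congr rfl fun l _ => ?_
      rw [mobiusCoeff_succ_succ]
      push_cast
      ring
    · rw [mobiusCoeff_succ_zero]
      push_cast
      ring

/-! ### Moderate growth -/

theorem ModerateGrowth.mul {F G : ℍ → ℂ} (hF : ModerateGrowth F) (hG : ModerateGrowth G) :
    ModerateGrowth (F * G) := by
  obtain ⟨C, N, hC⟩ := hF
  obtain ⟨C', N', hC'⟩ := hG
  refine ⟨C * C', N + N', fun τ => ?_⟩
  have h := mul_le_mul (hC τ) (hC' τ) (norm_nonneg _) ((norm_nonneg _).trans (hC τ))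
  rw [Pi.mul_apply, norm_mul, pow_add]
  linarith

theorem inv_im_le_growth (τ : ℍ) : 1 / τ.im ≤ (1 + ‖(τ : ℂ)‖ ^ 2) / τ.im := by
  have := τ.im_pos
  gcongr
  nlinarith [sq_nonneg ‖(τ : ℂ)‖]

/-- Cauchy's estimate on the circle of radius `Im τ / 2`. There the numerator of the growth function
increases by at most `13 / 4` and its denominator at most halves, whence `13 / 2`; dividing by the
radius costs one more power. -/
theorem ModerateGrowth.derivH_one {F : ℍ → ℂ} (hF : MDiff F) (hF' : ModerateGrowth F) :
    ModerateGrowth (derivH 1 F) := by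
  obtain ⟨C, N, hC⟩ := hF'
  refine ⟨2 * |C| * (13 / 2) ^ N, N + 1, fun τ => ?_⟩
  have hy := τ.im_pos
  set q := (1 + ‖(τ : ℂ)‖ ^ 2) / τ.im with hq
  have hq1 : 1 ≤ q := one_le_growth τ
  have hyn : τ.im ≤ ‖(τ : ℂ)‖ := (le_abs_self _).trans (Complex.abs_im_le_norm (τ : ℂ))
  have him : ∀ z ∈ Metric.closedBall (τ : ℂ) (τ.im / 2), τ.im / 2 ≤ z.im := by
    intro z hz
    rw [mem_closedBall_iff_norm] at hz
    have := (Complex.abs_im_le_norm (z - τ)).trans hz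
    rw [Complex.sub_im, abs_le] at this
    have h2 : (τ : ℂ).im = τ.im := rfl
    linarith [this.1]
  have hbound : ∀ z ∈ Metric.sphere (τ : ℂ) (τ.im / 2),
      ‖(F ∘ ofComplex) z‖ ≤ |C| * (13 / 2 * q) ^ N := by
    intro z hz
    have hz1 := him z (Metric.sphere_subset_closedBall hz)
    have hzpos : 0 < z.im := by linarith
    rw [Function.comp_apply, ofComplex_apply_of_im_pos hzpos]
    refine (hC _).trans ?_
    refine mul_le_mul (le_abs_self C) ?_ (by positivity) (abs_nonneg C)
    refine pow_le_pow_left₀ (by positivity) ?_ N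
    have hzn : ‖z‖ ≤ 3 / 2 * ‖(τ : ℂ)‖ := by
      rw [mem_sphere_iff_norm] at hz
      have := norm_add_le (z - τ) (τ : ℂ)
      rw [sub_add_cancel] at this
      linarith
    change (1 + ‖z‖ ^ 2) / z.im ≤ _
    have h3 : 1 + ‖z‖ ^ 2 ≤ 13 / 4 * (1 + ‖(τ : ℂ)‖ ^ 2) := by
      nlinarith [norm_nonneg z, norm_nonneg (τ : ℂ)]
    calc (1 + ‖z‖ ^ 2) / z.im ≤ (13 / 4 * (1 + ‖(τ : ℂ)‖ ^ 2)) / (τ.im / 2) := by gcongr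
      _ = 13 / 2 * q := by rw [hq]; field_simp; ring
  have hd : DiffContOnCl ℂ (F ∘ ofComplex) (Metric.ball (τ : ℂ) (τ.im / 2)) := by
    refine DifferentiableOn.diffContOnCl ?_
    rw [closure_ball _ (by positivity)]
    intro z hz
    exact (analyticAt_comp_ofComplex hF (by linarith [him z hz])).differentiableAt.differentiableWithinAt
  have hmain := Complex.norm_deriv_le_of_forall_mem_sphere_norm_le (by positivity) hd hbound
  have h4 := inv_im_le_growth τ
  rw [← hq] at h4
  calc ‖derivH 1 F τ‖ ≤ |C| * (13 / 2 * q) ^ N / (τ.im / 2) := by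
        rwa [derivH, iteratedDeriv_one]
    _ = 2 * |C| * (13 / 2) ^ N * q ^ N * (1 / τ.im) := by rw [mul_pow]; field_simp
    _ ≤ 2 * |C| * (13 / 2) ^ N * q ^ N * q := by gcongr
    _ = _ := by ring

theorem ModerateGrowth.derivH {F : ℍ → ℂ} (hF : MDiff F) (hF' : ModerateGrowth F) (m : ℕ) :
    ModerateGrowth (derivH m F) := by
  induction m with
  | zero => rwa [derivH_zero]
  | succ m ih =>
    rw [derivH_succ]
    exact ih.derivH_one (mdiff_derivH hF m)

/-! ### Geodesic polar coordinates -/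

/-- The Möbius transformation that maps the unit disc to the upper half-plane and `0` to `τ`. -/
def discMap (τ : ℍ) (u : ℂ) : ℂ := (-conj (τ : ℂ) * u + τ) / (-1 * u + 1)

theorem one_sub_ne_zero_of_norm_lt {u : ℂ} (hu : ‖u‖ < 1) : -1 * u + 1 ≠ 0 := by
  intro h
  have : u = 1 := by linear_combination -h
  simp [this] at hu

theorem discMap_im (τ : ℍ) (u : ℂ) :
    (discMap τ u).im = τ.im * (1 - ‖u‖ ^ 2) / ‖-1 * u + 1‖ ^ 2 := by
  rw [discMap, Complex.div_im, ← Complex.normSq_eq_norm_sq, ← Complex.normSq_eq_norm_sq,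
    ← sub_div]
  congr 1
  simp [Complex.normSq_apply]
  ring

theorem discMap_im_pos (τ : ℍ) {u : ℂ} (hu : ‖u‖ < 1) : 0 < (discMap τ u).im := by
  rw [discMap_im]
  have := τ.im_pos
  have h1 := norm_pos_iff.2 (one_sub_ne_zero_of_norm_lt hu)
  have h2 : 0 < 1 - ‖u‖ ^ 2 := by nlinarith [norm_nonneg u]
  positivity

/-- The point of the upper half-plane with disc coordinate `u` around `τ`. -/
def discPoint (τ : ℍ) (u : ℂ) : ℍ := ofComplex (discMap τ u)

theorem coe_discPoint (τ : ℍ) {u : ℂ} (hu : ‖u‖ < 1) : (discPoint τ u : ℂ) = discMap τ u := by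
  rw [discPoint, ofComplex_apply_of_im_pos (discMap_im_pos τ hu)]

theorem discPoint_im (τ : ℍ) {u : ℂ} (hu : ‖u‖ < 1) :
    (discPoint τ u).im = τ.im * (1 - ‖u‖ ^ 2) / ‖-1 * u + 1‖ ^ 2 := by
  rw [← discMap_im, ← coe_discPoint τ hu]
  rfl

/-- The disc coordinate of `z` around `τ`. -/
def discCoord (τ z : ℍ) : ℂ := ((z : ℂ) - τ) / ((z : ℂ) - conj (τ : ℂ))

theorem sub_conj_ne_zero (τ z : ℍ) : (z : ℂ) - conj (τ : ℂ) ≠ 0 := by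
  intro h
  have := congrArg Complex.im h
  simp at this
  have h1 := z.im_pos
  have h2 := τ.im_pos
  linarith

theorem discCoord_discPoint (τ : ℍ) {u : ℂ} (hu : ‖u‖ < 1) : discCoord τ (discPoint τ u) = u := by
  have h := one_sub_ne_zero_of_norm_lt hu
  have h1 := sub_conj_ne_zero τ (discPoint τ u)
  rw [discCoord, div_eq_iff h1, coe_discPoint τ hu, discMap, div_sub' h, div_sub' h, mul_div_assoc',
    div_left_inj' h]
  ring

theorem norm_discCoord_sq (τ z : ℍ) :
    1 - ‖discCoord τ z‖ ^ 2 = 4 * z.im * τ.im / ‖(z : ℂ) - conj (τ : ℂ)‖ ^ 2 := by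
  have h := norm_pos_iff.2 (sub_conj_ne_zero τ z)
  rw [discCoord, norm_div, div_pow, one_sub_div (by positivity), ← Complex.normSq_eq_norm_sq,
    ← Complex.normSq_eq_norm_sq]
  congr 1
  simp [Complex.normSq_apply]
  ring

theorem norm_discCoord_lt (τ z : ℍ) : ‖discCoord τ z‖ < 1 := by
  have h := norm_discCoord_sq τ z
  have h1 := norm_pos_iff.2 (sub_conj_ne_zero τ z)
  have h2 : 0 < 4 * z.im * τ.im / ‖(z : ℂ) - conj (τ : ℂ)‖ ^ 2 := by
    have := z.im_pos
    have := τ.im_pos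
    positivity
  nlinarith [norm_nonneg (discCoord τ z)]

theorem discPoint_discCoord (τ z : ℍ) : discPoint τ (discCoord τ z) = z := by
  have h := norm_discCoord_lt τ z
  have h1 := sub_conj_ne_zero τ z
  have h2 := one_sub_ne_zero_of_norm_lt h
  rw [UpperHalfPlane.ext_iff, coe_discPoint τ h, discMap, div_eq_iff h2, discCoord]
  field_simp
  ring

theorem hasDerivAt_discMap (τ : ℍ) {u : ℂ} (hu : ‖u‖ < 1) :
    HasDerivAt (discMap τ) (((τ : ℂ) - conj (τ : ℂ)) / (-1 * u + 1) ^ 2) u := by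
  have hj : HasDerivAt (fun u : ℂ => -1 * u + 1) (-1) u := by
    simpa using ((hasDerivAt_id u).const_mul (-1)).add_const 1
  have h := (((hasDerivAt_id u).const_mul (-conj (τ : ℂ))).add_const (τ : ℂ)).div hj
    (one_sub_ne_zero_of_norm_lt hu)
  refine h.congr_deriv ?_
  simp
  ring

theorem norm_sub_conj_self (τ : ℍ) : ‖(τ : ℂ) - conj (τ : ℂ)‖ = 2 * τ.im := by
  have := τ.im_pos
  rw [Complex.sub_conj, norm_mul, Complex.norm_I, mul_one, Complex.norm_real, Real.norm_eq_abs,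
    abs_of_pos (by positivity)]
  rfl

/-- The point with geodesic polar coordinates `p` around `τ`. -/
def polarPoint (τ : ℍ) (p : ℝ × ℝ) : ℍ := discPoint τ (circleMap 0 p.1 p.2)

/-- The domain of geodesic polar coordinates. -/
def polarRect : Set (ℝ × ℝ) := Set.Ioo 0 1 ×ˢ Set.Ioo (-Real.pi) Real.pi

theorem measurableSet_polarRect : MeasurableSet polarRect :=
  measurableSet_Ioo.prod measurableSet_Ioo

/-- The density of the hyperbolic area in geodesic polar coordinates. -/
def polarWeight (r : ℝ) : ℝ := 4 * r / (1 - r ^ 2) ^ 2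

theorem measurable_polarWeight : Measurable polarWeight := by
  unfold polarWeight
  fun_prop

theorem polarWeight_nonneg {r : ℝ} (hr : 0 ≤ r) : 0 ≤ polarWeight r := by
  unfold polarWeight
  positivity

theorem measurable_ofComplex : Measurable (ofComplex : ℂ → ℍ) := by
  have hms : MeasurableSet {z : ℂ | 0 < z.im} := isOpen_upperHalfPlaneSet.measurableSet
  refine measurable_of_restrict_of_restrict_compl hms ?_ ?_
  · refine Continuous.measurable (continuousOn_iff_continuous_domRestrict.1 fun z hz => ?_)
    exact (mdifferentiableAt_ofComplex hz).continuousAt.continuousWithinAt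
  -- Off the half-plane `ofComplex` takes a constant default value.
  · have h : ({z : ℂ | 0 < z.im}ᶜ).domRestrict (ofComplex : ℂ → ℍ) = fun _ => ofComplex 0 :=
      funext fun z => ofComplex_apply_eq_of_im_nonpos (not_lt.1 z.2) (by simp)
    rw [h]
    exact measurable_const

theorem measurable_discPoint (τ : ℍ) : Measurable (discPoint τ) := by
  refine measurable_ofComplex.comp ?_
  unfold discMap
  fun_prop

theorem measurable_polarPoint (τ : ℍ) : Measurable (polarPoint τ) := by
  refine (measurable_discPoint τ).comp ?_
  unfold circleMap
  fun_prop

theorem coe_image_eq_discMap_image (τ : ℍ) (s : Set ℍ) :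
    ((↑) : ℍ → ℂ) '' s = discMap τ '' (Metric.ball 0 1 ∩ discPoint τ ⁻¹' s) := by
  ext z
  constructor
  · rintro ⟨w, hw, rfl⟩
    refine ⟨discCoord τ w, ⟨mem_ball_zero_iff.2 (norm_discCoord_lt τ w), ?_⟩, ?_⟩
    · rwa [Set.mem_preimage, discPoint_discCoord]
    · rw [← coe_discPoint τ (norm_discCoord_lt τ w), discPoint_discCoord]
  · rintro ⟨u, ⟨hu, hu'⟩, rfl⟩
    exact ⟨discPoint τ u, hu', coe_discPoint τ (mem_ball_zero_iff.1 hu)⟩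

/-- The Jacobian is `|discMap'|² = (2 Im τ / |1 - u|²)²`. Against the density `1 / y²` it leaves a
weight free of `τ`. -/
theorem volume_eq_lintegral_disc (τ : ℍ) {s : Set ℍ} (hs : MeasurableSet s) :
    volume s = ∫⁻ u in Metric.ball 0 1 ∩ discPoint τ ⁻¹' s,
      ENNReal.ofReal (4 / (1 - ‖u‖ ^ 2) ^ 2) := by
  have hms : MeasurableSet (Metric.ball 0 1 ∩ discPoint τ ⁻¹' s) :=
    measurableSet_ball.inter (measurable_discPoint τ hs)
  have hinj : Set.InjOn (discMap τ) (Metric.ball 0 1 ∩ discPoint τ ⁻¹' s) := by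
    rintro u ⟨hu, -⟩ v ⟨hv, -⟩ huv
    rw [mem_ball_zero_iff] at hu hv
    rw [← discCoord_discPoint τ hu, ← discCoord_discPoint τ hv, discPoint, discPoint, huv]
  rw [volume_eq_lintegral, coe_image_eq_discMap_image τ s,
    lintegral_image_eq_lintegral_abs_det_fderiv_mul volume hms
      (fun u hu => ((hasDerivAt_discMap τ
        (mem_ball_zero_iff.1 hu.1)).hasFDerivAt.restrictScalars ℝ).hasFDerivWithinAt) hinj]
  refine setLIntegral_congr_fun hms fun u hu => ?_
  have hu1 := mem_ball_zero_iff.1 hu.1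
  have h0 := norm_pos_iff.2 (one_sub_ne_zero_of_norm_lt hu1)
  have hpos := discMap_im_pos τ hu1
  have h2 : 0 < 1 - ‖u‖ ^ 2 := by nlinarith [norm_nonneg u]
  have h3 := τ.im_pos
  have hdet : ((ContinuousLinearMap.toSpanSingleton ℂ
      (((τ : ℂ) - conj (τ : ℂ)) / (-1 * u + 1) ^ 2)).restrictScalars ℝ).det =
      (2 * τ.im / ‖-1 * u + 1‖ ^ 2) ^ 2 := by
    rw [← norm_sub_conj_self, ← norm_pow, ← norm_div, ← Complex.normSq_eq_norm_sq]
    simp [ContinuousLinearMap.det, LinearMap.det_restrictScalars, Algebra.norm_complex_eq]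
  have hw : (((1 / ‖(discMap τ u).im‖₊) ^ 2 : NNReal) : ENNReal) =
      ENNReal.ofReal ((1 / (discMap τ u).im) ^ 2) := by
    rw [ENNReal.ofReal, ENNReal.coe_inj, ← NNReal.coe_inj, Real.coe_toNNReal _ (by positivity)]
    simp
  rw [hw, ← ENNReal.ofReal_mul (abs_nonneg _)]
  congr 1
  have h5 : ((ContinuousLinearMap.toSpanSingleton ℂ
      (((τ : ℂ) - conj (τ : ℂ)) / (-1 * u + 1) ^ 2)).restrictScalars ℝ).det =
      (2 * τ.im / ‖-1 * u + 1‖ ^ 2) ^ 2 := hdet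
  rw [h5, abs_of_nonneg (by positivity), discMap_im]
  generalize ‖-1 * u + 1‖ = t at h0
  field_simp
  ring

theorem measurable_polarDensity :
    Measurable fun p : ℝ × ℝ => ENNReal.ofReal (polarWeight p.1) :=
  (measurable_polarWeight.comp measurable_fst).ennreal_ofReal

theorem volume_eq_map_polar (τ : ℍ) :
    (volume : Measure ℍ) = ((volume.restrict polarRect).withDensity
      fun p => ENNReal.ofReal (polarWeight p.1)).map (polarPoint τ) := by
  ext s hs
  have hms : MeasurableSet (Metric.ball 0 1 ∩ discPoint τ ⁻¹' s) :=
    measurableSet_ball.inter (measurable_discPoint τ hs)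
  rw [Measure.map_apply (measurable_polarPoint τ) hs, withDensity_apply' _ _,
    volume_eq_lintegral_disc τ hs, ← lintegral_indicator hms,
    ← Complex.lintegral_comp_polarCoord_symm,
    Measure.restrict_restrict (measurable_polarPoint τ hs),
    ← lintegral_indicator ((measurable_polarPoint τ hs).inter measurableSet_polarRect),
    ← lintegral_indicator (by exact measurableSet_Ioi.prod measurableSet_Ioo)]
  refine lintegral_congr fun p => ?_
  have hc : Complex.polarCoord.symm p = circleMap 0 p.1 p.2 := by
    rw [Complex.polarCoord_symm_apply, circleMap, zero_add, Complex.exp_mul_I]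
    simp
  by_cases hp : p ∈ polarCoord.target
  · have hp0 : 0 < p.1 := hp.1
    have hn : ‖circleMap 0 p.1 p.2‖ = p.1 := by rw [norm_circleMap_zero, abs_of_pos hp0]
    rw [Set.indicator_of_mem hp, hc]
    by_cases hq : p ∈ polarPoint τ ⁻¹' s ∩ polarRect
    · have hm : circleMap 0 p.1 p.2 ∈ Metric.ball 0 1 ∩ discPoint τ ⁻¹' s :=
        ⟨by rw [mem_ball_zero_iff, hn]; exact hq.2.1.2, hq.1⟩
      rw [Set.indicator_of_mem hq, Set.indicator_of_mem hm, smul_eq_mul,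
        ← ENNReal.ofReal_mul hp0.le, hn, polarWeight]
      congr 1
      ring
    · have hm : circleMap 0 p.1 p.2 ∉ Metric.ball 0 1 ∩ discPoint τ ⁻¹' s := by
        rintro ⟨h1, h2⟩
        rw [mem_ball_zero_iff, hn] at h1
        exact hq ⟨h2, ⟨hp0, h1⟩, hp.2⟩
      rw [Set.indicator_of_notMem hq, Set.indicator_of_notMem hm, smul_zero]
  · have hq : p ∉ polarPoint τ ⁻¹' s ∩ polarRect := fun h => hp ⟨h.2.1.1, h.2.2⟩
    rw [Set.indicator_of_notMem hp, Set.indicator_of_notMem hq]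

theorem lintegral_eq_lintegral_polar (τ : ℍ) {g : ℍ → ENNReal} (hg : Measurable g) :
    ∫⁻ z, g z = ∫⁻ r in Set.Ioo 0 1, ENNReal.ofReal (polarWeight r) *
      ∫⁻ θ in Set.Ioo (-Real.pi) Real.pi, g (polarPoint τ (r, θ)) := by
  have h1 : Measurable fun p => g (polarPoint τ p) := hg.comp (measurable_polarPoint τ)
  have h2 := measurable_polarDensity
  rw [volume_eq_map_polar τ, lintegral_map hg (measurable_polarPoint τ),
    lintegral_withDensity_eq_lintegral_mul (g := fun p => g (polarPoint τ p)) _ h2 h1, polarRect, Measure.volume_eq_prod,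
    ← Measure.prod_restrict, lintegral_prod _ (h2.mul h1).aemeasurable]
  refine lintegral_congr fun r => ?_
  exact lintegral_const_mul (μ := volume.restrict (Set.Ioo (-Real.pi) Real.pi))
    (ENNReal.ofReal (polarWeight r)) (h1.comp (measurable_prodMk_left (x := r)))

theorem integrable_polar (τ : ℍ) {g : ℍ → ℂ} (hg : Integrable g) :
    Integrable (fun p : ℝ × ℝ => (polarWeight p.1 : ℂ) * g (polarPoint τ p))
      ((volume.restrict (Set.Ioo 0 1)).prod (volume.restrict (Set.Ioo (-Real.pi) Real.pi))) := by
  rw [volume_eq_map_polar τ] at hg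
  have h := hg.comp_measurable (measurable_polarPoint τ)
  rw [integrable_withDensity_iff_integrable_smul₀'
    measurable_polarDensity.aemeasurable (by simp)] at h
  rw [Measure.prod_restrict, ← Measure.volume_eq_prod]
  refine h.congr ?_
  filter_upwards [ae_restrict_mem measurableSet_polarRect] with p hp
  rw [ENNReal.toReal_ofReal (polarWeight_nonneg hp.1.1.le), Complex.real_smul]
  rfl

theorem integral_eq_integral_polar (τ : ℍ) {g : ℍ → ℂ} (hg : Integrable g) :
    ∫ z, g z = ∫ r in Set.Ioo 0 1, (polarWeight r : ℂ) *
      ∫ θ in Set.Ioo (-Real.pi) Real.pi, g (polarPoint τ (r, θ)) := by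
  have h0 := integrable_polar τ hg
  rw [volume_eq_map_polar τ] at hg
  have h1 := hg.1
  rw [volume_eq_map_polar τ, integral_map (measurable_polarPoint τ).aemeasurable h1,
    integral_withDensity_eq_integral_toReal_smul₀
    measurable_polarDensity.aemeasurable (by simp)]
  have h2 := integral_prod _ h0
  simp only [integral_const_mul] at h2
  rw [← h2, Measure.prod_restrict, ← Measure.volume_eq_prod]
  refine integral_congr_ae ?_
  filter_upwards [ae_restrict_mem measurableSet_polarRect] with p hp
  rw [ENNReal.toReal_ofReal (polarWeight_nonneg hp.1.1.le), Complex.real_smul]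

/-! ### Lattices -/

theorem measurePreserving_SL_smul (γ : SL(2, ℝ)) :
    MeasurePreserving (fun z : ℍ => γ • z) volume volume :=
  measurePreserving_smul (γ : GL (Fin 2) ℝ) (volume : Measure ℍ)

theorem measurable_SL_smul (γ : SL(2, ℝ)) : Measurable fun z : ℍ => γ • z :=
  (measurePreserving_SL_smul γ).measurable

theorem volume_pos_of_isOpen {U : Set ℍ} (hU : IsOpen U) (hne : U.Nonempty) : 0 < volume U := by
  rw [volume_eq_lintegral]
  have hU' : IsOpen (((↑) : ℍ → ℂ) '' U) := isOpenEmbedding_coe.isOpenMap U hU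
  rw [setLIntegral_pos_iff (by fun_prop)]
  refine lt_of_lt_of_le (hU'.measure_pos volume (hne.image _)) (measure_mono ?_)
  rintro _ ⟨z, hz, rfl⟩
  refine ⟨?_, z, hz, rfl⟩
  simpa using z.im_ne_zero

theorem IsLattice.countable {Γ : Subgroup SL(2, ℝ)} (hΓ : IsLattice Γ) : Countable Γ := by
  have := hΓ.discrete
  have h1 : SecondCountableTopology (Matrix (Fin 2) (Fin 2) ℝ) :=
    inferInstanceAs (SecondCountableTopology (Fin 2 → Fin 2 → ℝ))
  have h2 : SecondCountableTopology SL(2, ℝ) :=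
    Matrix.SpecialLinearGroup.isClosedEmbedding_val.isEmbedding.secondCountableTopology
  exact TopologicalSpace.separableSpace_iff_countable.1 inferInstance

/-- Unfolding: the translates of `S` cover the half-plane, and invariance of the area moves each of
them back to `S`. Only an inequality, since the translates may overlap. -/
theorem lintegral_le_lintegral_tsum {Γ : Subgroup SL(2, ℝ)} [Countable Γ] {S : Set ℍ}
    (hS : MeasurableSet S) (hcov : ∀ τ : ℍ, ∃ γ ∈ Γ, γ • τ ∈ S) {g : ℍ → ENNReal}
    (hg : Measurable g) :
    ∫⁻ z, g z ≤ ∫⁻ z in S, ∑' γ : Γ, g ((γ : SL(2, ℝ))⁻¹ • z) := by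
  have hU : (Set.univ : Set ℍ) = ⋃ γ : Γ, (fun z : ℍ => (γ : SL(2, ℝ)) • z) ⁻¹' S := by
    ext τ
    obtain ⟨γ, hγ, h⟩ := hcov τ
    simpa using ⟨γ, hγ, h⟩
  rw [← setLIntegral_univ, hU, lintegral_tsum (β := Γ)
    (f := fun γ z => g ((γ : SL(2, ℝ))⁻¹ • z)) fun γ => (hg.comp (measurable_SL_smul (γ : SL(2, ℝ))⁻¹)).aemeasurable]
  refine (lintegral_iUnion_le _ _).trans (ENNReal.tsum_le_tsum fun γ => le_of_eq ?_)
  rw [← (measurePreserving_SL_smul (γ : SL(2, ℝ))).setLIntegral_comp_preimage hS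
    (f := fun z => g ((γ : SL(2, ℝ))⁻¹ • z)) (hg.comp (measurable_SL_smul (γ : SL(2, ℝ))⁻¹))]
  simp

/-- If some translate of `τ` lies in `B`, the count for `τ` equals the count for that point of `B`,
which proper discontinuity bounds by the number of `γ` for which `γ B` meets `B`. -/
theorem exists_tsum_indicator_le {Γ : Subgroup SL(2, ℝ)} [DiscreteTopology Γ] {B : Set ℍ}
    (hB : IsCompact B) :
    ∃ M : ℕ, ∀ τ : ℍ, ∑' γ : Γ, B.indicator (1 : ℍ → ENNReal) ((γ : SL(2, ℝ))⁻¹ • τ) ≤ M := by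
  classical
  have hfin := ProperlyDiscontinuousSMul.finite_disjoint_inter_image (Γ := Γ) hB hB
  refine ⟨hfin.toFinset.card, fun τ => ?_⟩
  by_cases h : ∃ γ₀ : Γ, (γ₀ : SL(2, ℝ))⁻¹ • τ ∈ B
  · obtain ⟨γ₀, hγ₀⟩ := h
    calc ∑' γ : Γ, B.indicator (1 : ℍ → ENNReal) ((γ : SL(2, ℝ))⁻¹ • τ)
        = ∑' γ : Γ, B.indicator (1 : ℍ → ENNReal) ((γ : SL(2, ℝ)) • (γ₀ : SL(2, ℝ))⁻¹ • τ) := by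
          rw [← ((Equiv.inv Γ).trans (Equiv.mulLeft γ₀)).tsum_eq]
          refine tsum_congr fun γ => ?_
          simp [smul_smul]
      _ ≤ ∑' γ : Γ, (hfin.toFinset : Set Γ).indicator (1 : Γ → ENNReal) γ := by
          refine ENNReal.tsum_le_tsum fun γ => ?_
          by_cases hγ : (γ : SL(2, ℝ)) • (γ₀ : SL(2, ℝ))⁻¹ • τ ∈ B
          · have : γ ∈ (hfin.toFinset : Set Γ) := by
              simp only [Set.Finite.coe_toFinset, Set.mem_ofPred_eq]
              exact ⟨(γ : SL(2, ℝ)) • (γ₀ : SL(2, ℝ))⁻¹ • τ, ⟨_, hγ₀, rfl⟩, hγ⟩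
            rw [Set.indicator_of_mem this]
            exact Set.indicator_le_self' (by simp) _
          · rw [Set.indicator_of_notMem hγ]
            exact zero_le
      _ = hfin.toFinset.card := by
          rw [← tsum_subtype, Finset.tsum_subtype' hfin.toFinset (1 : Γ → ENNReal)]
          simp
  · push Not at h
    rw [ENNReal.tsum_eq_zero.2 fun γ => Set.indicator_of_notMem (h γ) _]
    exact zero_le

/-- The point is that `M` depends on `B` and `Γ` only: covering sets cannot have arbitrarily small
area. -/
theorem volume_le_mul_volume {Γ : Subgroup SL(2, ℝ)} [DiscreteTopology Γ] [Countable Γ] {B : Set ℍ}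
    (hB : IsCompact B) :
    ∃ M : ℕ, ∀ S : Set ℍ, MeasurableSet S → (∀ τ : ℍ, ∃ γ ∈ Γ, γ • τ ∈ S) →
      volume B ≤ M * volume S := by
  obtain ⟨M, hM⟩ := exists_tsum_indicator_le (Γ := Γ) hB
  refine ⟨M, fun S hS hcov => ?_⟩
  rw [← lintegral_indicator_one hB.isClosed.measurableSet]
  refine (lintegral_le_lintegral_tsum hS hcov
    (measurable_one.indicator hB.isClosed.measurableSet)).trans ?_
  refine (lintegral_mono fun τ => hM τ).trans ?_
  rw [setLIntegral_const]

/-- After exchanging the integrals, the `z`-integral is unfolded to `S`. Invariance of `κ` moves the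
sum over `Γ` onto the indicator of `B`, where it is at most `M`, and the remaining integral over `τ`
is `V`. -/
theorem lintegral_kernel_le {Γ : Subgroup SL(2, ℝ)} [DiscreteTopology Γ] [Countable Γ] {B : Set ℍ}
    (hB : IsCompact B) :
    ∃ M : ℕ, ∀ (S E : Set ℍ) (κ : ℍ → ℍ → ENNReal) (V : ENNReal), MeasurableSet S →
      (∀ τ : ℍ, ∃ γ ∈ Γ, γ • τ ∈ S) → MeasurableSet E → (∀ γ ∈ Γ, ∀ z, γ • z ∈ E ↔ z ∈ E) →
      Measurable (fun p : ℍ × ℍ => κ p.1 p.2) → (∀ γ ∈ Γ, ∀ τ z, κ (γ • τ) (γ • z) = κ τ z) →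
      (∀ z, ∫⁻ τ, κ τ z = V) →
      ∫⁻ τ in B, ∫⁻ z in E, κ τ z ≤ M * V * volume (S ∩ E) := by
  obtain ⟨M, hM⟩ := exists_tsum_indicator_le (Γ := Γ) hB
  refine ⟨M, fun S E κ V hS hcov hE hinv hκ hκinv hV => ?_⟩
  have hBm := hB.isClosed.measurableSet
  have hsm : Measurable fun p : ℍ × ℍ => κ p.2 p.1 := hκ.comp measurable_swap
  have hcomm : ∫⁻ τ in B, ∫⁻ z in E, κ τ z = ∫⁻ z in E, ∫⁻ τ in B, κ τ z :=
    lintegral_lintegral_swap hκ.aemeasurable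
  set b : ℍ → ENNReal := fun z => ∫⁻ τ in B, κ τ z with hb
  have hbm : Measurable b := hsm.lintegral_prod_right'
  have hbt : ∀ (γ : Γ) (z : ℍ), b ((γ : SL(2, ℝ))⁻¹ • z) =
      ∫⁻ τ, B.indicator (1 : ℍ → ENNReal) ((γ : SL(2, ℝ))⁻¹ • τ) * κ τ z := by
    intro γ z
    have h2 : Measurable fun τ => B.indicator (1 : ℍ → ENNReal) ((γ : SL(2, ℝ))⁻¹ • τ) * κ τ z :=
      ((measurable_one.indicator hBm).comp (measurable_SL_smul _)).mul
        (hκ.comp measurable_prodMk_right)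
    rw [← (measurePreserving_SL_smul (γ : SL(2, ℝ))).lintegral_comp h2, hb]
    beta_reduce
    rw [← lintegral_indicator hBm]
    refine lintegral_congr fun τ => ?_
    rw [inv_smul_smul]
    by_cases h : τ ∈ B
    · rw [Set.indicator_of_mem h, Set.indicator_of_mem h, Pi.one_apply, one_mul,
        ← hκinv γ γ.2 τ, smul_inv_smul]
    · rw [Set.indicator_of_notMem h, Set.indicator_of_notMem h, zero_mul]
  have hsum : ∀ z, ∑' γ : Γ, b ((γ : SL(2, ℝ))⁻¹ • z) ≤ M * V := by
    intro z
    simp only [hbt]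
    rw [← lintegral_tsum fun γ => ?_]
    · simp only [ENNReal.tsum_mul_right]
      rw [← hV z, ← lintegral_const_mul (M : ENNReal) (f := fun τ => κ τ z)
        (hκ.comp measurable_prodMk_right)]
      exact lintegral_mono fun τ => mul_le_mul_left (hM τ) _
    · exact (((measurable_one.indicator hBm).comp (measurable_SL_smul _)).mul
        (hκ.comp measurable_prodMk_right)).aemeasurable
  rw [hcomm, ← lintegral_indicator hE]
  refine (lintegral_le_lintegral_tsum hS hcov (hbm.indicator hE)).trans ?_
  calc ∫⁻ z in S, ∑' γ : Γ, E.indicator b ((γ : SL(2, ℝ))⁻¹ • z)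
      ≤ ∫⁻ z in S, E.indicator (fun _ => M * V) z := by
        refine lintegral_mono fun z => ?_
        by_cases h : z ∈ E
        · rw [Set.indicator_of_mem h]
          exact (ENNReal.tsum_le_tsum fun γ => Set.indicator_le_self' (by simp) _).trans (hsum z)
        · rw [Set.indicator_of_notMem h, ENNReal.tsum_eq_zero.2 fun γ => ?_]
          refine Set.indicator_of_notMem (fun h' => h ?_) _
          exact (hinv _ (inv_mem γ.2) z).1 h'
    _ = M * V * volume (S ∩ E) := by
        rw [lintegral_indicator hE, setLIntegral_const, Measure.restrict_apply hE, Set.inter_comm]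

/-! ### Orbits of cusps -/

/-- The map `x + i y ↦ x + i t y`. -/
def stretch (t : ℝ) (ht : 0 < t) (z : ℍ) : ℍ := ⟨⟨z.re, t * z.im⟩, mul_pos ht z.im_pos⟩

theorem stretch_stretch_inv (t : ℝ) (ht : 0 < t) (z : ℍ) :
    stretch t ht (stretch t⁻¹ (inv_pos.2 ht) z) = z := by
  rw [UpperHalfPlane.ext_iff]
  apply Complex.ext
  · rfl
  · change t * (t⁻¹ * z.im) = z.im
    field_simp

theorem stretch_inv_stretch (t : ℝ) (ht : 0 < t) (z : ℍ) :
    stretch t⁻¹ (inv_pos.2 ht) (stretch t ht z) = z := by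
  rw [UpperHalfPlane.ext_iff]
  apply Complex.ext
  · rfl
  · change t⁻¹ * (t * z.im) = z.im
    field_simp

theorem measurable_stretch (t : ℝ) (ht : 0 < t) : Measurable (stretch t ht) := by
  have h : Measurable fun z : ℍ => (stretch t ht z : ℂ) := by
    have h2 : (fun z : ℍ => (stretch t ht z : ℂ)) =
        fun z : ℍ => ((z : ℂ).re : ℂ) + ((t * (z : ℂ).im : ℝ) : ℂ) * Complex.I := by
      funext z
      rw [← Complex.mk_eq_add_mul_I]
      rfl
    rw [h2]
    fun_prop
  exact measurableEmbedding_coe.measurable_comp_iff.1 h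

theorem SL_smul_coe (γ : SL(2, ℝ)) (z : ℍ) :
    ((γ • z : ℍ) : ℂ) = ((γ 0 0 : ℂ) * z + γ 0 1) / ((γ 1 0 : ℂ) * z + γ 1 1) := by
  rw [UpperHalfPlane.specialLinearGroup_apply]
  simp

theorem SL_det (γ : SL(2, ℝ)) : γ 0 0 * γ 1 1 - γ 0 1 * γ 1 0 = 1 := by
  rw [← Matrix.det_fin_two]
  exact γ.2

/-- An upper triangular `γ` acts by a real affine map, which treats real and imaginary parts
separately and only scales the latter. -/
theorem stretch_smul (t : ℝ) (ht : 0 < t) {γ : SL(2, ℝ)} (hγ : γ 1 0 = 0) (z : ℍ) :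
    γ • stretch t ht z = stretch t ht (γ • z) := by
  have hd := SL_det γ
  rw [hγ, mul_zero, sub_zero] at hd
  have hd0 : γ 1 1 ≠ 0 := right_ne_zero_of_mul_eq_one hd
  have hre : ∀ z : ℍ, ((γ • z : ℍ) : ℂ).re = (γ 0 0 * z.re + γ 0 1) / γ 1 1 := by
    intro z
    rw [SL_smul_coe, hγ]
    simp [Complex.div_re, Complex.normSq_apply]
    field_simp
  have him : ∀ z : ℍ, ((γ • z : ℍ) : ℂ).im = γ 0 0 * z.im / γ 1 1 := by
    intro z
    rw [SL_smul_coe, hγ]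
    simp [Complex.div_im, Complex.normSq_apply]
    field_simp
  rw [UpperHalfPlane.ext_iff]
  apply Complex.ext
  · rw [hre]
    change _ = ((γ • z : ℍ) : ℂ).re
    rw [hre]
    rfl
  · rw [him]
    change γ 0 0 * (t * z.im) / γ 1 1 = t * ((γ • z : ℍ) : ℂ).im
    rw [him]
    ring

theorem volume_stretch (t : ℝ) (ht : 0 < t) {S : Set ℍ} (hS : MeasurableSet S) :
    volume (stretch t⁻¹ (inv_pos.2 ht) ⁻¹' S) = ENNReal.ofReal t⁻¹ * volume S := by
  set L : ℂ →ₗ[ℝ] ℂ := Matrix.toLin Complex.basisOneI Complex.basisOneI !![1, 0; 0, t] with hL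
  have hLa : ∀ z : ℂ, L z = ⟨z.re, t * z.im⟩ := by
    intro z
    rw [hL, Matrix.toLin_apply]
    apply Complex.ext <;> simp [Matrix.mulVec, Matrix.vecHead, Matrix.vecTail, Fin.sum_univ_two, Complex.coe_basisOneI]
  set L' : ℂ →L[ℝ] ℂ := LinearMap.toContinuousLinearMap L with hL'
  have hLdet : L'.det = t := by
    rw [hL', ContinuousLinearMap.det]
    simp [hL, LinearMap.det_toLin, Matrix.det_fin_two]
  have himage : ((↑) : ℍ → ℂ) '' (stretch t⁻¹ (inv_pos.2 ht) ⁻¹' S) = L' '' (((↑) : ℍ → ℂ) '' S) := by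
    have hc : ∀ z : ℍ, L' z = stretch t ht z := fun z => hLa z
    ext w
    constructor
    · rintro ⟨z, hz, rfl⟩
      refine ⟨_, ⟨_, hz, rfl⟩, ?_⟩
      rw [hc, stretch_stretch_inv]
    · rintro ⟨_, ⟨z, hz, rfl⟩, rfl⟩
      refine ⟨stretch t ht z, ?_, (hc z).symm⟩
      rwa [Set.mem_preimage, stretch_inv_stretch]
  have hinj : Set.InjOn L' (((↑) : ℍ → ℂ) '' S) := by
    intro z _ w _ h
    have h' : (⟨z.re, t * z.im⟩ : ℂ) = ⟨w.re, t * w.im⟩ := by rw [← hLa, ← hLa]; exact h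
    simp only [Complex.mk.injEq, mul_eq_mul_left_iff, ht.ne', or_false] at h'
    exact Complex.ext h'.1 h'.2
  have hm := measurableEmbedding_coe.measurableSet_image.2 hS
  rw [volume_eq_lintegral, volume_eq_lintegral, himage,
    lintegral_image_eq_lintegral_abs_det_fderiv_mul volume hm
      (fun z _ => L'.hasFDerivWithinAt) hinj, ← lintegral_const_mul _ (by fun_prop)]
  refine setLIntegral_congr_fun hm ?_
  rintro _ ⟨z, -, rfl⟩
  have h1 : (L' z).im = t * z.im := congrArg Complex.im (hLa z)
  have hz := z.im_pos
  have e : ∀ x : ℝ, 0 < x → (((1 / ‖x‖₊) ^ 2 : NNReal) : ENNReal) = ENNReal.ofReal ((1 / x) ^ 2) := by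
    intro x hx
    rw [ENNReal.ofReal, ENNReal.coe_inj, ← NNReal.coe_inj, Real.coe_toNNReal _ (by positivity)]
    simp
  have h2 : (z : ℂ).im = z.im := rfl
  beta_reduce
  rw [h1, h2, e _ (by positivity), e _ hz, hLdet, abs_of_pos ht, ← ENNReal.ofReal_mul ht.le,
    ← ENNReal.ofReal_mul (by positivity)]
  congr 1
  field_simp

/-- Otherwise finitely many cosets of the upper triangular elements exhaust `Γ`, so these elements
alone translate every point into a set `S'` of finite area. They commute with `stretch`, so the
stretched sets cover too; but their area tends to `0`, against `volume_le_mul_volume`. -/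
theorem IsLattice.exists_cross_ne_zero {Γ : Subgroup SL(2, ℝ)} (hΓ : IsLattice Γ)
    (s : Finset SL(2, ℝ)) (hs : ∀ α ∈ s, α ∈ Γ) :
    ∃ γ ∈ Γ, ∀ α ∈ s, γ 1 0 * α 1 1 - γ 1 1 * α 1 0 ≠ 0 := by
  by_contra! hcon
  have := hΓ.discrete
  have := hΓ.countable
  obtain ⟨S, hS, hfin, hcov⟩ := hΓ.finite_covolume
  obtain ⟨M, hM⟩ := volume_le_mul_volume (Γ := Γ) (isCompact_closedBall I 1)
  have hpos : 0 < volume (Metric.closedBall I 1) :=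
    (volume_pos_of_isOpen Metric.isOpen_ball ⟨I, Metric.mem_ball_self one_pos⟩).trans_le
      (measure_mono Metric.ball_subset_closedBall)
  set S' : Set ℍ := ⋃ α ∈ s, (fun z : ℍ => α⁻¹ • z) ⁻¹' S with hS'
  have hS'm : MeasurableSet S' :=
    Finset.measurableSet_biUnion s fun α _ => measurable_SL_smul α⁻¹ hS
  have hS'fin : volume S' < ⊤ := by
    refine (measure_biUnion_finset_le s _).trans_lt (ENNReal.sum_lt_top.2 fun α _ => ?_)
    rwa [(measurePreserving_SL_smul α⁻¹).measure_preimage hS.nullMeasurableSet]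
  have hcov' : ∀ τ : ℍ, ∃ γ ∈ Γ, γ 1 0 = 0 ∧ γ • τ ∈ S' := by
    intro τ
    obtain ⟨γ, hγ, h⟩ := hcov τ
    -- Proportionality of the bottom rows of `γ⁻¹` and `α` says exactly that `α * γ` is upper
    -- triangular.
    obtain ⟨α, hα, hc⟩ := hcon γ⁻¹ (inv_mem hγ)
    refine ⟨α * γ, mul_mem (hs α hα) hγ, ?_, ?_⟩
    · simp [Matrix.SpecialLinearGroup.SL2_inv_expl] at hc
      simp [Matrix.mul_apply, Fin.sum_univ_two]
      linarith
    · rw [hS']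
      refine Set.mem_biUnion hα ?_
      rw [Set.mem_preimage, mul_smul, inv_smul_smul]
      exact h
  have hle : ∀ t : ℝ, 0 < t → volume (Metric.closedBall I 1) ≤ M * (ENNReal.ofReal t⁻¹ * volume S') := by
    intro t ht
    rw [← volume_stretch t ht hS'm]
    refine hM _ (measurable_stretch _ _ hS'm) fun τ => ?_
    obtain ⟨γ, hγ, h0, h⟩ := hcov' (stretch t⁻¹ (inv_pos.2 ht) τ)
    refine ⟨γ, hγ, ?_⟩
    rwa [Set.mem_preimage, ← stretch_smul _ _ h0]
  have hlim : Filter.Tendsto (fun t : ℝ => (M : ENNReal) * (ENNReal.ofReal t⁻¹ * volume S'))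
      Filter.atTop (nhds 0) := by
    have h1 : Filter.Tendsto (fun t : ℝ => ENNReal.ofReal t⁻¹) Filter.atTop (nhds 0) := by
      simpa using ENNReal.tendsto_ofReal tendsto_inv_atTop_zero
    have h2 := ENNReal.Tendsto.mul_const h1 (Or.inr hS'fin.ne)
    have h3 := ENNReal.Tendsto.const_mul (a := (M : ENNReal)) h2 (Or.inr (ENNReal.natCast_ne_top M))
    simpa using h3
  have := ge_of_tendsto hlim (Filter.eventually_atTop.2 ⟨1, fun t ht => hle t (by linarith)⟩)
  exact absurd this (not_le.2 hpos)

/-! ### Circle averages in disc coordinates -/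

theorem circleAverage_eq_setIntegral {E : Type*} [NormedAddCommGroup E] [NormedSpace ℝ E]
    (f : ℂ → E) (r : ℝ) :
    Real.circleAverage f 0 r =
      (2 * Real.pi)⁻¹ • ∫ θ in Set.Ioo (-Real.pi) Real.pi, f (circleMap 0 r θ) := by
  have hper : Function.Periodic (fun θ => f (circleMap 0 r θ)) (2 * Real.pi) := fun θ => by
    simp [periodic_circleMap 0 r θ]
  have h := hper.intervalIntegral_add_eq 0 (-Real.pi)
  rw [zero_add, show -Real.pi + 2 * Real.pi = Real.pi by ring] at h
  rw [Real.circleAverage_def, h, intervalIntegral.integral_of_le (by linarith [Real.pi_pos]),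
    integral_Ioc_eq_integral_Ioo]

/-- Jensen's formula, in which every zero `u` in the disc contributes the nonnegative amount `log (r
/ |u|)` times its order. -/
theorem log_norm_le_circleAverage {f : ℂ → ℂ} {r : ℝ} (hr : 0 < r)
    (hf : AnalyticOnNhd ℂ f (Metric.closedBall 0 r)) (h0 : f 0 ≠ 0) :
    Real.log ‖f 0‖ ≤ Real.circleAverage (fun u => Real.log ‖f u‖) 0 r := by
  have hr' : |r| = r := abs_of_pos hr
  rw [AnalyticOnNhd.circleAverage_log_norm hr.ne' (by rwa [hr']) h0, hr', le_add_iff_nonneg_left]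
  refine finsum_nonneg fun u => ?_
  by_cases hu : u ∈ Metric.closedBall (0 : ℂ) r
  · refine mul_nonneg ?_ ?_
    · exact_mod_cast MeromorphicOn.AnalyticOnNhd.divisor_nonneg hf u
    · rcases eq_or_ne u 0 with rfl | hu0
      · simp
      · rw [mem_closedBall_zero_iff] at hu
        rw [zero_sub, norm_neg]
        refine Real.log_nonneg ?_
        rw [← div_eq_mul_inv, one_le_div (norm_pos_iff.2 hu0)]
        exact hu
  · rw [Function.locallyFinsuppWithin.apply_eq_zero_of_notMem _ hu]
    simp

theorem differentiableOn_disc {f : ℍ → ℂ} (hf : MDiff f) (τ : ℍ) (s : ℤ) :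
    DifferentiableOn ℂ (fun u => (-1 * u + 1) ^ s * (f ∘ ofComplex) (discMap τ u))
      (Metric.ball 0 1) := by
  intro u hu
  rw [mem_ball_zero_iff] at hu
  have h1 : DifferentiableAt ℂ (fun u : ℂ => -1 * u + 1) u := by fun_prop
  have h2 := (analyticAt_comp_ofComplex hf (discMap_im_pos τ hu)).differentiableAt
  have h3 : DifferentiableAt ℂ (fun u => (f ∘ ofComplex) (discMap τ u)) u :=
    DifferentiableAt.comp (g := f ∘ ofComplex) u h2 (hasDerivAt_discMap τ hu).differentiableAt
  exact ((h1.zpow (Or.inl (one_sub_ne_zero_of_norm_lt hu))).mul h3).differentiableWithinAt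

theorem norm_discCoord (τ z : ℍ) : ‖discCoord τ z‖ = Real.tanh (dist z τ / 2) := by
  rw [discCoord, norm_div, tanh_half_dist, Complex.dist_eq, Complex.dist_eq]

theorem norm_discCoord_comm (τ z : ℍ) : ‖discCoord τ z‖ = ‖discCoord z τ‖ := by
  rw [norm_discCoord, norm_discCoord, dist_comm]

theorem norm_discCoord_smul (γ : SL(2, ℝ)) (τ z : ℍ) :
    ‖discCoord (γ • τ) (γ • z)‖ = ‖discCoord τ z‖ := by
  rw [norm_discCoord, norm_discCoord, dist_smul]

theorem measurable_discCoord : Measurable fun p : ℍ × ℍ => discCoord p.1 p.2 := by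
  have h1 : Measurable fun p : ℍ × ℍ => (p.1 : ℂ) := measurable_coe.comp measurable_fst
  have h2 : Measurable fun p : ℍ × ℍ => (p.2 : ℂ) := measurable_coe.comp measurable_snd
  exact (h2.sub h1).div (h2.sub (Complex.continuous_conj.measurable.comp h1))

/-- After taking logarithms, moderate growth costs only a multiple of `-log (1 - r²)` on the circle
of radius `r`, the same order as the gain in `log_petersson_add_le`. -/
theorem growth_discPoint_le (τ : ℍ) {u : ℂ} (hu : ‖u‖ < 1) :
    (1 + ‖(discPoint τ u : ℂ)‖ ^ 2) / (discPoint τ u).im ≤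
      4 * ((1 + ‖(τ : ℂ)‖ ^ 2) / τ.im) / (1 - ‖u‖ ^ 2) := by
  have h0 := norm_pos_iff.2 (one_sub_ne_zero_of_norm_lt hu)
  have h2 : 0 < 1 - ‖u‖ ^ 2 := by nlinarith [norm_nonneg u]
  have h3 := τ.im_pos
  rw [discPoint_im τ hu, coe_discPoint τ hu, discMap, norm_div, div_pow, one_add_div (by positivity),
    div_div_div_cancel_right₀ (by positivity), mul_div_assoc', div_div]
  refine div_le_div_of_nonneg_right ?_ (by positivity)
  have h4 : ‖-1 * u + 1‖ ≤ 2 := by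
    refine (norm_add_le _ _).trans ?_
    simp
    linarith
  have h5 : ‖-conj (τ : ℂ) * u + τ‖ ≤ 2 * ‖(τ : ℂ)‖ := by
    refine (norm_add_le _ _).trans ?_
    rw [norm_mul, norm_neg, Complex.norm_conj]
    nlinarith [norm_nonneg (τ : ℂ)]
  have h6 : 0 ≤ ‖-conj (τ : ℂ) * u + τ‖ := norm_nonneg _
  nlinarith [norm_nonneg (τ : ℂ)]

/-! ### Modular forms of negative weight -/

/-- The invariant function `|G| ^ 2 y ^ (-m)` attached to a modular form of weight `-m`. -/
def petersson (m : ℕ) (G : ℍ → ℂ) (τ : ℍ) : ℝ := ‖G τ‖ ^ 2 / τ.im ^ m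

theorem SL_denom_ne_zero (γ : SL(2, ℝ)) (τ : ℍ) : (γ 1 0 : ℂ) * τ + γ 1 1 ≠ 0 := by
  have h := denom_ne_zero (γ : GL (Fin 2) ℝ) τ
  simpa [denom] using h

theorem SL_smul_im (γ : SL(2, ℝ)) (τ : ℍ) :
    (γ • τ).im = τ.im / ‖(γ 1 0 : ℂ) * τ + γ 1 1‖ ^ 2 := by
  have h := SL_denom_ne_zero γ τ
  have h1 := norm_pos_iff.2 h
  have h2 : (γ • τ).im = ((γ • τ : ℍ) : ℂ).im := rfl
  have hd := SL_det γ
  rw [h2, SL_smul_coe, Complex.div_im, ← Complex.normSq_eq_norm_sq, ← sub_div]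
  congr 1
  simp
  linear_combination τ.im * hd

theorem petersson_smul {m : ℕ} {G : ℍ → ℂ} {γ : SL(2, ℝ)} {τ : ℍ}
    (h : G (γ • τ) * ((γ 1 0 : ℂ) * τ + γ 1 1) ^ m = G τ) :
    petersson m G (γ • τ) = petersson m G τ := by
  have h0 := norm_pos_iff.2 (SL_denom_ne_zero γ τ)
  have h1 := τ.im_pos
  rw [petersson, petersson, SL_smul_im, ← h, norm_mul, norm_pow, div_pow, mul_pow]
  field_simp
  ring

theorem petersson_le {m : ℕ} {G : ℍ → ℂ} (hG : ModerateGrowth G) :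
    ∃ (C : ℝ) (N : ℕ), 1 ≤ C ∧ 1 ≤ N ∧
      ∀ τ : ℍ, petersson m G τ ≤ C * ((1 + ‖(τ : ℂ)‖ ^ 2) / τ.im) ^ N := by
  obtain ⟨C, N, hC⟩ := hG
  refine ⟨C ^ 2 + 1, 2 * N + m + 1, by nlinarith [sq_nonneg C], by omega, fun τ => ?_⟩
  have h1 := one_le_growth τ
  have h2 := inv_im_le_growth τ
  set q := (1 + ‖(τ : ℂ)‖ ^ 2) / τ.im
  have hy := τ.im_pos
  calc petersson m G τ = ‖G τ‖ ^ 2 * (1 / τ.im) ^ m := by rw [petersson, one_div, inv_pow]; rfl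
    _ ≤ (C * q ^ N) ^ 2 * q ^ m := by gcongr; exact hC τ
    _ = C ^ 2 * q ^ (2 * N + m) := by ring
    _ ≤ (C ^ 2 + 1) * q ^ (2 * N + m + 1) := by
        have : q ^ (2 * N + m) ≤ q ^ (2 * N + m + 1) := pow_le_pow_right₀ h1 (by omega)
        gcongr
        linarith

/-- Since `y = Im τ (1 - r²) / |1 - u|²` on the circle `|u| = r`, the function `petersson m G`
agrees there with the norm of a holomorphic function `H`. At the centre `‖H 0‖` is larger than
`petersson m G τ` by the factor `(1 - r²)^(-m)`, which is the gain in Jensen's inequality. -/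
theorem log_petersson_add_le {m : ℕ} {G : ℍ → ℂ} (hG : MDiff G) {τ : ℍ} (h0 : G τ ≠ 0) {r : ℝ}
    (hr : 0 < r) (hr1 : r < 1) :
    Real.log (petersson m G τ) + m * -Real.log (1 - r ^ 2) ≤
        Real.circleAverage (fun u => Real.log (petersson m G (discPoint τ u))) 0 r ∧
      CircleIntegrable (fun u => Real.log (petersson m G (discPoint τ u))) 0 r := by
  have hy := τ.im_pos
  have h1r : 0 < 1 - r ^ 2 := by nlinarith
  set c : ℝ := 1 / (τ.im * (1 - r ^ 2)) ^ m with hc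
  have hcpos : 0 < c := by positivity
  set H : ℂ → ℂ := fun u => (c : ℂ) * ((-1 * u + 1) ^ (m : ℤ) * (G ∘ ofComplex) (discMap τ u)) ^ 2
    with hH
  have hsub : Metric.closedBall (0 : ℂ) r ⊆ Metric.ball 0 1 := Metric.closedBall_subset_ball hr1
  have hHan : AnalyticOnNhd ℂ H (Metric.closedBall 0 r) := by
    refine AnalyticOnNhd.mono ?_ hsub
    exact (((differentiableOn_disc hG τ m).pow 2).const_mul _).analyticOnNhd Metric.isOpen_ball
  have hH0 : H 0 = c * G τ ^ 2 := by
    simp [hH, discMap]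
  have hHn : ∀ u ∈ Metric.sphere (0 : ℂ) r, ‖H u‖ = petersson m G (discPoint τ u) := by
    intro u hu
    have hur : ‖u‖ = r := by simpa using hu
    have hu1 : ‖u‖ < 1 := by linarith
    have h3 := norm_pos_iff.2 (one_sub_ne_zero_of_norm_lt hu1)
    rw [petersson, discPoint_im τ hu1, hur, hH]
    simp only [norm_mul, norm_pow, Function.comp_apply, zpow_natCast]
    rw [Complex.norm_real, Real.norm_eq_abs, abs_of_pos hcpos, hc, discPoint, div_pow]
    generalize ‖-1 * u + 1‖ = t at h3
    field_simp
    ring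
  have hJ := log_norm_le_circleAverage hr hHan (by
    rw [hH0]
    exact mul_ne_zero (by exact_mod_cast hcpos.ne') (pow_ne_zero 2 h0))
  have hint : CircleIntegrable (fun u => Real.log ‖H u‖) 0 r :=
    MeromorphicOn.circleIntegrable_log_norm
      ((hHan.mono (by rw [abs_of_pos hr]; exact Metric.sphere_subset_closedBall)).meromorphicOn)
  have hcongr : ∀ u ∈ Metric.sphere (0 : ℂ) |r|, Real.log ‖H u‖ =
      Real.log (petersson m G (discPoint τ u)) := by
    intro u hu
    rw [abs_of_pos hr] at hu
    rw [hHn u hu]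
  refine ⟨?_, ?_⟩
  · rw [← Real.circleAverage_congr_sphere hcongr]
    refine le_trans (le_of_eq ?_) hJ
    have hp : (‖H 0‖ : ℝ) = petersson m G τ * ((1 - r ^ 2) ^ m)⁻¹ := by
      rw [hH0, norm_mul, norm_pow, Complex.norm_real, Real.norm_eq_abs, abs_of_pos hcpos, hc,
        petersson, mul_pow]
      field_simp
    have hpp : petersson m G τ ≠ 0 := by
      have := norm_pos_iff.2 h0
      rw [petersson]
      positivity
    rw [hp, Real.log_mul hpp (by positivity), Real.log_inv, Real.log_pow]
    ring
  · have hfun : (fun θ => Real.log (petersson m G (discPoint τ (circleMap 0 r θ)))) =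
        fun θ => Real.log ‖H (circleMap 0 r θ)‖ := by
      funext θ
      rw [hcongr _ (circleMap_mem_sphere' 0 r θ)]
    unfold CircleIntegrable at hint ⊢
    rw [hfun]
    exact hint

/-- The points whose orbit stays far from the base point. -/
def farSet (Γ : Subgroup SL(2, ℝ)) (T : ℝ) : Set ℍ :=
  {z | ∀ γ : Γ, T < (1 + ‖(((γ : SL(2, ℝ)) • z : ℍ) : ℂ)‖ ^ 2) / ((γ : SL(2, ℝ)) • z).im}

theorem measurableSet_farSet (Γ : Subgroup SL(2, ℝ)) [Countable Γ] (T : ℝ) :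
    MeasurableSet (farSet Γ T) := by
  have h : farSet Γ T = ⋂ γ : Γ,
      {z | T < (1 + ‖(((γ : SL(2, ℝ)) • z : ℍ) : ℂ)‖ ^ 2) / ((γ : SL(2, ℝ)) • z).im} := by
    ext z
    simp [farSet]
  rw [h]
  refine MeasurableSet.iInter fun γ => measurableSet_lt measurable_const ?_
  have h1 : Measurable fun z : ℍ => (((γ : SL(2, ℝ)) • z : ℍ) : ℂ) :=
    measurable_coe.comp (measurable_SL_smul γ)
  exact (measurable_const.add (h1.norm.pow_const 2)).div (Complex.measurable_im.comp h1)

theorem smul_mem_farSet {Γ : Subgroup SL(2, ℝ)} {T : ℝ} {γ : SL(2, ℝ)} (hγ : γ ∈ Γ) (z : ℍ) :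
    γ • z ∈ farSet Γ T ↔ z ∈ farSet Γ T := by
  constructor
  · intro h δ
    have := h (δ * ⟨γ, hγ⟩⁻¹)
    simpa [smul_smul] using this
  · intro h δ
    have := h (δ * ⟨γ, hγ⟩)
    simpa [smul_smul] using this

/-- Let `l = -log (1 - r²)` and let `a` be the proportion of the circle inside `farSet Γ T`. Outside
that set invariance bounds `log (petersson m G)` by a constant, inside it moderate growth gives
`O(1) + N l`. Jensen's inequality then reads `m l ≤ O(1) + N (l + O(1)) a`. The resulting lower
bound for `a` is independent of `T`; only the radius depends on it. -/
theorem exists_radius_le_circleAverage {Γ : Subgroup SL(2, ℝ)} [Countable Γ] {m : ℕ} (hm : 0 < m)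
    {G : ℍ → ℂ} (hG : MDiff G)
    (hmod : ∀ γ ∈ Γ, ∀ τ : ℍ, G (γ • τ) * ((γ 1 0 : ℂ) * τ + γ 1 1) ^ m = G τ)
    {C : ℝ} {N : ℕ} (hC : 1 ≤ C) (hN : 1 ≤ N)
    (hbound : ∀ τ : ℍ, petersson m G τ ≤ C * ((1 + ‖(τ : ℂ)‖ ^ 2) / τ.im) ^ N)
    {B : Set ℍ} (hB : IsCompact B) (hB0 : ∀ τ ∈ B, G τ ≠ 0) {T : ℝ} (hT : 1 ≤ T) :
    ∃ r₁ : ℝ, 0 < r₁ ∧ r₁ < 1 ∧ ∀ τ ∈ B, ∀ r, r₁ < r → r < 1 →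
      (m : ℝ) / (4 * N) ≤ Real.circleAverage
        (fun u => (farSet Γ T).indicator (1 : ℍ → ℝ) (discPoint τ u)) 0 r := by
  have hGc : Continuous G := hG.continuous
  have hpos : ∀ τ ∈ B, 0 < petersson m G τ := by
    intro τ hτ
    have h1 := norm_pos_iff.2 (hB0 τ hτ)
    have h2 := τ.im_pos
    rw [petersson]
    positivity
  obtain ⟨L, hL⟩ : ∃ L, ∀ τ ∈ B, ‖Real.log (petersson m G τ)‖ ≤ L := by
    refine hB.exists_bound_of_continuousOn ?_
    refine ContinuousOn.log ?_ fun τ hτ => (hpos τ hτ).ne'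
    unfold petersson
    exact ((hGc.norm.pow 2).div (continuous_im.pow m) fun τ =>
      pow_ne_zero m τ.im_ne_zero).continuousOn
  obtain ⟨A, hA⟩ : ∃ A, ∀ τ ∈ B, ‖Real.log (4 * ((1 + ‖(τ : ℂ)‖ ^ 2) / τ.im))‖ ≤ A := by
    refine hB.exists_bound_of_continuousOn ?_
    refine ContinuousOn.log ?_ fun τ _ => ?_
    · exact (continuous_const.mul ((continuous_const.add (continuous_coe.norm.pow 2)).div
        continuous_im fun τ => τ.im_ne_zero)).continuousOn
    · have := one_le_growth τ
      positivity
  set K₀ : ℝ := Real.log C + N * Real.log T with hK₀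
  have hK₀n : 0 ≤ K₀ := by
    have := Real.log_nonneg hC
    have := Real.log_nonneg hT
    positivity
  have hmR : (0 : ℝ) < m := by exact_mod_cast hm
  have hNR : (1 : ℝ) ≤ N := by exact_mod_cast hN
  -- For `l ≥ l₀` the constants satisfy `A ≤ l` and `L + K₀ ≤ m l / 2`, so that `m l / 2 ≤ 2 N l a`.
  -- The radius below is chosen to make `-log (1 - r²)` at least `l₀`.
  set l₀ : ℝ := max 1 (max A (2 * (L + K₀) / m)) with hl₀
  have hl₀1 : 1 ≤ l₀ := le_max_left _ _
  have hexp : Real.exp (-l₀) < 1 := by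
    rw [Real.exp_lt_one_iff]
    linarith
  refine ⟨√(1 - Real.exp (-l₀)), Real.sqrt_pos.2 (by linarith), ?_, ?_⟩
  · rw [Real.sqrt_lt' one_pos]
    linarith [Real.exp_pos (-l₀)]
  intro τ hτ r hr hr1
  have hr0 : 0 < r := (Real.sqrt_nonneg _).trans_lt hr
  have h1r : 0 < 1 - r ^ 2 := by nlinarith
  set l : ℝ := -Real.log (1 - r ^ 2) with hl
  have hll : l₀ ≤ l := by
    have h1 : 1 - Real.exp (-l₀) < r ^ 2 := (Real.sqrt_lt' hr0).1 hr
    have h2 : Real.log (1 - r ^ 2) ≤ Real.log (Real.exp (-l₀)) := Real.log_le_log h1r (by linarith)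
    rw [Real.log_exp] at h2
    linarith
  have hlA : A ≤ l := ((le_max_left _ _).trans (le_max_right _ _)).trans hll
  have hlL : 2 * (L + K₀) ≤ m * l := by
    have h1 : 2 * (L + K₀) / m ≤ l := ((le_max_right _ _).trans (le_max_right _ _)).trans hll
    rwa [div_le_iff₀' hmR] at h1
  obtain ⟨hJ, hint⟩ := log_petersson_add_le hG (m := m) (hB0 τ hτ) hr0 hr1
  set E := farSet Γ T with hE
  have hEm : MeasurableSet E := measurableSet_farSet Γ T
  have hind : CircleIntegrable (fun u => E.indicator (1 : ℍ → ℝ) (discPoint τ u)) 0 r := by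
    have hmeas : Measurable fun θ => E.indicator (1 : ℍ → ℝ) (discPoint τ (circleMap 0 r θ)) :=
      (measurable_one.indicator hEm).comp
        ((measurable_discPoint τ).comp (continuous_circleMap 0 r).measurable)
    unfold CircleIntegrable
    refine (intervalIntegrable_const (c := (1 : ℝ))).mono_fun hmeas.aestronglyMeasurable ?_
    refine Filter.Eventually.of_forall fun θ => ?_
    rw [norm_one]
    refine (norm_indicator_le_norm_self _ _).trans ?_
    simp
  have hNl : 0 ≤ (N : ℝ) * (A + l) := by
    have := (norm_nonneg _).trans (hA τ hτ)
    have : 0 ≤ l := by linarith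
    positivity
  have hup : ∀ u ∈ Metric.sphere (0 : ℂ) |r|, Real.log (petersson m G (discPoint τ u)) ≤
      K₀ + (N * (A + l)) * E.indicator (1 : ℍ → ℝ) (discPoint τ u) := by
    intro u hu
    have hur : ‖u‖ = r := by simpa [abs_of_pos hr0] using hu
    set z := discPoint τ u with hz
    have hinn : 0 ≤ E.indicator (1 : ℍ → ℝ) z := Set.indicator_nonneg (by simp) _
    have hright : 0 ≤ K₀ + (N * (A + l)) * E.indicator (1 : ℍ → ℝ) z := by positivity
    have hpn : 0 ≤ petersson m G z := by
      have := z.im_pos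
      rw [petersson]
      positivity
    rcases hpn.eq_or_lt with h0 | h0
    -- At zeros of `G` the logarithm has the default value `0`, and the bound holds because its
    -- right side is nonnegative.
    · rw [← h0, Real.log_zero]
      exact hright
    have hinv : ∀ γ ∈ Γ, petersson m G z ≤
        C * ((1 + ‖((γ • z : ℍ) : ℂ)‖ ^ 2) / (γ • z).im) ^ N := by
      intro γ hγ
      rw [← petersson_smul (hmod γ hγ z)]
      exact hbound _
    have hlogle : ∀ q : ℝ, 1 ≤ q → petersson m G z ≤ C * q ^ N →
        Real.log (petersson m G z) ≤ Real.log C + N * Real.log q := by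
      intro q hq h
      rw [← Real.log_pow, ← Real.log_mul (by positivity) (by positivity)]
      exact Real.log_le_log h0 h
    by_cases hzE : z ∈ E
    · rw [Set.indicator_of_mem hzE, Pi.one_apply, mul_one]
      have h1 : (1 + ‖(z : ℂ)‖ ^ 2) / z.im ≤
          4 * ((1 + ‖(τ : ℂ)‖ ^ 2) / τ.im) / (1 - r ^ 2) := by
        have := growth_discPoint_le τ (u := u) (by linarith)
        rwa [hur] at this
      have h2 := hlogle _ (one_le_growth z) (hbound z)
      have h3 : Real.log ((1 + ‖(z : ℂ)‖ ^ 2) / z.im) ≤ A + l := by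
        refine (Real.log_le_log (by linarith [one_le_growth z]) h1).trans ?_
        have := one_le_growth τ
        rw [Real.log_div (by positivity) h1r.ne', hl]
        linarith [(le_abs_self _).trans (hA τ hτ)]
      have h4 : 0 ≤ N * Real.log T := by
        have := Real.log_nonneg hT
        positivity
      have h5 := mul_le_mul_of_nonneg_left h3 (by positivity : (0 : ℝ) ≤ N)
      linarith
    · rw [Set.indicator_of_notMem hzE, mul_zero, add_zero]
      obtain ⟨γ, hγ⟩ : ∃ γ : Γ, ¬ T < (1 + ‖(((γ : SL(2, ℝ)) • z : ℍ) : ℂ)‖ ^ 2) /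
          ((γ : SL(2, ℝ)) • z).im := by
        rw [hE] at hzE
        simpa [farSet] using hzE
      refine hlogle T hT ((hinv γ γ.2).trans ?_)
      have h1 := one_le_growth ((γ : SL(2, ℝ)) • z)
      have h2 := not_lt.1 hγ
      gcongr
  have hmono := Real.circleAverage_mono hint
    ((circleIntegrable_const K₀ 0 r).add (hind.const_smul (a := (N * (A + l) : ℝ)))) hup
  have heq : Real.circleAverage ((fun _ => K₀) + (N * (A + l) : ℝ) • fun u =>
      E.indicator (1 : ℍ → ℝ) (discPoint τ u)) 0 r =
      K₀ + (N * (A + l)) * Real.circleAverage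
        (fun u => E.indicator (1 : ℍ → ℝ) (discPoint τ u)) 0 r := by
    rw [Real.circleAverage_add (circleIntegrable_const K₀ 0 r) hind.const_smul,
      Real.circleAverage_const, Real.circleAverage_smul, smul_eq_mul]
  set a := Real.circleAverage (fun u => E.indicator (1 : ℍ → ℝ) (discPoint τ u)) 0 r with ha
  have hmain : Real.log (petersson m G τ) + m * l ≤ K₀ + (N * (A + l)) * a :=
    (hJ.trans hmono).trans_eq heq
  have hapos : 0 ≤ a := Real.circleAverage_nonneg_of_nonneg fun u _ =>
    Set.indicator_nonneg (by simp) _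
  have hlog := (neg_le_of_abs_le (hL τ hτ))
  have hlpos : 0 < l := by linarith
  have h6 : (m : ℝ) * l / 2 ≤ 2 * N * l * a := by
    have h7 : (N * (A + l)) * a ≤ 2 * N * l * a := by
      refine mul_le_mul_of_nonneg_right ?_ hapos
      nlinarith
    linarith
  rw [div_le_iff₀ (by positivity)]
  have h8 : (m : ℝ) * l ≤ (a * (4 * N)) * l := by linarith
  exact le_of_mul_le_mul_right h8 hlpos

/-- The indicator of the annulus with radii `r₁ < r₂` in the disc coordinate around `τ`. -/
def annulus (r₁ r₂ : ℝ) (τ z : ℍ) : ENNReal :=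
  (Set.Ioo r₁ r₂).indicator (1 : ℝ → ENNReal) ‖discCoord τ z‖

theorem measurable_annulus (r₁ r₂ : ℝ) : Measurable fun p : ℍ × ℍ => annulus r₁ r₂ p.1 p.2 :=
  (measurable_one.indicator measurableSet_Ioo).comp measurable_discCoord.norm

theorem setLIntegral_annulus {r₁ r₂ : ℝ} (h0 : 0 < r₁) (h1 : r₂ < 1) (τ : ℍ) {E : Set ℍ}
    (hE : MeasurableSet E) :
    ∫⁻ z in E, annulus r₁ r₂ τ z = ∫⁻ r in Set.Ioo r₁ r₂, ENNReal.ofReal (polarWeight r) *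
      ∫⁻ θ in Set.Ioo (-Real.pi) Real.pi, E.indicator 1 (polarPoint τ (r, θ)) := by
  have hm : Measurable fun z => annulus r₁ r₂ τ z := 
    Measurable.comp (g := fun p : ℍ × ℍ => annulus r₁ r₂ p.1 p.2) (f := fun z => (τ, z))
      (measurable_annulus r₁ r₂) measurable_prodMk_left
  have hsub : Set.Ioo r₁ r₂ ⊆ Set.Ioo (0 : ℝ) 1 := Set.Ioo_subset_Ioo h0.le h1.le
  rw [← lintegral_indicator hE, lintegral_eq_lintegral_polar τ (hm.indicator hE),
    ← Set.inter_eq_self_of_subset_left hsub, ← Measure.restrict_restrict measurableSet_Ioo,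
    ← lintegral_indicator (μ := volume.restrict (Set.Ioo (0 : ℝ) 1)) (s := Set.Ioo r₁ r₂)
      measurableSet_Ioo]
  refine setLIntegral_congr_fun (s := Set.Ioo (0 : ℝ) 1) measurableSet_Ioo fun r hr => ?_
  have hnorm : ∀ θ, ‖discCoord τ (polarPoint τ (r, θ))‖ = r := by
    intro θ
    have hn : ‖circleMap 0 r θ‖ = r := by rw [norm_circleMap_zero, abs_of_pos hr.1]
    rw [polarPoint, discCoord_discPoint τ (by rw [hn]; exact hr.2), hn]
  by_cases hr' : r ∈ Set.Ioo r₁ r₂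
  · rw [Set.indicator_of_mem hr']
    congr 1
    refine lintegral_congr fun θ => ?_
    by_cases hz : polarPoint τ (r, θ) ∈ E
    · rw [Set.indicator_of_mem hz, Set.indicator_of_mem hz, annulus, hnorm,
        Set.indicator_of_mem hr']
      rfl
    · rw [Set.indicator_of_notMem hz, Set.indicator_of_notMem hz]
  · rw [Set.indicator_of_notMem hr']
    refine mul_eq_zero_of_right _ ?_
    rw [lintegral_eq_zero_of_ae_eq_zero]
    refine Filter.Eventually.of_forall fun θ => ?_
    refine le_antisymm ((Set.indicator_le_self' (fun _ _ => zero_le) _).trans ?_) zero_le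
    rw [annulus, hnorm, Set.indicator_of_notMem hr']
    rfl

theorem lintegral_annulus {r₁ r₂ : ℝ} (h0 : 0 < r₁) (h1 : r₂ < 1) (τ : ℍ) :
    ∫⁻ z, annulus r₁ r₂ τ z =
      (∫⁻ r in Set.Ioo r₁ r₂, ENNReal.ofReal (polarWeight r)) * ENNReal.ofReal (2 * Real.pi) := by
  rw [← setLIntegral_univ, setLIntegral_annulus h0 h1 τ MeasurableSet.univ,
    ← lintegral_mul_const _ measurable_polarWeight.ennreal_ofReal]
  refine lintegral_congr fun r => ?_
  congr 1
  simp only [Set.indicator_univ, Pi.one_apply]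
  rw [setLIntegral_one, Real.volume_Ioo]
  congr 1
  ring

theorem lintegral_polarWeight_pos {r₁ r₂ : ℝ} (h0 : 0 < r₁) (h12 : r₁ < r₂) (h1 : r₂ < 1) :
    0 < ∫⁻ r in Set.Ioo r₁ r₂, ENNReal.ofReal (polarWeight r) := by
  rw [setLIntegral_pos_iff measurable_polarWeight.ennreal_ofReal]
  have hsub : Set.Ioo r₁ r₂ ⊆
      Function.support (fun r => ENNReal.ofReal (polarWeight r)) ∩ Set.Ioo r₁ r₂ := by
    intro r hr
    refine ⟨?_, hr⟩
    have hr0 : 0 < r := h0.trans hr.1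
    have hr1 : 0 < 1 - r ^ 2 := by nlinarith [hr.2]
    have : 0 < polarWeight r := by
      unfold polarWeight
      positivity
    simpa using this
  refine lt_of_lt_of_le ?_ (measure_mono hsub)
  rw [Real.volume_Ioo]
  simpa using h12

theorem lintegral_polarWeight_lt_top {r₁ r₂ : ℝ} (h0 : 0 < r₁) (h1 : r₂ < 1) :
    ∫⁻ r in Set.Ioo r₁ r₂, ENNReal.ofReal (polarWeight r) < ⊤ := by
  refine setLIntegral_lt_top_of_le_nnreal (by simp) ⟨Real.toNNReal (4 / (1 - r₂ ^ 2) ^ 2), ?_⟩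
  intro r hr
  refine ENNReal.ofReal_le_ofReal ?_
  have hr0 : 0 < r := h0.trans hr.1
  have hr1 : 0 < 1 - r₂ ^ 2 := by nlinarith [hr.2]
  have hr2 : 1 - r₂ ^ 2 ≤ 1 - r ^ 2 := by nlinarith [hr.2]
  unfold polarWeight
  gcongr
  linarith [hr.2]

/-- Integrates the bound on circles over the radius, turning a proportion of length into a
proportion of area. -/
theorem le_setLIntegral_annulus {r₁ r₂ : ℝ} (h0 : 0 < r₁) (h1 : r₂ < 1) (τ : ℍ) {E : Set ℍ}
    (hE : MeasurableSet E) {δ : ℝ} (hδ : ∀ r, r₁ < r → r < 1 → δ ≤ Real.circleAverage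
        (fun u => E.indicator (1 : ℍ → ℝ) (discPoint τ u)) 0 r) :
    ENNReal.ofReal δ * ∫⁻ z, annulus r₁ r₂ τ z ≤ ∫⁻ z in E, annulus r₁ r₂ τ z := by
  rw [lintegral_annulus h0 h1, setLIntegral_annulus h0 h1 τ hE, mul_left_comm,
    ← ENNReal.ofReal_mul' (by positivity),
    ← lintegral_mul_const _ measurable_polarWeight.ennreal_ofReal]
  refine setLIntegral_mono' measurableSet_Ioo fun r hr => ?_
  refine mul_le_mul_right ?_ _
  have h := hδ r hr.1 (hr.2.trans h1)
  have hmeas : Measurable fun θ => E.indicator (1 : ℍ → ℝ) (polarPoint τ (r, θ)) :=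
    (measurable_one.indicator hE).comp ((measurable_polarPoint τ).comp measurable_prodMk_left)
  rw [circleAverage_eq_setIntegral, smul_eq_mul, inv_mul_eq_div, le_div_iff₀ (by positivity)] at h
  refine (ENNReal.ofReal_le_ofReal h).trans (le_of_eq ?_)
  rw [ofReal_integral_eq_lintegral_ofReal]
  · refine lintegral_congr fun θ => ?_
    change ENNReal.ofReal (E.indicator 1 (polarPoint τ (r, θ))) = _
    by_cases hz : polarPoint τ (r, θ) ∈ E
    · simp [hz]
    · simp [hz]
  · refine Integrable.mono' (integrable_const (1 : ℝ)) hmeas.aestronglyMeasurable ?_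
    refine Filter.Eventually.of_forall fun θ => (norm_indicator_le_norm_self _ _).trans ?_
    simp
  · exact Filter.Eventually.of_forall fun θ => Set.indicator_nonneg (by simp) _

/-- For centres `τ` in a compact set `B` on which `G` has no zero, the far set fills at least the
proportion `δ` of an annulus around `τ`. Averaging over `B` and unfolding gives `δ vol(B) ≤ M vol(S
∩ farSet)`. The far sets decrease to the empty set inside a set of finite area, so the right side
tends to `0`. -/
theorem IsLattice.eq_zero_of_neg_weight {Γ : Subgroup SL(2, ℝ)} (hΓ : IsLattice Γ) {m : ℕ}
    (hm : 0 < m) {G : ℍ → ℂ} (hG : MDiff G) (hG' : ModerateGrowth G)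
    (hmod : ∀ γ ∈ Γ, ∀ τ : ℍ, G (γ • τ) * ((γ 1 0 : ℂ) * τ + γ 1 1) ^ m = G τ) : G = 0 := by
  by_contra hne
  obtain ⟨τ₀, hτ₀⟩ := Function.ne_iff.1 hne
  have := hΓ.discrete
  have := hΓ.countable
  obtain ⟨S, hS, hfin, hcov⟩ := hΓ.finite_covolume
  obtain ⟨C, N, hC, hN, hbound⟩ := petersson_le (m := m) hG'
  have hopen : IsOpen {τ | G τ ≠ 0} := isOpen_ne.preimage hG.continuous
  obtain ⟨B, hB, hτB, hBsub⟩ := exists_compact_subset hopen (x := τ₀) hτ₀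
  obtain ⟨M, hM⟩ := lintegral_kernel_le (Γ := Γ) hB
  have hBpos : 0 < volume B := (volume_pos_of_isOpen isOpen_interior ⟨τ₀, hτB⟩).trans_le
    (measure_mono interior_subset)
  set δ : ℝ := (m : ℝ) / (4 * N) with hδ
  have hδpos : 0 < δ := by
    have : (0 : ℝ) < m := by exact_mod_cast hm
    have : (0 : ℝ) < N := by exact_mod_cast hN
    positivity
  have hle : ∀ n : ℕ, ENNReal.ofReal δ * volume B ≤ M * volume (S ∩ farSet Γ (n + 1)) := by
    intro n
    obtain ⟨r₁, h0, h1, hr⟩ := exists_radius_le_circleAverage hm hG hmod hC hN hbound hB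
      (fun τ hτ => hBsub hτ) (T := n + 1) (by linarith [n.cast_nonneg (α := ℝ)])
    -- Any radius strictly between `r₁` and `1` works: the area `V` of the annulus must be positive
    -- and finite to be cancelled.
    set r₂ := (r₁ + 1) / 2 with hr₂
    have h12 : r₁ < r₂ := by linarith
    have h2 : r₂ < 1 := by linarith
    set E := farSet Γ (n + 1) with hE
    have hEm : MeasurableSet E := measurableSet_farSet Γ _
    set V := (∫⁻ r in Set.Ioo r₁ r₂, ENNReal.ofReal (polarWeight r)) *
      ENNReal.ofReal (2 * Real.pi) with hV
    have hV0 : V ≠ 0 := mul_ne_zero (lintegral_polarWeight_pos h0 h12 h2).ne' (by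
      simp [Real.pi_pos])
    have hVt : V ≠ ⊤ := ENNReal.mul_ne_top (lintegral_polarWeight_lt_top h0 h2).ne ENNReal.ofReal_ne_top
    -- The kernel is a function of hyperbolic distance, so it is invariant and symmetric, and its
    -- integral over the centre is also `V`.
    have hker := hM S E (annulus r₁ r₂) V hS hcov hEm (fun γ hγ z => smul_mem_farSet hγ z)
      (measurable_annulus r₁ r₂)
      (fun γ _ τ z => by rw [annulus, annulus, norm_discCoord_smul]) (fun z => by
        rw [hV, ← lintegral_annulus h0 h2 z]
        refine lintegral_congr fun τ => ?_
        rw [annulus, annulus, norm_discCoord_comm])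
    have hlow : ENNReal.ofReal δ * V * volume B ≤ ∫⁻ τ in B, ∫⁻ z in E, annulus r₁ r₂ τ z := by
      rw [← setLIntegral_const]
      refine setLIntegral_mono' hB.isClosed.measurableSet fun τ hτ => ?_
      rw [hV, ← lintegral_annulus h0 h2 τ]
      exact le_setLIntegral_annulus h0 h2 τ hEm (hr τ hτ)
    have h3 : V * (ENNReal.ofReal δ * volume B) ≤ V * (M * volume (S ∩ E)) := by
      calc V * (ENNReal.ofReal δ * volume B) = ENNReal.ofReal δ * V * volume B := by ring
        _ ≤ M * V * volume (S ∩ E) := hlow.trans hker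
        _ = _ := by ring
    exact (ENNReal.mul_le_mul_iff_right hV0 hVt).1 h3
  have hanti : Antitone fun n : ℕ => S ∩ farSet Γ (n + 1) := by
    intro a b hab z hz
    refine ⟨hz.1, fun γ => lt_of_le_of_lt ?_ (hz.2 γ)⟩
    have : (a : ℝ) ≤ b := by exact_mod_cast hab
    linarith
  have hempty : ⋂ n : ℕ, S ∩ farSet Γ (n + 1) = ∅ := by
    refine Set.eq_empty_of_forall_notMem fun z hz => ?_
    obtain ⟨n, hn⟩ := exists_nat_ge ((1 + ‖(z : ℂ)‖ ^ 2) / z.im)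
    have h := (Set.mem_iInter.1 hz n).2 1
    simp only [OneMemClass.coe_one, one_smul] at h
    linarith
  have hlim := tendsto_measure_iInter_atTop (μ := (volume : Measure ℍ))
    (fun n : ℕ => (hS.inter (measurableSet_farSet Γ (n + 1))).nullMeasurableSet) hanti
    ⟨0, measure_ne_top_of_subset Set.inter_subset_left hfin.ne⟩
  rw [hempty, measure_empty] at hlim
  have hlim2 := ENNReal.Tendsto.const_mul (a := (M : ENNReal)) hlim
    (Or.inr (ENNReal.natCast_ne_top M))
  rw [mul_zero] at hlim2
  have h0 := ge_of_tendsto' hlim2 hle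
  exact absurd h0 (not_le.2 (ENNReal.mul_pos (by simpa using hδpos) hBpos.ne'))

/-! ### Binomial and Beta identities -/

/-- The sum is, up to sign, the `n`-th finite difference of `P` at `0`. -/
theorem sum_neg_one_pow_choose_mul_eval {P : Polynomial ℂ} {n : ℕ} (hP : P.natDegree < n) :
    ∑ t ∈ Finset.range (n + 1), (-1) ^ t * (n.choose t : ℂ) * P.eval (t : ℂ) = 0 := by
  have h := congrFun (Polynomial.fwdDiff_iter_eq_zero_of_degree_lt hP) 0
  rw [fwdDiff_iter_eq_sum_shift] at h
  have h2 : ∑ t ∈ Finset.range (n + 1), (-1) ^ t * (n.choose t : ℂ) * P.eval (t : ℂ) =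
      (-1) ^ n * ∑ t ∈ Finset.range (n + 1),
        ((-1 : ℤ) ^ (n - t) * n.choose t) • P.eval (0 + t • (1 : ℂ)) := by
    rw [Finset.mul_sum]
    refine Finset.sum_congr rfl fun t ht => ?_
    have ht' : t ≤ n := Nat.lt_succ_iff.1 (Finset.mem_range.1 ht)
    have h3 : (-1 : ℂ) ^ n * (-1) ^ (n - t) = (-1) ^ t := by
      rw [← pow_add, show n + (n - t) = t + 2 * (n - t) by omega, pow_add, pow_mul]
      simp
    rw [zsmul_eq_mul, zero_add, nsmul_one, ← h3]
    push_cast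
    ring
  rw [h2, h]
  simp

theorem sum_neg_one_pow_choose_mul_choose (m l : ℕ) :
    ∑ j ∈ Finset.range (m + 1), (-1) ^ j * (m.choose j : ℂ) * (j.choose l : ℂ) =
      if l = m then (-1) ^ m else 0 := by
  rcases lt_trichotomy l m with h | rfl | h
  · rw [if_neg h.ne]
    have hd : (descPochhammer ℂ l).natDegree < m := by rwa [descPochhammer_natDegree]
    have h1 := sum_neg_one_pow_choose_mul_eval hd
    have h2 : (l.factorial : ℂ) ≠ 0 := by exact_mod_cast l.factorial_ne_zero
    refine (mul_eq_zero_iff_left h2).1 ?_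
    rw [Finset.mul_sum, ← h1]
    refine Finset.sum_congr rfl fun j _ => ?_
    rw [descPochhammer_eval_eq_descFactorial, Nat.descFactorial_eq_factorial_mul_choose]
    push_cast
    ring
  · rw [if_pos rfl, Finset.sum_range_succ, Finset.sum_eq_zero fun j hj => ?_]
    · simp
    · rw [Nat.choose_eq_zero_of_lt (Finset.mem_range.1 hj)]
      simp
  · rw [if_neg h.ne']
    refine Finset.sum_eq_zero fun j hj => ?_
    rw [Nat.choose_eq_zero_of_lt (lt_of_lt_of_le (Finset.mem_range.1 hj) h)]
    simp

/-- The Beta integral `B(j + 1, n + 1)` in the variable `r²`. -/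
theorem integral_radial (n j : ℕ) :
    ∫ r in (0 : ℝ)..1, 2 * r * (1 - r ^ 2) ^ n * r ^ (2 * j) =
      (j.factorial * n.factorial : ℝ) / (n + j + 1).factorial := by
  induction n generalizing j with
  | zero =>
    have h : ∀ r : ℝ, 2 * r * (1 - r ^ 2) ^ 0 * r ^ (2 * j) = 2 * r ^ (2 * j + 1) := fun r => by ring
    simp only [h]
    rw [intervalIntegral.integral_const_mul, integral_pow, zero_add, Nat.factorial_succ j]
    have := Nat.factorial_ne_zero j
    push_cast
    field_simp
    simp
    ring
  | succ n ih =>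
    have h : ∀ r : ℝ, 2 * r * (1 - r ^ 2) ^ (n + 1) * r ^ (2 * j) =
        2 * r * (1 - r ^ 2) ^ n * r ^ (2 * j) - 2 * r * (1 - r ^ 2) ^ n * r ^ (2 * (j + 1)) :=
      fun r => by ring
    simp only [h]
    rw [intervalIntegral.integral_sub (Continuous.intervalIntegrable (by fun_prop) _ _)
      (Continuous.intervalIntegrable (by fun_prop) _ _), ih, ih,
      show n + (j + 1) + 1 = n + j + 1 + 1 by ring, show n + 1 + j + 1 = n + j + 1 + 1 by ring,
      Nat.factorial_succ (n + j + 1), Nat.factorial_succ j, Nat.factorial_succ n]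
    have := Nat.factorial_ne_zero (n + j + 1)
    push_cast
    field_simp
    ring

/-! ### Bergman projection of almost holomorphic functions -/

/-- On the circle `conj u = r² / u`, so Cauchy's formula extracts the `j`-th Taylor coefficient. -/
theorem circleAverage_mul_conj_pow {H : ℂ → ℂ} (hH : DifferentiableOn ℂ H (Metric.ball 0 1)) (j : ℕ)
    {r : ℝ} (hr : 0 < r) (hr1 : r < 1) :
    Real.circleAverage (fun u => H u * conj u ^ j) 0 r =
      (r : ℂ) ^ (2 * j) * (iteratedDeriv j H 0 / j.factorial) := by
  have hd : DiffContOnCl ℂ H (Metric.ball 0 r) := by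
    refine DifferentiableOn.diffContOnCl ?_
    rw [closure_ball _ hr.ne']
    exact hH.mono (Metric.closedBall_subset_ball hr1)
  have h1 := hd.circleIntegral_one_div_sub_center_pow_smul hr j
  have h2 : Real.circleAverage (fun u => H u * conj u ^ j) 0 r =
      (2 * Real.pi * Complex.I)⁻¹ * ((r : ℂ) ^ (2 * j) *
        ∮ z in C(0, r), (1 / (z - 0) ^ (j + 1)) • H z) := by
    rw [Real.circleAverage_eq_circleIntegral (F := ℂ) hr.ne', smul_eq_mul]
    congr 1
    rw [← circleIntegral.integral_const_mul]
    refine circleIntegral.integral_congr hr.le fun u hu => ?_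
    have hur : ‖u‖ = r := by simpa using hu
    have hu0 : u ≠ 0 := by
      rintro rfl
      simp at hur
      exact hr.ne hur
    have hcu : conj u = (r : ℂ) ^ 2 / u := by
      rw [eq_div_iff hu0, mul_comm, Complex.mul_conj, Complex.normSq_eq_norm_sq, hur]
      push_cast
      rfl
    simp only [sub_zero, smul_eq_mul]
    rw [hcu, div_pow, ← pow_mul]
    field_simp
    ring
  rw [h2, h1, smul_eq_mul]
  have hpi : (2 * Real.pi * Complex.I : ℂ) ≠ 0 := Complex.two_pi_I_ne_zero
  field_simp

theorem circleAverage_mul_one_sub_conj_pow {H : ℂ → ℂ} (hH : DifferentiableOn ℂ H (Metric.ball 0 1))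
    (m : ℕ) {r : ℝ} (hr : 0 < r) (hr1 : r < 1) :
    Real.circleAverage (fun u => H u * (1 - conj u) ^ m) 0 r =
      ∑ j ∈ Finset.range (m + 1), (-1) ^ j * (m.choose j : ℂ) *
        ((r : ℂ) ^ (2 * j) * (iteratedDeriv j H 0 / j.factorial)) := by
  have hc : ContinuousOn H (Metric.sphere 0 r) := hH.continuousOn.mono
    (Metric.sphere_subset_closedBall.trans (Metric.closedBall_subset_ball hr1))
  have hexp : (fun u => H u * (1 - conj u) ^ m) = fun u => ∑ j ∈ Finset.range (m + 1),
      ((-1) ^ j * (m.choose j : ℂ)) • (H u * conj u ^ j) := by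
    funext u
    rw [show (1 - conj u) = -conj u + 1 by ring, add_pow, Finset.mul_sum]
    refine Finset.sum_congr rfl fun j _ => ?_
    rw [neg_pow, smul_eq_mul]
    ring
  rw [hexp, Real.circleAverage_fun_sum]
  · refine Finset.sum_congr rfl fun j _ => ?_
    rw [Real.circleAverage_fun_smul, circleAverage_mul_conj_pow hH j hr hr1, smul_eq_mul]
  · intro j _
    refine ContinuousOn.circleIntegrable hr.le ?_
    exact (hc.mul (Complex.continuous_conj.pow j).continuousOn).const_smul ((-1) ^ j * (m.choose j : ℂ))

/-- The holomorphic function on the disc that corresponds to `h(z) / (z - conj z) ^ m` in weight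
`w`. -/
def discTerm (w : ℤ) (m : ℕ) (f : ℍ → ℂ) (τ : ℍ) (u : ℂ) : ℂ :=
  (((τ : ℂ) - conj (τ : ℂ)) ^ m)⁻¹ * ((-1 * u + 1) ^ (-(w - m)) * (f ∘ ofComplex) (discMap τ u))

theorem differentiableOn_discTerm (w : ℤ) (m : ℕ) {f : ℍ → ℂ} (hf : MDiff f) (τ : ℍ) :
    DifferentiableOn ℂ (discTerm w m f τ) (Metric.ball 0 1) :=
  (differentiableOn_disc hf τ _).const_mul _

theorem sub_conj_self_ne_zero (τ : ℍ) : (τ : ℂ) - conj (τ : ℂ) ≠ 0 := sub_conj_ne_zero τ τ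

/-- In disc coordinates the kernel `(z - conj z) / (τ - conj z)` is `(1 - |u|²) / (1 - u)`. What is
not holomorphic in `u` is radial or a polynomial in `conj u`, so the angular integral can be
evaluated. -/
theorem bergmanIntegrand_discPoint (w : ℤ) (N : ℕ) (h : ℕ → Hol) (τ : ℍ) {u : ℂ} (hu : ‖u‖ < 1) :
    bergmanIntegrand w (almostHol N h) τ (discPoint τ u) = ∑ m ∈ Finset.range (N + 1),
      ((1 - ‖u‖ ^ 2 : ℝ) : ℂ) ^ (w - m) * (discTerm w m (h m) τ u * (1 - conj u) ^ m) := by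
  have h1 : (1 : ℂ) - u ≠ 0 := by
    have := one_sub_ne_zero_of_norm_lt hu
    rwa [neg_one_mul, neg_add_eq_sub] at this
  have h2 : (1 : ℂ) - conj u ≠ 0 := by
    have := (map_ne_zero (starRingEnd ℂ)).2 h1
    simpa using this
  have h3 := sub_conj_self_ne_zero τ
  have h4 : ((1 - ‖u‖ ^ 2 : ℝ) : ℂ) = 1 - u * conj u := by
    rw [Complex.mul_conj, Complex.normSq_eq_norm_sq]
    push_cast
    rfl
  have h5 : ((1 - ‖u‖ ^ 2 : ℝ) : ℂ) ≠ 0 := by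
    have : 0 < 1 - ‖u‖ ^ 2 := by nlinarith [norm_nonneg u]
    exact_mod_cast this.ne'
  have hz : (discPoint τ u : ℂ) = (τ - conj (τ : ℂ) * u) / (1 - u) := by
    rw [coe_discPoint τ hu, discMap]
    congr 1 <;> ring
  have hzc : conj (discPoint τ u : ℂ) = (conj (τ : ℂ) - τ * conj u) / (1 - conj u) := by
    rw [hz]
    simp
  have hzz : (discPoint τ u : ℂ) - conj (discPoint τ u : ℂ) =
      (τ - conj (τ : ℂ)) * ((1 - ‖u‖ ^ 2 : ℝ) : ℂ) / ((1 - u) * (1 - conj u)) := by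
    rw [hzc, hz, h4]
    field_simp
    ring
  have hτz : (τ : ℂ) - conj (discPoint τ u : ℂ) = (τ - conj (τ : ℂ)) / (1 - conj u) := by
    rw [hzc]
    field_simp
    ring
  have hratio : ((discPoint τ u : ℂ) - conj (discPoint τ u : ℂ)) /
      ((τ : ℂ) - conj (discPoint τ u : ℂ)) = ((1 - ‖u‖ ^ 2 : ℝ) : ℂ) / (1 - u) := by
    rw [hzz, hτz]
    generalize ((1 - ‖u‖ ^ 2 : ℝ) : ℂ) = s
    field_simp
  rw [bergmanIntegrand, hratio, almostHol, Finset.sum_mul]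
  refine Finset.sum_congr rfl fun m _ => ?_
  rw [hzz, discTerm, neg_one_mul, neg_add_eq_sub, zpow_neg]
  generalize ((1 - ‖u‖ ^ 2 : ℝ) : ℂ) = s at h5
  rw [zpow_sub₀ h1, zpow_sub₀ h5, zpow_natCast, zpow_natCast, div_zpow, div_pow, mul_pow, mul_pow]
  simp only [Function.comp_apply, discPoint]
  have h6 : s ^ w ≠ 0 := zpow_ne_zero _ h5
  have h7 : (1 - u) ^ w ≠ 0 := zpow_ne_zero _ h1
  field_simp

theorem integral_angular (w : ℤ) (N : ℕ) (h : ℕ → Hol) (τ : ℍ) {r : ℝ} (hr : 0 < r) (hr1 : r < 1) :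
    ∫ θ in Set.Ioo (-Real.pi) Real.pi, bergmanIntegrand w (almostHol N h) τ (polarPoint τ (r, θ)) =
      2 * Real.pi * ∑ m ∈ Finset.range (N + 1), ((1 - r ^ 2 : ℝ) : ℂ) ^ (w - m) *
        ∑ j ∈ Finset.range (m + 1), (-1) ^ j * (m.choose j : ℂ) *
          ((r : ℂ) ^ (2 * j) * (iteratedDeriv j (discTerm w m (h m) τ) 0 / j.factorial)) := by
  have h1 := circleAverage_eq_setIntegral
    (fun u => bergmanIntegrand w (almostHol N h) τ (discPoint τ u)) r
  have h2 : ∫ θ in Set.Ioo (-Real.pi) Real.pi,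
      bergmanIntegrand w (almostHol N h) τ (polarPoint τ (r, θ)) = 2 * Real.pi *
      Real.circleAverage (fun u => bergmanIntegrand w (almostHol N h) τ (discPoint τ u)) 0 r := by
    rw [h1, Complex.real_smul]
    push_cast
    rw [← mul_assoc, mul_inv_cancel₀ (by simp), one_mul]
    rfl
  rw [h2]
  congr 1
  have hcongr : ∀ u ∈ Metric.sphere (0 : ℂ) |r|,
      bergmanIntegrand w (almostHol N h) τ (discPoint τ u) = ∑ m ∈ Finset.range (N + 1),
        (((1 - r ^ 2 : ℝ) : ℂ) ^ (w - m)) • (discTerm w m (h m) τ u * (1 - conj u) ^ m) := by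
    intro u hu
    have hur : ‖u‖ = r := by simpa [abs_of_pos hr] using hu
    rw [bergmanIntegrand_discPoint w N h τ (by linarith), hur]
    rfl
  rw [Real.circleAverage_congr_sphere hcongr, Real.circleAverage_fun_sum]
  · refine Finset.sum_congr rfl fun m _ => ?_
    rw [Real.circleAverage_fun_smul, smul_eq_mul,
      circleAverage_mul_one_sub_conj_pow (differentiableOn_discTerm w m (h m).2 τ) m hr hr1]
  · intro m _
    refine ContinuousOn.circleIntegrable hr.le ?_
    have hc : ContinuousOn (discTerm w m (h m) τ) (Metric.sphere 0 r) :=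
      (differentiableOn_discTerm w m (h m).2 τ).continuousOn.mono
        (Metric.sphere_subset_closedBall.trans (Metric.closedBall_subset_ball hr1))
    have hc2 : Continuous fun u : ℂ => (1 - conj u) ^ m :=
      (continuous_const.sub Complex.continuous_conj).pow m
    exact (hc.mul hc2.continuousOn).const_smul (((1 - r ^ 2 : ℝ) : ℂ) ^ (w - m))

theorem iteratedDeriv_discTerm (w : ℤ) (m j : ℕ) {f : ℍ → ℂ} (hf : MDiff f) (τ : ℍ) :
    iteratedDeriv j (discTerm w m f τ) 0 = (((τ : ℂ) - conj (τ : ℂ)) ^ m)⁻¹ *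
      ∑ l ∈ Finset.range (j + 1), mobiusCoeff (w - m : ℤ) j l * ((τ : ℂ) - conj (τ : ℂ)) ^ l *
        derivH l f τ := by
  have hden : (-1 : ℂ) * 0 + 1 ≠ 0 := by simp
  have him : 0 < ((-conj (τ : ℂ) * 0 + τ) / ((-1 : ℂ) * 0 + 1)).im := by
    simpa using τ.im_pos
  have h := iteratedDeriv_mobius hf (-conj (τ : ℂ)) τ (-1) 1 (w - m) j hden him
  have h2 : iteratedDeriv j (discTerm w m f τ) 0 = (((τ : ℂ) - conj (τ : ℂ)) ^ m)⁻¹ *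
      iteratedDeriv j (fun u => (-1 * u + 1) ^ (-(w - m)) *
        (f ∘ ofComplex) ((-conj (τ : ℂ) * u + τ) / (-1 * u + 1))) 0 :=
    iteratedDeriv_const_mul_field _ _
  rw [h2, h]
  congr 1
  refine Finset.sum_congr rfl fun l _ => ?_
  have h3 : -conj (τ : ℂ) * 1 - τ * -1 = τ - conj (τ : ℂ) := by ring
  rw [h3]
  simp

theorem factorial_mul_mobiusCoeff (n j l : ℕ) :
    ((n + l + 1).factorial : ℂ) * mobiusCoeff (n + 2 : ℕ) j l =
      (j.choose l : ℂ) * (n + j + 1).factorial := by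
  rcases le_or_gt l j with h | h
  · obtain ⟨t, rfl⟩ := Nat.exists_eq_add_of_le h
    have h1 := factorial_mul_ascPochhammer ℂ (n + l + 1) t
    rw [mobiusCoeff, show l + t - l = t by omega,
      show ((n + 2 : ℕ) : ℂ) + l = ((n + l + 1 : ℕ) : ℂ) + 1 by push_cast; ring, mul_left_comm, h1,
      show n + (l + t) + 1 = n + l + 1 + t by ring]
  · rw [mobiusCoeff_of_lt _ h, Nat.choose_eq_zero_of_lt h]
    simp

/-- By `factorial_mul_mobiusCoeff` the denominator of the Beta integral cancels against the
coefficient in the `j`-th derivative of `discTerm`. The sum over `j` becomes the alternating sum of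
`sum_neg_one_pow_choose_mul_choose`, which leaves only `l = m`, where the powers of `τ - conj τ`
disappear. -/
theorem sum_discTerm (N m : ℕ) (hm : m ≤ N) {f : ℍ → ℂ} (hf : MDiff f) (τ : ℍ) :
    ((N : ℂ) + 1) * ∑ j ∈ Finset.range (m + 1), (-1) ^ j * (m.choose j : ℂ) *
        (iteratedDeriv j (discTerm (N + 2 : ℕ) m f τ) 0 / j.factorial) *
          ((j.factorial * (N - m).factorial : ℂ) / (N - m + j + 1).factorial) =
      (-1) ^ m / (ascPochhammer ℂ m).eval (((N + 2 : ℕ) : ℂ) - m - 1) * derivH m f τ := by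
  obtain ⟨n, rfl⟩ := Nat.exists_eq_add_of_le' hm
  have hfac : ∀ a : ℕ, (a.factorial : ℂ) ≠ 0 := fun a => by exact_mod_cast a.factorial_ne_zero
  have hτ := sub_conj_self_ne_zero τ
  set δ := (τ : ℂ) - conj (τ : ℂ) with hδ
  have hterm : ∀ j ∈ Finset.range (m + 1), (-1) ^ j * (m.choose j : ℂ) *
        (iteratedDeriv j (discTerm (n + m + 2 : ℕ) m f τ) 0 / j.factorial) *
          ((j.factorial * n.factorial : ℂ) / (n + j + 1).factorial) =
      ∑ l ∈ Finset.range (m + 1), ((-1) ^ j * (m.choose j : ℂ) * (j.choose l : ℂ)) *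
        (n.factorial / (n + l + 1).factorial * (δ ^ l / δ ^ m) * derivH l f τ) := by
    intro j hj
    have hext : ∑ l ∈ Finset.range (j + 1), mobiusCoeff ((n + m + 2 : ℕ) - m : ℤ) j l * δ ^ l *
        derivH l f τ = ∑ l ∈ Finset.range (m + 1), mobiusCoeff ((n + m + 2 : ℕ) - m : ℤ) j l *
          δ ^ l * derivH l f τ := by
      refine Finset.sum_subset (Finset.range_mono (Finset.mem_range.1 hj)) fun l _ hl => ?_
      rw [mobiusCoeff_of_lt _ (by simpa using hl)]
      simp
    rw [iteratedDeriv_discTerm _ _ _ hf, ← hδ]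
    push_cast at hext ⊢
    rw [hext, Finset.mul_sum, Finset.sum_div, Finset.mul_sum, Finset.sum_mul]
    refine Finset.sum_congr rfl fun l _ => ?_
    have h1 := factorial_mul_mobiusCoeff n j l
    have h2 : mobiusCoeff ((n : ℂ) + m + 2 - m) j l =
        (j.choose l : ℂ) * (n + j + 1).factorial / (n + l + 1).factorial := by
      rw [eq_div_iff (hfac _), ← h1, mul_comm]
      congr 2
      push_cast
      ring
    rw [h2]
    have e1 := hfac j
    have e2 := hfac (n + j + 1)
    have e3 := hfac (n + l + 1)
    field_simp
  rw [show n + m - m = n by omega, Finset.sum_congr rfl hterm, Finset.sum_comm]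
  simp only [← Finset.sum_mul, sum_neg_one_pow_choose_mul_choose]
  rw [Finset.sum_eq_single m]
  · rw [if_pos rfl]
    have h1 := factorial_mul_ascPochhammer ℂ n m
    have h2 : (((n + m + 2 : ℕ) : ℂ) - m - 1) = (n : ℂ) + 1 := by push_cast; ring
    have h3 : (ascPochhammer ℂ m).eval ((n : ℂ) + 1) = (n + m).factorial / n.factorial := by
      rw [eq_div_iff (hfac n), ← h1, mul_comm]
    rw [h2, h3, Nat.factorial_succ (n + m)]
    have e1 := hfac n
    have e2 := hfac (n + m)
    have e3 : ((n + m + 1 : ℕ) : ℂ) ≠ 0 := by exact_mod_cast Nat.succ_ne_zero (n + m)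
    push_cast at e3 ⊢
    field_simp
  · intro l _ hl
    rw [if_neg hl, zero_mul]
  · intro h
    simp at h

/-- Only the whole integrand is assumed integrable, not its separate terms. This suffices: Fubini is
applied once to the whole, and after the angular integration each term is a polynomial in `r`. -/
theorem bergmanProj_almostHol_of_two_le (N : ℕ) (h : ℕ → Hol) (τ : ℍ)
    (hint : Integrable (bergmanIntegrand (N + 2 : ℕ) (almostHol N h) τ)) :
    bergmanProj (N + 2 : ℕ) (almostHol N h) τ = almostHolProj (N + 2 : ℕ) N h τ := by
  set c : ℕ → ℕ → ℂ := fun m j => (-1) ^ j * (m.choose j : ℂ) *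
    (iteratedDeriv j (discTerm (N + 2 : ℕ) m (h m) τ) 0 / j.factorial) with hc
  have hfun : ∀ r ∈ Set.Ioo (0 : ℝ) 1, (polarWeight r : ℂ) * ∫ θ in Set.Ioo (-Real.pi) Real.pi,
      bergmanIntegrand (N + 2 : ℕ) (almostHol N h) τ (polarPoint τ (r, θ)) =
      4 * Real.pi * ∑ m ∈ Finset.range (N + 1), ∑ j ∈ Finset.range (m + 1), c m j *
        ((2 * r * (1 - r ^ 2) ^ (N - m) * r ^ (2 * j) : ℝ) : ℂ) := by
    intro r hr
    have h1r : (0 : ℝ) < 1 - r ^ 2 := by nlinarith [hr.1, hr.2]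
    rw [integral_angular _ _ _ _ hr.1 hr.2, ← mul_assoc, Finset.mul_sum, Finset.mul_sum]
    refine Finset.sum_congr rfl fun m hm => ?_
    rw [Finset.mul_sum, Finset.mul_sum, Finset.mul_sum]
    refine Finset.sum_congr rfl fun j _ => ?_
    have hm' : m ≤ N := Nat.lt_succ_iff.1 (Finset.mem_range.1 hm)
    -- Two of the powers of `1 - r²` cancel the denominator of `polarWeight`; the rest has exponent
    -- `N - m ≥ 0`.
    have hz : ((1 - r ^ 2 : ℝ) : ℂ) ^ (((N + 2 : ℕ) : ℤ) - m) =
        ((1 - r ^ 2 : ℝ) : ℂ) ^ (N - m) * ((1 - r ^ 2 : ℝ) : ℂ) ^ 2 := by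
      rw [show ((N + 2 : ℕ) : ℤ) - m = (N - m + 2 : ℕ) by omega, zpow_natCast, pow_add]
    have h1c : ((1 - r ^ 2 : ℝ) : ℂ) ≠ 0 := by exact_mod_cast h1r.ne'
    rw [hz, polarWeight, hc]
    push_cast at h1c ⊢
    field_simp
  have hbeta : ∀ m j : ℕ, m ≤ N → ∫ r in Set.Ioo (0 : ℝ) 1,
      ((2 * r * (1 - r ^ 2) ^ (N - m) * r ^ (2 * j) : ℝ) : ℂ) =
      (j.factorial * (N - m).factorial : ℂ) / (N - m + j + 1).factorial := by
    intro m j _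
    have h1 := integral_radial (N - m) j
    rw [intervalIntegral.integral_of_le zero_le_one, integral_Ioc_eq_integral_Ioo] at h1
    rw [integral_complex_ofReal, h1]
    push_cast
    rfl
  have hii : ∀ m j : ℕ, Integrable (fun r : ℝ => c m j *
      ((2 * r * (1 - r ^ 2) ^ (N - m) * r ^ (2 * j) : ℝ) : ℂ)) (volume.restrict (Set.Ioo 0 1)) := by
    intro m j
    have : Continuous fun r : ℝ => c m j *
      ((2 * r * (1 - r ^ 2) ^ (N - m) * r ^ (2 * j) : ℝ) : ℂ) := by fun_prop
    exact (this.integrableOn_Icc (a := 0) (b := 1)).mono_set Set.Ioo_subset_Icc_self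
  rw [bergmanProj, integral_eq_integral_polar τ hint, setIntegral_congr_fun measurableSet_Ioo hfun,
    integral_const_mul, integral_finsetSum _ fun m _ => integrable_finsetSum _ fun j _ => hii m j]
  have hpi : (Real.pi : ℂ) ≠ 0 := by exact_mod_cast Real.pi_ne_zero
  rw [← mul_assoc, div_mul_cancel₀ _ (by simp), almostHolProj, Finset.mul_sum]
  refine Finset.sum_congr rfl fun m hm => ?_
  have hm' : m ≤ N := Nat.lt_succ_iff.1 (Finset.mem_range.1 hm)
  rw [integral_finsetSum _ fun j _ => hii m j]
  have h1 := sum_discTerm N m hm' (h m).2 τ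
  rw [derivH] at h1
  refine Eq.trans ?_ (h1.trans ?_)
  · congr 1
    · push_cast
      ring
    · refine Finset.sum_congr rfl fun j _ => ?_
      rw [integral_const_mul, hbeta m j hm']
  · push_cast
    rfl

/-- The angular integral is `2π h₀(τ) (1 - r²)^w`. Multiplied by `polarWeight` it is at least of
size `1 / (1 - r)` near `r = 1` unless `h₀(τ) = 0`, so the radial integral diverges. -/
theorem hol_eq_zero_of_integrable {w : ℤ} (hw : w ≤ 1) (h : ℕ → Hol) (τ : ℍ)
    (hint : Integrable (bergmanIntegrand w (almostHol 0 h) τ)) : (h 0 : ℍ → ℂ) τ = 0 := by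
  by_contra h0
  have h1 := (integrable_polar τ hint).integral_prod_left
  have hpi : (Real.pi : ℂ) ≠ 0 := by exact_mod_cast Real.pi_ne_zero
  obtain ⟨a, ha⟩ : ∃ a : ℂ, a = 2 * Real.pi * (h 0 : ℍ → ℂ) τ := ⟨_, rfl⟩
  have ha0 : 0 < ‖a‖ := by
    rw [ha]
    exact norm_pos_iff.2 (mul_ne_zero (by simp) h0)
  have h2 : ∀ r ∈ Set.Ioo (0 : ℝ) 1, ∫ θ in Set.Ioo (-Real.pi) Real.pi,
      (polarWeight r : ℂ) * bergmanIntegrand w (almostHol 0 h) τ (polarPoint τ (r, θ)) =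
      (polarWeight r : ℂ) * (((1 - r ^ 2 : ℝ) : ℂ) ^ w * a) := by
    intro r hr
    rw [integral_const_mul, integral_angular _ _ _ _ hr.1 hr.2, ha]
    congr 1
    simp [discTerm, discMap]
    ring
  -- On this interval `4 r ≥ 1 + r`, which gives `1 / (1 - r) ≤ 4 r / (1 - r²)`.
  have h3 : IntegrableOn (fun r : ℝ => (r - 1)⁻¹) (Set.Ioo (1 / 2) 1) := by
    have h4 : IntegrableOn (fun r : ℝ => ∫ θ in Set.Ioo (-Real.pi) Real.pi,
        (polarWeight r : ℂ) * bergmanIntegrand w (almostHol 0 h) τ (polarPoint τ (r, θ)))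
        (Set.Ioo (1 / 2) 1) :=
      IntegrableOn.mono_set (t := Set.Ioo 0 1) h1 (Set.Ioo_subset_Ioo (by norm_num) le_rfl)
    refine Integrable.mono (h4.const_mul ((‖a‖⁻¹ : ℝ) : ℂ)) (by fun_prop) ?_
    filter_upwards [ae_restrict_mem measurableSet_Ioo] with r hr
    have hr0 : (0 : ℝ) < r := by linarith [hr.1]
    have h1r : (0 : ℝ) < 1 - r ^ 2 := by nlinarith [hr.2]
    have h1r' : (1 : ℝ) - r ^ 2 ≤ 1 := by nlinarith
    have hr1 : 0 < 1 - r := by linarith [hr.2]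
    have hn1 : ‖(r - 1)⁻¹‖ = (1 - r)⁻¹ := by
      rw [norm_inv, Real.norm_eq_abs, abs_sub_comm, abs_of_pos hr1]
    have hn2 : ‖((‖a‖⁻¹ : ℝ) : ℂ) * ((polarWeight r : ℂ) * (((1 - r ^ 2 : ℝ) : ℂ) ^ w * a))‖ =
        ‖a‖⁻¹ * (polarWeight r * ((1 - r ^ 2) ^ w * ‖a‖)) := by
      rw [norm_mul, norm_mul, norm_mul, norm_zpow, Complex.norm_of_nonneg (by positivity),
        Complex.norm_of_nonneg h1r.le, Complex.norm_of_nonneg (polarWeight_nonneg hr0.le)]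
    rw [h2 r ⟨hr0, hr.2⟩, hn1, hn2]
    have h5 : (1 - r ^ 2 : ℝ) ≤ (1 - r ^ 2) ^ w := by
      have := zpow_le_zpow_right_of_le_one₀ h1r h1r' hw
      rwa [zpow_one] at this
    have h6 : (1 - r)⁻¹ ≤ polarWeight r * (1 - r ^ 2) := by
      rw [polarWeight, inv_eq_one_div, div_mul_eq_mul_div, div_le_div_iff₀ hr1 (by positivity)]
      have e : (1 - r ^ 2 : ℝ) = (1 - r) * (1 + r) := by ring
      rw [e]
      have hpos : 0 ≤ (1 - r) ^ 2 * (1 + r) := by positivity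
      nlinarith [hr.1]
    have h7 := mul_le_mul_of_nonneg_left h5 (polarWeight_nonneg hr0.le)
    calc (1 - r)⁻¹ ≤ polarWeight r * (1 - r ^ 2) ^ w := h6.trans h7
      _ = ‖a‖⁻¹ * (polarWeight r * ((1 - r ^ 2) ^ w * ‖a‖)) := by field_simp
  have h8 : IntervalIntegrable (fun r : ℝ => (r - 1)⁻¹) volume (1 / 2) 1 := by
    rw [intervalIntegrable_iff_integrableOn_Ioo_of_le (by norm_num)]
    exact h3
  rw [intervalIntegrable_sub_inv_iff] at h8
  rcases h8 with h8 | h8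
  · norm_num at h8
  · exact h8 Set.right_mem_uIcc

/-- For `w ≤ 1` only `m = 0` occurs, integrability forces `h 0 = 0`, and both sides vanish. -/
theorem bergmanProj_almostHol (w : ℤ) (h : ℕ → Hol)
    (hint : ∀ τ, Integrable (bergmanIntegrand w (almostHol (w - 2).toNat h) τ)) (τ : ℍ) :
    bergmanProj w (almostHol (w - 2).toNat h) τ = almostHolProj w (w - 2).toNat h τ := by
  rcases le_or_gt w 1 with hw | hw
  · have hN : (w - 2).toNat = 0 := by omega
    rw [hN] at hint ⊢
    have h0 : ∀ τ, (h 0 : ℍ → ℂ) τ = 0 := fun τ => hol_eq_zero_of_integrable hw h τ (hint τ)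
    simp [bergmanProj, bergmanIntegrand, almostHol, almostHolProj, h0]
  · obtain ⟨N, rfl⟩ : ∃ N : ℕ, w = (N + 2 : ℕ) := ⟨(w - 2).toNat, by omega⟩
    have hN : (((N + 2 : ℕ) : ℤ) - 2).toNat = N := by omega
    rw [hN] at hint ⊢
    exact bergmanProj_almostHol_of_two_le N h τ (hint τ)

/-! ### The factor of automorphy -/

/-- The factor of automorphy `c τ + d`. -/
def jFactor (γ : SL(2, ℝ)) (τ : ℍ) : ℂ := (γ 1 0 : ℂ) * τ + γ 1 1

theorem jFactor_ne_zero (γ : SL(2, ℝ)) (τ : ℍ) : jFactor γ τ ≠ 0 := SL_denom_ne_zero γ τ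

theorem slash_eq (k : ℤ) (γ : SL(2, ℝ)) (f : ℍ → ℂ) (τ : ℍ) :
    slash k γ f τ = jFactor γ τ ^ (-k) * f (γ • τ) :=
  slash_apply k γ f τ

theorem qmVar_eq (γ : SL(2, ℝ)) (τ : ℍ) :
    qmVar γ τ = (2 * Real.pi * Complex.I)⁻¹ * ((γ 1 0 : ℂ) / jFactor γ τ) :=
  rfl

theorem jFactor_mul (α γ : SL(2, ℝ)) (τ : ℍ) :
    jFactor (α * γ) τ = jFactor α (γ • τ) * jFactor γ τ := by
  have h := SL_denom_ne_zero γ τ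
  rw [jFactor, jFactor, jFactor, SL_smul_coe]
  simp only [Matrix.SpecialLinearGroup.coe_mul, Matrix.mul_apply, Fin.sum_univ_two]
  push_cast
  field_simp
  ring

theorem jFactor_inv (γ : SL(2, ℝ)) (τ : ℍ) : jFactor γ⁻¹ (γ • τ) = (jFactor γ τ)⁻¹ := by
  have h := jFactor_mul γ⁻¹ γ τ
  rw [inv_mul_cancel] at h
  refine eq_inv_of_mul_eq_one_left ?_
  rw [← h]
  simp [jFactor]

theorem SL_inv_one_zero (γ : SL(2, ℝ)) : γ⁻¹ 1 0 = -γ 1 0 := by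
  rw [Matrix.SpecialLinearGroup.SL2_inv_expl]
  rfl

/-- `qmVar γ` is `(2πi)⁻¹` times the logarithmic derivative of `jFactor γ`. The identity is the
logarithmic derivative of the cocycle relation `jFactor_mul`, since `γ τ` has derivative `jFactor γ
τ ^ (-2)`. -/
theorem qmVar_mul (α γ : SL(2, ℝ)) (τ : ℍ) :
    qmVar (α * γ) τ = qmVar γ τ + jFactor γ τ ^ (-2 : ℤ) * qmVar α (γ • τ) := by
  have h := jFactor_ne_zero γ τ
  have h' := jFactor_ne_zero α (γ • τ)
  have hd : (γ 0 0 : ℂ) * γ 1 1 - γ 0 1 * γ 1 0 = 1 := by exact_mod_cast SL_det γ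
  have hz : jFactor α (γ • τ) * jFactor γ τ = (α 1 0 : ℂ) * (γ 0 0 * τ + γ 0 1) +
      α 1 1 * jFactor γ τ := by
    have h2 : (γ 1 0 : ℂ) * τ + γ 1 1 ≠ 0 := h
    rw [jFactor, SL_smul_coe, jFactor, add_mul, mul_assoc, div_mul_cancel₀ _ h2]
  have hc : ((α * γ) 1 0 : ℂ) = α 1 0 * γ 0 0 + α 1 1 * γ 1 0 := by
    simp [Matrix.SpecialLinearGroup.coe_mul, Matrix.mul_apply, Fin.sum_univ_two]
  rw [qmVar_eq, qmVar_eq, qmVar_eq, jFactor_mul, hc, zpow_neg, zpow_ofNat]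
  have key : ((α 1 0 : ℂ) * γ 0 0 + α 1 1 * γ 1 0) / (jFactor α (γ • τ) * jFactor γ τ) =
      γ 1 0 / jFactor γ τ + (jFactor γ τ ^ 2)⁻¹ * (α 1 0 / jFactor α (γ • τ)) := by
    have h3 : ((α 1 0 : ℂ) * γ 0 0 + α 1 1 * γ 1 0) * jFactor γ τ =
        γ 1 0 * (jFactor α (γ • τ) * jFactor γ τ) + α 1 0 := by
      rw [hz, jFactor]
      linear_combination (α 1 0 : ℂ) * hd
    field_simp
    linear_combination h3
  rw [key]
  ring

theorem qmVar_sub (α γ : SL(2, ℝ)) (τ : ℍ) :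
    qmVar γ τ - qmVar α τ = (2 * Real.pi * Complex.I)⁻¹ *
      (((γ 1 0 * α 1 1 - γ 1 1 * α 1 0 : ℝ) : ℂ) * (jFactor γ τ)⁻¹ * (jFactor α τ)⁻¹) := by
  have h := jFactor_ne_zero γ τ
  have h' := jFactor_ne_zero α τ
  rw [qmVar_eq, qmVar_eq, ← mul_sub]
  congr 1
  field_simp
  rw [jFactor, jFactor]
  push_cast
  ring

theorem IsLattice.exists_seq {Γ : Subgroup SL(2, ℝ)} (hΓ : IsLattice Γ) :
    ∃ g : ℕ → SL(2, ℝ), (∀ i, g i ∈ Γ) ∧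
      ∀ i j, i ≠ j → g i 1 0 * g j 1 1 - g i 1 1 * g j 1 0 ≠ 0 := by
  obtain ⟨g, hg, hg'⟩ := exists_seq_of_forall_finset_exists (fun γ : SL(2, ℝ) => γ ∈ Γ)
    (fun α γ => γ 1 0 * α 1 1 - γ 1 1 * α 1 0 ≠ 0) fun s hs => hΓ.exists_cross_ne_zero s hs
  refine ⟨g, hg, fun i j hij => ?_⟩
  rcases lt_or_gt_of_ne hij with h | h
  · have := hg' i j h
    contrapose! this
    linarith
  · exact hg' j i h

/-! ### Holomorphic functions of moderate growth -/

theorem norm_le_growth (τ : ℍ) : ‖(τ : ℂ)‖ ≤ (1 + ‖(τ : ℂ)‖ ^ 2) / τ.im := by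
  rw [le_div_iff₀ τ.im_pos]
  have h : τ.im ≤ ‖(τ : ℂ)‖ := (le_abs_self _).trans (Complex.abs_im_le_norm (τ : ℂ))
  nlinarith [norm_nonneg (τ : ℂ)]

theorem norm_linear_le (a b : ℝ) (z : ℂ) : ‖(a : ℂ) * z + b‖ ≤ |a| * ‖z‖ + |b| := by
  refine (norm_add_le _ _).trans ?_
  simp

theorem growth_smul_le (γ : SL(2, ℝ)) : ∃ C : ℝ, 0 ≤ C ∧ ∀ τ : ℍ,
    (1 + ‖((γ • τ : ℍ) : ℂ)‖ ^ 2) / (γ • τ).im ≤ C * ((1 + ‖(τ : ℂ)‖ ^ 2) / τ.im) := by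
  refine ⟨2 * (γ 1 0 ^ 2 + γ 1 1 ^ 2 + γ 0 0 ^ 2 + γ 0 1 ^ 2), by positivity, fun τ => ?_⟩
  have hj := norm_pos_iff.2 (SL_denom_ne_zero γ τ)
  have hy := τ.im_pos
  have h1 := norm_linear_le (γ 1 0) (γ 1 1) τ
  have h2 := norm_linear_le (γ 0 0) (γ 0 1) τ
  rw [SL_smul_im, SL_smul_coe, norm_div]
  have e : (1 + (‖(γ 0 0 : ℂ) * τ + γ 0 1‖ / ‖(γ 1 0 : ℂ) * τ + γ 1 1‖) ^ 2) /
      (τ.im / ‖(γ 1 0 : ℂ) * τ + γ 1 1‖ ^ 2) =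
      (‖(γ 1 0 : ℂ) * τ + γ 1 1‖ ^ 2 + ‖(γ 0 0 : ℂ) * τ + γ 0 1‖ ^ 2) / τ.im := by
    generalize ‖(γ 1 0 : ℂ) * τ + γ 1 1‖ = s at hj
    field_simp
  rw [e, ← mul_div_assoc]
  gcongr
  have hsq : ∀ a b t x : ℝ, 0 ≤ x → x ≤ |a| * t + |b| → x ^ 2 ≤ 2 * (a ^ 2 + b ^ 2) * (1 + t ^ 2) := by
    intro a b t x hx h
    have h3 : x ^ 2 ≤ (|a| * t + |b|) ^ 2 := by gcongr
    have h4 := sq_abs a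
    have h5 := sq_abs b
    nlinarith [sq_nonneg (|a| * t - |b|), sq_nonneg (|b| * t), sq_nonneg a]
  have h3 := hsq _ _ _ _ (norm_nonneg _) h1
  have h4 := hsq _ _ _ _ (norm_nonneg _) h2
  linarith

theorem ModerateGrowth.comp_smul {F : ℍ → ℂ} (hF : ModerateGrowth F) (γ : SL(2, ℝ)) :
    ModerateGrowth fun τ => F (γ • τ) := by
  obtain ⟨C, N, hC⟩ := hF
  obtain ⟨B, hB, hB'⟩ := growth_smul_le γ
  refine ⟨|C| * B ^ N, N, fun τ => (hC _).trans ?_⟩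
  have h0 : 0 ≤ (1 + ‖((γ • τ : ℍ) : ℂ)‖ ^ 2) / (γ • τ).im :=
    zero_le_one.trans (one_le_growth _)
  rw [mul_assoc, ← mul_pow]
  exact mul_le_mul (le_abs_self C) (pow_le_pow_left₀ h0 (hB' τ) N) (by positivity) (abs_nonneg C)

theorem ModerateGrowth.jFactor (γ : SL(2, ℝ)) : ModerateGrowth (jFactor γ) := by
  refine ⟨|γ 1 0| + |γ 1 1|, 1, fun τ => (norm_linear_le _ _ _).trans ?_⟩
  have h1 := norm_le_growth τ
  have h2 := one_le_growth τ
  rw [pow_one, add_mul]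
  exact add_le_add (mul_le_mul_of_nonneg_left h1 (abs_nonneg _))
    (le_mul_of_one_le_right (abs_nonneg _) h2)

/-- The algebra of holomorphic functions of moderate growth. -/
def holGrowth : Subalgebra ℂ (ℍ → ℂ) where
  carrier := {F | MDiff F ∧ ModerateGrowth F}
  mul_mem' hF hG := ⟨hF.1.mul hG.1, hF.2.mul hG.2⟩
  add_mem' hF hG := ⟨hF.1.add hG.1, hF.2.add hG.2⟩
  algebraMap_mem' c := ⟨mdifferentiable_const, ‖c‖, 0, fun τ => by simp⟩

theorem derivH_mem_holGrowth {F : ℍ → ℂ} (hF : F ∈ holGrowth) (m : ℕ) : derivH m F ∈ holGrowth :=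
  ⟨mdiff_derivH hF.1 m, hF.2.derivH hF.1 m⟩

theorem jFactor_mem_holGrowth (γ : SL(2, ℝ)) : jFactor γ ∈ holGrowth := by
  refine ⟨?_, .jFactor γ⟩
  have h : jFactor γ = slash (-1) γ 1 := by
    ext τ
    simp [slash_eq]
  rw [h]
  exact (holSlash (-1) γ ⟨1, mdifferentiable_const⟩).2

/-- Growth of the inverse follows from `jFactor_inv`, which writes it as the factor of `γ⁻¹`
evaluated at `γ τ`. -/
theorem jFactor_inv_mem_holGrowth (γ : SL(2, ℝ)) : (jFactor γ)⁻¹ ∈ holGrowth := by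
  constructor
  · have h : (jFactor γ)⁻¹ = slash 1 γ 1 := by
      ext τ
      simp [slash_eq]
    rw [h]
    exact (holSlash 1 γ ⟨1, mdifferentiable_const⟩).2
  · have h : (jFactor γ)⁻¹ = fun τ => jFactor γ⁻¹ (γ • τ) := by
      ext τ
      rw [jFactor_inv, Pi.inv_apply]
    rw [h]
    exact (ModerateGrowth.jFactor γ⁻¹).comp_smul γ

theorem jFactor_zpow_mem_holGrowth (γ : SL(2, ℝ)) (k : ℤ) : jFactor γ ^ k ∈ holGrowth := by
  cases k with
  | ofNat n =>
    rw [Int.ofNat_eq_natCast, zpow_natCast]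
    exact pow_mem (jFactor_mem_holGrowth γ) n
  | negSucc n =>
    rw [zpow_negSucc, ← inv_pow]
    exact pow_mem (jFactor_inv_mem_holGrowth γ) _

theorem slash_mem_holGrowth {F : ℍ → ℂ} (hF : F ∈ holGrowth) (k : ℤ) (γ : SL(2, ℝ)) :
    slash k γ F ∈ holGrowth := by
  refine ⟨(holSlash k γ ⟨F, hF.1⟩).2, ?_⟩
  have h : slash k γ F = (jFactor γ ^ (-k)) * fun τ => F (γ • τ) := by
    ext τ
    simp [slash_eq]
  rw [h]
  exact (jFactor_zpow_mem_holGrowth γ (-k)).2.mul (hF.2.comp_smul γ)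

theorem qmVar_mem_holGrowth (γ : SL(2, ℝ)) : qmVar γ ∈ holGrowth := by
  have h : qmVar γ = ((2 * Real.pi * Complex.I)⁻¹ * (γ 1 0 : ℂ)) • (jFactor γ)⁻¹ := by
    ext τ
    simp [qmVar_eq, div_eq_mul_inv, mul_assoc]
  rw [h]
  exact Subalgebra.smul_mem _ (jFactor_inv_mem_holGrowth γ) _

/-- By `qmVar_sub` the inverse difference is a constant times a product of two factors of
automorphy; these are the denominators in Lagrange interpolation. -/
theorem qmVar_sub_inv_mem_holGrowth (γ α : SL(2, ℝ)) :
    (qmVar γ - qmVar α)⁻¹ ∈ holGrowth := by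
  have h : (qmVar γ - qmVar α)⁻¹ = (2 * Real.pi * Complex.I *
      ((γ 1 0 * α 1 1 - γ 1 1 * α 1 0 : ℝ) : ℂ)⁻¹) • (jFactor γ * jFactor α) := by
    ext τ
    rw [Pi.inv_apply, Pi.sub_apply, qmVar_sub, mul_inv, mul_inv, mul_inv]
    simp
    ring
  rw [h]
  exact Subalgebra.smul_mem _
    (mul_mem (jFactor_mem_holGrowth γ) (jFactor_mem_holGrowth α)) _

/-! ### Coefficients of quasimodular forms -/

theorem qmVar_injective {g : ℕ → SL(2, ℝ)}
    (hg : ∀ i j, i ≠ j → g i 1 0 * g j 1 1 - g i 1 1 * g j 1 0 ≠ 0) (τ : ℍ) :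
    Function.Injective fun i => qmVar (g i) τ := by
  intro i j hij
  by_contra h
  have h1 := qmVar_sub (g j) (g i) τ
  rw [sub_eq_zero.2 hij, eq_comm, mul_eq_zero, mul_eq_zero, mul_eq_zero] at h1
  rcases h1 with h1 | (h1 | h1) | h1
  · exact inv_ne_zero Complex.two_pi_I_ne_zero h1
  · exact hg i j h (by exact_mod_cast h1)
  · exact inv_ne_zero (jFactor_ne_zero _ _) h1
  · exact inv_ne_zero (jFactor_ne_zero _ _) h1

variable {Γ : Subgroup SL(2, ℝ)} {K : ℤ} {F : ℍ → ℂ}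

theorem IsTransfPoly.unique (hΓ : IsLattice Γ) {τ : ℍ} {P Q : Polynomial ℂ}
    (hP : IsTransfPoly Γ K F τ P) (hQ : IsTransfPoly Γ K F τ Q) : P = Q := by
  obtain ⟨g, hg, hg'⟩ := hΓ.exists_seq
  refine Polynomial.eq_of_infinite_eval_eq P Q
    ((Set.infinite_range_of_injective (qmVar_injective hg' τ)).mono ?_)
  rintro _ ⟨i, rfl⟩
  exact (hP _ (hg i)).symm.trans (hQ _ (hg i))

theorem transfPoly_eq (hΓ : IsLattice Γ) {τ : ℍ} {P : Polynomial ℂ}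
    (hP : IsTransfPoly Γ K F τ P) : transfPoly Γ K F τ = P := by
  have h : ∃ P, IsTransfPoly Γ K F τ P := ⟨P, hP⟩
  rw [transfPoly, dif_pos h]
  exact h.choose_spec.unique hΓ hP

theorem HasDepthLE.isTransfPoly (hΓ : IsLattice Γ) {n : ℕ} (hF : HasDepthLE Γ K n F) (τ : ℍ) :
    IsTransfPoly Γ K F τ (transfPoly Γ K F τ) := by
  obtain ⟨P, -, hP⟩ := hF τ
  rwa [transfPoly_eq hΓ hP]

theorem HasDepthLE.natDegree_le (hΓ : IsLattice Γ) {n : ℕ} (hF : HasDepthLE Γ K n F) (τ : ℍ) :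
    (transfPoly Γ K F τ).natDegree ≤ n := by
  obtain ⟨P, hn, hP⟩ := hF τ
  rwa [transfPoly_eq hΓ hP]

variable (Γ K F) in
/-- The coefficient of `1 / (τ - conj τ) ^ m` in the completion of `F`. -/
def qmCoeff (m : ℕ) (τ : ℍ) : ℂ := (transfPoly Γ K F τ).coeff m / (2 * Real.pi * Complex.I) ^ m

theorem HasDepthLE.qmCoeff_eq_zero (hΓ : IsLattice Γ) {n m : ℕ} (hF : HasDepthLE Γ K n F)
    (hm : n < m) : qmCoeff Γ K F m = 0 := by
  ext τ
  simp [qmCoeff, Polynomial.coeff_eq_zero_of_natDegree_lt ((hF.natDegree_le hΓ τ).trans_lt hm)]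

theorem HasDepthLE.of_qmCoeff_eq_zero (hΓ : IsLattice Γ) {n N : ℕ} (hF : HasDepthLE Γ K N F)
    (h : ∀ m, n < m → qmCoeff Γ K F m = 0) : HasDepthLE Γ K n F := by
  refine fun τ => ⟨transfPoly Γ K F τ, ?_, hF.isTransfPoly hΓ τ⟩
  rw [Polynomial.natDegree_le_iff_coeff_eq_zero]
  intro m hm
  have h1 := congrFun (h m hm) τ
  exact (div_eq_zero_iff.1 h1).resolve_right (pow_ne_zero _ Complex.two_pi_I_ne_zero)

theorem HasDepthLE.qmCoeff_zero (hΓ : IsLattice Γ) {n : ℕ} (hF : HasDepthLE Γ K n F) :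
    qmCoeff Γ K F 0 = F := by
  ext τ
  have h := hF.isTransfPoly hΓ τ 1 Γ.one_mem
  rw [qmCoeff, pow_zero, div_one, Polynomial.coeff_zero_eq_eval_zero]
  simpa [slash_eq, jFactor, qmVar] using h.symm

theorem HasDepthLE.completion_eq (hΓ : IsLattice Γ) {n : ℕ} (hF : HasDepthLE Γ K n F) (τ : ℍ) :
    completion Γ K F τ = ∑ m ∈ Finset.range (n + 1),
      qmCoeff Γ K F m τ / ((τ : ℂ) - conj (τ : ℂ)) ^ m := by
  rw [completion, Polynomial.eval_eq_sum_range' (Nat.lt_succ_of_le (hF.natDegree_le hΓ τ))]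
  refine Finset.sum_congr rfl fun m _ => ?_
  rw [qmCoeff, inv_pow, mul_pow, div_div, div_eq_mul_inv]

/-- The transformation polynomial is interpolated from its values at `n + 1` elements of `Γ` whose
nodes stay distinct at every `τ`. Values, nodes and inverse differences of nodes all lie in
`holGrowth`, so the interpolation can be done once over this algebra and then evaluated pointwise.
-/
theorem HasDepthLE.qmCoeff_mem_holGrowth (hΓ : IsLattice Γ) {n : ℕ} (hF : HasDepthLE Γ K n F)
    (hF' : F ∈ holGrowth) (m : ℕ) : qmCoeff Γ K F m ∈ holGrowth := by
  obtain ⟨g, hg, hg'⟩ := hΓ.exists_seq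
  let s : ℕ → holGrowth := fun i => ⟨slash K (g i) F, slash_mem_holGrowth hF' K (g i)⟩
  let v : ℕ → holGrowth := fun i => ⟨qmVar (g i), qmVar_mem_holGrowth (g i)⟩
  let w : ℕ → ℕ → holGrowth := fun i j =>
    ⟨(qmVar (g i) - qmVar (g j))⁻¹, qmVar_sub_inv_mem_holGrowth (g i) (g j)⟩
  let P : Polynomial holGrowth := ∑ i ∈ Finset.range (n + 1), Polynomial.C (s i) *
    ∏ j ∈ (Finset.range (n + 1)).erase i, (Polynomial.C (w i j) * (Polynomial.X - Polynomial.C (v j)))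
  have hP : ∀ τ, transfPoly Γ K F τ =
      P.map ((Pi.evalRingHom (fun _ : ℍ => ℂ) τ).comp holGrowth.val.toRingHom) := by
    intro τ
    have h1 := Lagrange.eq_interpolate_of_eval_eq (s := Finset.range (n + 1))
      (v := fun i => qmVar (g i) τ) (fun i => slash K (g i) F τ) (f := transfPoly Γ K F τ)
      (qmVar_injective hg' τ).injOn ?_ fun i _ => ((hF.isTransfPoly hΓ τ) _ (hg i)).symm
    · rw [h1, Lagrange.interpolate_apply, Polynomial.map_sum]
      refine Finset.sum_congr rfl fun i _ => ?_
      rw [Polynomial.map_mul, Polynomial.map_prod, Lagrange.basis, Polynomial.map_C]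
      congr 1
      refine Finset.prod_congr rfl fun j _ => ?_
      rw [Polynomial.map_mul, Polynomial.map_C, Polynomial.map_sub, Polynomial.map_X,
        Polynomial.map_C]
      rfl
    · rw [Finset.card_range]
      exact (Polynomial.degree_le_natDegree).trans_lt
        (by exact_mod_cast Nat.lt_succ_of_le (hF.natDegree_le hΓ τ))
  have h2 : qmCoeff Γ K F m = ((2 * Real.pi * Complex.I : ℂ) ^ m)⁻¹ • (P.coeff m : ℍ → ℂ) := by
    ext τ
    rw [qmCoeff, hP, Polynomial.coeff_map, div_eq_inv_mul]
    rfl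
  rw [h2]
  exact Subalgebra.smul_mem _ (P.coeff m).2 _

/-! ### Transformation of the coefficients -/

/-- The transform under `γ` of the coefficients `G 0, …, G n` of an almost holomorphic function. -/
def quasiTransform (K : ℤ) (n : ℕ) (γ : SL(2, ℝ)) (G : ℕ → ℍ → ℂ) (i : ℕ) (τ : ℍ) : ℂ :=
  ∑ m ∈ Finset.range (n + 1), (m.choose i : ℂ) * (-(γ 1 0 : ℂ)) ^ (m - i) *
    jFactor γ τ ^ ((m : ℤ) + i - K) * G m (γ • τ)

theorem coeff_comp_linear {P : Polynomial ℂ} {n : ℕ} (hP : P.natDegree ≤ n) (b x : ℂ) (i : ℕ) :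
    (P.comp (Polynomial.C b * (Polynomial.X + Polynomial.C x))).coeff i =
      ∑ m ∈ Finset.range (n + 1), P.coeff m * (b ^ m * (x ^ (m - i) * (m.choose i : ℂ))) := by
  rw [Polynomial.comp, Polynomial.eval₂_eq_sum_range' _ (Nat.lt_succ_of_le hP),
    Polynomial.finsetSum_coeff]
  refine Finset.sum_congr rfl fun m _ => ?_
  rw [mul_pow, ← Polynomial.C_pow, Polynomial.coeff_C_mul, Polynomial.coeff_C_mul,
    Polynomial.coeff_X_add_C_pow]

/-- By uniqueness it suffices to test the right side on `α ∈ Γ`, which is the law at `γ τ` for `α *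
γ⁻¹` rewritten by the two cocycle relations. -/
theorem HasDepthLE.transfPoly_eq_comp (hΓ : IsLattice Γ) {n : ℕ} (hF : HasDepthLE Γ K n F)
    {γ : SL(2, ℝ)} (hγ : γ ∈ Γ) (τ : ℍ) :
    transfPoly Γ K F τ = Polynomial.C (jFactor γ τ ^ (-K)) *
      (transfPoly Γ K F (γ • τ)).comp
        (Polynomial.C (jFactor γ τ ^ 2) * (Polynomial.X + Polynomial.C (-qmVar γ τ))) := by
  refine transfPoly_eq hΓ fun α hα => ?_
  have h1 := hF.isTransfPoly hΓ (γ • τ) (α * γ⁻¹) (Γ.mul_mem hα (Γ.inv_mem hγ))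
  have h2 := qmVar_mul (α * γ⁻¹) γ τ
  have h3 := jFactor_mul (α * γ⁻¹) γ τ
  have hj := jFactor_ne_zero γ τ
  rw [inv_mul_cancel_right] at h2 h3
  have h4 : jFactor γ τ ^ 2 * (qmVar α τ + -qmVar γ τ) = qmVar (α * γ⁻¹) (γ • τ) := by
    rw [h2, zpow_neg, zpow_ofNat]
    field_simp
    ring
  rw [Polynomial.eval_mul, Polynomial.eval_C, Polynomial.eval_comp]
  simp only [Polynomial.eval_mul, Polynomial.eval_C, Polynomial.eval_add, Polynomial.eval_X]
  rw [h4, ← h1, slash_eq, slash_eq, h3, mul_zpow, smul_smul, inv_mul_cancel_right]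
  ring

/-- Modularity of the completion, coefficient by coefficient: with `j = jFactor γ τ`, passing to `γ
τ` replaces `1 / (τ - conj τ)` by `j² / (τ - conj τ) - c j`, and the `m`-th power is expanded. -/
theorem HasDepthLE.qmCoeff_eq_quasiTransform (hΓ : IsLattice Γ) {n : ℕ} (hF : HasDepthLE Γ K n F)
    {γ : SL(2, ℝ)} (hγ : γ ∈ Γ) (i : ℕ) :
    qmCoeff Γ K F i = quasiTransform K n γ (qmCoeff Γ K F) i := by
  ext τ
  have hj := jFactor_ne_zero γ τ
  have hpi := Complex.two_pi_I_ne_zero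
  rw [qmCoeff, hF.transfPoly_eq_comp hΓ hγ τ, Polynomial.coeff_C_mul,
    coeff_comp_linear (hF.natDegree_le hΓ _), quasiTransform, Finset.mul_sum, Finset.sum_div]
  refine Finset.sum_congr rfl fun m _ => ?_
  rw [qmCoeff]
  rcases lt_or_ge m i with h | h
  · simp [Nat.choose_eq_zero_of_lt h]
  · obtain ⟨t, rfl⟩ := Nat.exists_eq_add_of_le h
    have h1 : jFactor γ τ ^ (((i + t : ℕ) : ℤ) + i - K) =
        jFactor γ τ ^ (-K) * (jFactor γ τ ^ (2 * i + t)) := by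
      rw [← zpow_natCast, ← zpow_add₀ hj]
      congr 1
      push_cast
      ring
    rw [h1, qmVar_eq, show i + t - i = t by omega, neg_pow, neg_pow (γ 1 0 : ℂ), mul_pow, div_pow]
    generalize (2 * Real.pi * Complex.I : ℂ) = p at *
    generalize jFactor γ τ ^ (-K) = q
    rw [inv_pow]
    field_simp
    ring

/-- The zeroth component of the law alone, applied to `γ⁻¹` at the point `γ τ`, is the quasimodular
transformation of `G 0`. -/
theorem isTransfPoly_of_quasiTransform {n : ℕ} {G : ℕ → ℍ → ℂ}
    (hG : ∀ γ ∈ Γ, G 0 = quasiTransform K n γ G 0) (τ : ℍ) :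
    IsTransfPoly Γ K (G 0) τ (∑ m ∈ Finset.range (n + 1),
      Polynomial.C (G m τ * (2 * Real.pi * Complex.I) ^ m) * Polynomial.X ^ m) := by
  intro γ hγ
  have hj := jFactor_ne_zero γ τ
  have hpi := Complex.two_pi_I_ne_zero
  rw [slash_eq, hG γ⁻¹ (Γ.inv_mem hγ), quasiTransform, Polynomial.eval_finsetSum, Finset.mul_sum]
  refine Finset.sum_congr rfl fun m _ => ?_
  have h1 : (jFactor γ τ)⁻¹ ^ ((m : ℤ) + (0 : ℕ) - K) =
      jFactor γ τ ^ K * (jFactor γ τ ^ m)⁻¹ := by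
    rw [inv_zpow, ← zpow_neg, ← zpow_natCast, ← zpow_neg, ← zpow_add₀ hj]
    congr 1
    push_cast
    ring
  rw [jFactor_inv, h1, SL_inv_one_zero, inv_smul_smul, Nat.choose_zero_right, zpow_neg, qmVar_eq]
  have hq : jFactor γ τ ^ K ≠ 0 := zpow_ne_zero _ hj
  simp only [Polynomial.eval_mul, Polynomial.eval_C, Polynomial.eval_pow, Polynomial.eval_X]
  generalize (2 * Real.pi * Complex.I : ℂ) = p at *
  rw [mul_pow, inv_pow, div_pow, Nat.sub_zero]
  push_cast
  field_simp

theorem qmCoeff_eq_of_quasiTransform (hΓ : IsLattice Γ) {n : ℕ} {G : ℕ → ℍ → ℂ}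
    (hG : ∀ γ ∈ Γ, G 0 = quasiTransform K n γ G 0) {m : ℕ} (hm : m ≤ n) :
    qmCoeff Γ K (G 0) m = G m := by
  ext τ
  rw [qmCoeff, transfPoly_eq hΓ (isTransfPoly_of_quasiTransform hG τ), Polynomial.finsetSum_coeff]
  simp only [Polynomial.coeff_C_mul_X_pow]
  rw [Finset.sum_ite_eq, if_pos (Finset.mem_range.2 (Nat.lt_succ_of_le hm)),
    mul_div_cancel_right₀ _ (pow_ne_zero _ Complex.two_pi_I_ne_zero)]

/-! ### The depth is at most half the weight -/

/-- The transformation law is triangular, so the top coefficient is a modular form of weight `K - 2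
(n + 1) < 0`. -/
theorem HasDepthLE.pred (hΓ : IsLattice Γ) {n : ℕ} (hF : HasDepthLE Γ K (n + 1) F)
    (hF' : F ∈ holGrowth) (hn : K < 2 * (n + 1 : ℕ)) : HasDepthLE Γ K n F := by
  have hmem := hF.qmCoeff_mem_holGrowth hΓ hF' (n + 1)
  have h0 : qmCoeff Γ K F (n + 1) = 0 := by
    refine hΓ.eq_zero_of_neg_weight (m := (2 * (n + 1 : ℕ) - K).toNat) (by omega) hmem.1 hmem.2 ?_
    intro γ hγ τ
    have h := congrFun (hF.qmCoeff_eq_quasiTransform hΓ hγ (n + 1)) τ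
    rw [quasiTransform, Finset.sum_eq_single (n + 1)] at h
    · rw [h, ← zpow_natCast]
      change _ * jFactor γ τ ^ _ = _
      rw [show (((2 * (n + 1 : ℕ) - K).toNat : ℕ) : ℤ) = (n + 1 : ℕ) + (n + 1 : ℕ) - K by omega]
      simp
      ring
    · intro m hm hm'
      rw [Nat.choose_eq_zero_of_lt (lt_of_le_of_ne (Nat.lt_succ_iff.1 (Finset.mem_range.1 hm)) hm')]
      simp
    · intro h
      simp at h
  refine hF.of_qmCoeff_eq_zero hΓ fun m hm => ?_
  rcases (Nat.succ_le_of_lt hm).eq_or_lt with h | h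
  · rw [← h, h0]
  · exact hF.qmCoeff_eq_zero hΓ h

theorem HasDepthLE.of_weight (hΓ : IsLattice Γ) {n N : ℕ} (hF : HasDepthLE Γ K n F)
    (hF' : F ∈ holGrowth) (hN : K < 2 * (N + 1 : ℕ)) : HasDepthLE Γ K N F := by
  induction n with
  | zero => exact hF.of_qmCoeff_eq_zero hΓ fun m hm => hF.qmCoeff_eq_zero hΓ (by omega)
  | succ n ih =>
    rcases le_or_gt (n + 1) N with h | h
    · exact hF.of_qmCoeff_eq_zero hΓ fun m hm => hF.qmCoeff_eq_zero hΓ (by omega)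
    · exact ih (hF.pred hΓ hF' (by omega))

/-! ### Coefficients of the holomorphic projection -/

/-- The coefficient of `d ^ m h / dτ ^ m` in the weight `w` projection of `h / (τ - conj τ) ^ m`. -/
def projCoeff (w : ℤ) (m : ℕ) : ℂ := (-1) ^ m / (ascPochhammer ℂ m).eval ((w : ℂ) - m - 1)

theorem projCoeff_zero (w : ℤ) : projCoeff w 0 = 1 := by simp [projCoeff]

theorem projCoeff_eq {N m : ℕ} (hm : m ≤ N) :
    projCoeff (N + 2 : ℕ) m = (-1) ^ m * ((N - m).factorial / N.factorial) := by
  obtain ⟨n, rfl⟩ := Nat.exists_eq_add_of_le' hm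
  have h0 : (n.factorial : ℂ) ≠ 0 := by exact_mod_cast n.factorial_ne_zero
  have h1 := factorial_mul_ascPochhammer ℂ n m
  have h2 : ((((n + m + 2 : ℕ) : ℤ) : ℂ) - m - 1) = (n : ℂ) + 1 := by
    push_cast
    ring
  rw [projCoeff, h2, ← h1, Nat.add_sub_cancel, div_mul_eq_div_div, div_self h0, mul_one_div]

theorem projCoeff_ne_zero {w : ℤ} {m : ℕ} (hm : m ≤ (w - 2).toNat) : projCoeff w m ≠ 0 := by
  rcases le_or_gt w 1 with hw | hw
  · obtain rfl : m = 0 := by omega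
    simp [projCoeff_zero]
  · obtain ⟨N, rfl⟩ : ∃ N : ℕ, w = (N + 2 : ℕ) := ⟨(w - 2).toNat, by omega⟩
    rw [projCoeff_eq (by omega)]
    have h1 : ((N - m).factorial : ℂ) ≠ 0 := by exact_mod_cast Nat.factorial_ne_zero _
    have h2 : (N.factorial : ℂ) ≠ 0 := by exact_mod_cast Nat.factorial_ne_zero _
    exact mul_ne_zero (pow_ne_zero _ (by simp)) (div_ne_zero h1 h2)

/-- Both sides are `a! (b - t)! / (a - t)!` for `t ≤ a`, and both vanish for `t > a`. -/
theorem factorial_mul_descFactorial_comm {a b t : ℕ} (hab : a ≤ b) (ht : t ≤ b) :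
    a.descFactorial t * (b - t).factorial = a.factorial * (b - t).descFactorial (b - a) := by
  rcases le_or_gt t a with h | h
  · have h1 := Nat.factorial_mul_descFactorial h
    have h2 := Nat.factorial_mul_descFactorial (show b - a ≤ b - t by omega)
    rw [show b - t - (b - a) = a - t by omega] at h2
    rw [← h1, ← h2]
    ring
  · rw [Nat.descFactorial_eq_zero_iff_lt.2 h, Nat.descFactorial_eq_zero_iff_lt.2 (by omega)]
    simp

/-- Isolates the dependence on `t`: apart from the sign and the binomial coefficient it is a
polynomial in `t` of degree `m - l - 1`, one too small to survive an alternating sum over `0 ≤ t ≤ m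
- l`. -/
theorem projCoeff_mul_mobiusCoeff {N m l t : ℕ} (hm : m ≤ N) (ht : l + t ≤ m) (hl : l < m) :
    projCoeff (N + 2 : ℕ) (l + t) * (m.choose (l + t) : ℂ) *
        mobiusCoeff (((N + 2 : ℕ) : ℤ) - m - (l + t : ℕ) : ℤ) (l + t) l =
      (-1) ^ l * (m.choose l : ℂ) * ((N + 1 - m).factorial / N.factorial) *
        ((-1) ^ t * ((m - l).choose t : ℂ) * ((N - l - t).descFactorial (m - l - 1) : ℂ)) := by
  have h1 : (((N + 1 - m).descFactorial t : ℂ)) * (N - l - t).factorial =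
      (N + 1 - m).factorial * (N - l - t).descFactorial (m - l - 1) := by
    have := factorial_mul_descFactorial_comm (show N + 1 - m ≤ N - l by omega)
      (show t ≤ N - l by omega)
    rw [show N - l - (N + 1 - m) = m - l - 1 by omega] at this
    exact_mod_cast this
  have h2 : (m.choose (l + t) : ℂ) * ((l + t).choose l : ℂ) = m.choose l * (m - l).choose t := by
    have := Nat.choose_mul (n := m) (Nat.le_add_right l t)
    rw [Nat.add_sub_cancel_left] at this
    exact_mod_cast this
  have h3 : (ascPochhammer ℂ t).eval ((((((N + 2 : ℕ) : ℤ) - m - (l + t : ℕ) : ℤ)) : ℂ) + l) =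
      (N + 1 - m).descFactorial t := by
    rw [← descPochhammer_eval_eq_descFactorial, descPochhammer_eval_eq_ascPochhammer]
    congr 1
    rw [Nat.cast_sub (by omega)]
    push_cast
    ring
  rw [projCoeff_eq (ht.trans hm), mobiusCoeff, Nat.add_sub_cancel_left, h3,
    show N - (l + t) = N - l - t by omega, pow_add]
  linear_combination (-1) ^ l * (-1) ^ t * (N.factorial : ℂ)⁻¹ *
    ((m.choose (l + t) : ℂ) * ((l + t).choose l : ℂ) * h1 +
      (N + 1 - m).factorial * (N - l - t).descFactorial (m - l - 1) * h2)

/-- The identity behind the equivariance of the projection. Terms with `i < l` vanish, and for `l <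
m` the rest is an `(m - l)`-th finite difference of a polynomial of smaller degree. -/
theorem sum_projCoeff_mul_mobiusCoeff {w : ℤ} {m : ℕ} (hm : m ≤ (w - 2).toNat) (l : ℕ) :
    ∑ i ∈ Finset.range (m + 1), projCoeff w i * (m.choose i : ℂ) *
      mobiusCoeff (w - m - i : ℤ) i l = if l = m then projCoeff w m else 0 := by
  rcases lt_trichotomy l m with hl | rfl | hl
  · obtain ⟨N, rfl⟩ : ∃ N : ℕ, w = (N + 2 : ℕ) := ⟨(w - 2).toNat, by omega⟩
    have hmN : m ≤ N := by omega
    rw [if_neg hl.ne, show m + 1 = l + (m - l + 1) by omega, Finset.sum_range_add,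
      Finset.sum_eq_zero fun i hi => ?_, zero_add]
    · have hdeg : ((descPochhammer ℂ (m - l - 1)).comp
          (Polynomial.C ((N - l : ℕ) : ℂ) - Polynomial.X)).natDegree < m - l := by
        refine Polynomial.natDegree_comp_le.trans_lt ?_
        rw [descPochhammer_natDegree]
        have h1 : (Polynomial.C ((N - l : ℕ) : ℂ) - Polynomial.X).natDegree ≤ 1 :=
          (Polynomial.natDegree_sub_le _ _).trans (by simp)
        have := Nat.mul_le_mul_left (m - l - 1) h1
        omega
      have h := sum_neg_one_pow_choose_mul_eval hdeg
      refine Eq.trans ?_ ((congrArg (fun x : ℂ => (-1) ^ l * (m.choose l : ℂ) *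
        ((N + 1 - m).factorial / N.factorial) * x) h).trans (mul_zero _))
      rw [Finset.mul_sum]
      refine Finset.sum_congr rfl fun t ht => ?_
      have ht' : t ≤ m - l := Nat.lt_succ_iff.1 (Finset.mem_range.1 ht)
      rw [projCoeff_mul_mobiusCoeff hmN (by omega) hl, Polynomial.eval_comp, Polynomial.eval_sub,
        Polynomial.eval_C, Polynomial.eval_X, ← Nat.cast_sub (by omega),
        descPochhammer_eval_eq_descFactorial]
    · rw [mobiusCoeff_of_lt _ (Finset.mem_range.1 hi), mul_zero]
  · rw [if_pos rfl, Finset.sum_range_succ, Finset.sum_eq_zero fun i hi => ?_]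
    · simp [mobiusCoeff]
    · rw [mobiusCoeff_of_lt _ (Finset.mem_range.1 hi), mul_zero]
  · rw [if_neg hl.ne']
    refine Finset.sum_eq_zero fun i hi => ?_
    rw [mobiusCoeff_of_lt _ (lt_of_lt_of_le (Finset.mem_range.1 hi) hl), mul_zero]

/-! ### Equivariance of the projection -/

theorem derivH_slash {f : ℍ → ℂ} (hf : MDiff f) (s : ℤ) (γ : SL(2, ℝ)) (i : ℕ) (τ : ℍ) :
    derivH i (slash s γ f) τ = ∑ l ∈ Finset.range (i + 1), mobiusCoeff s i l *
      (-(γ 1 0 : ℂ)) ^ (i - l) * jFactor γ τ ^ (-s - i - l) * derivH l f (γ • τ) := by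
  have hpos : ∀ u : ℂ, 0 < u.im → (γ 1 0 : ℂ) * u + γ 1 1 ≠ 0 ∧
      0 < (((γ 0 0 : ℂ) * u + γ 0 1) / ((γ 1 0 : ℂ) * u + γ 1 1)).im := by
    intro u hu
    refine ⟨SL_denom_ne_zero γ ⟨u, hu⟩, ?_⟩
    have h := SL_smul_coe γ ⟨u, hu⟩
    change _ = ((γ 0 0 : ℂ) * u + γ 0 1) / ((γ 1 0 : ℂ) * u + γ 1 1) at h
    rw [← h]
    exact (γ • (⟨u, hu⟩ : ℍ)).im_pos
  have hev : (slash s γ f ∘ ofComplex) =ᶠ[nhds (τ : ℂ)] fun u => ((γ 1 0 : ℂ) * u + γ 1 1) ^ (-s) *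
      (f ∘ ofComplex) (((γ 0 0 : ℂ) * u + γ 0 1) / ((γ 1 0 : ℂ) * u + γ 1 1)) := by
    filter_upwards [isOpen_upperHalfPlaneSet.mem_nhds τ.im_pos] with u hu
    have hu' : 0 < u.im := hu
    have h := SL_smul_coe γ ⟨u, hu'⟩
    change _ = ((γ 0 0 : ℂ) * u + γ 0 1) / ((γ 1 0 : ℂ) * u + γ 1 1) at h
    rw [← h, Function.comp_apply, Function.comp_apply, ofComplex_apply, ofComplex_apply_of_im_pos hu',
      slash_apply]
  have h1 := hpos τ τ.im_pos
  have hd : (γ 0 0 : ℂ) * γ 1 1 - γ 0 1 * γ 1 0 = 1 := by exact_mod_cast SL_det γ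
  rw [derivH, hev.iteratedDeriv_eq, iteratedDeriv_mobius hf _ _ _ _ _ _ h1.1 h1.2]
  refine Finset.sum_congr rfl fun l _ => ?_
  rw [hd, one_pow, mul_one, ← SL_smul_coe, Function.comp_apply, ofComplex_apply]
  rfl

/-- Displays the transform as a combination of slashes of weight `K - m - i`, to which
`derivH_slash` applies. -/
theorem quasiTransform_eq_sum (K : ℤ) (n : ℕ) (γ : SL(2, ℝ)) (G : ℕ → ℍ → ℂ) (i : ℕ) :
    quasiTransform K n γ G i = ∑ m ∈ Finset.range (n + 1),
      ((m.choose i : ℂ) * (-(γ 1 0 : ℂ)) ^ (m - i)) • slash (K - m - i) γ (G m) := by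
  ext τ
  rw [Finset.sum_apply, quasiTransform]
  refine Finset.sum_congr rfl fun m _ => ?_
  rw [Pi.smul_apply, slash_eq, smul_eq_mul, show -(K - m - i : ℤ) = m + i - K by ring]
  ring

theorem mdiff_slash {f : ℍ → ℂ} (hf : MDiff f) (k : ℤ) (γ : SL(2, ℝ)) : MDiff (slash k γ f) :=
  (holSlash k γ ⟨f, hf⟩).2

theorem mdiff_quasiTransform (K : ℤ) {n : ℕ} (γ : SL(2, ℝ)) {G : ℕ → ℍ → ℂ}
    (hG : ∀ m, MDiff (G m)) (i : ℕ) : MDiff (quasiTransform K n γ G i) := by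
  rw [quasiTransform_eq_sum]
  exact Submodule.sum_mem Hol fun m _ => Submodule.smul_mem Hol _ (mdiff_slash (hG m) _ _)

theorem slash_mul_quasiTransform (k K : ℤ) (n : ℕ) (γ : SL(2, ℝ)) (f : ℍ → ℂ) (G : ℕ → ℍ → ℂ)
    (i : ℕ) : slash k γ f * quasiTransform K n γ G i =
      quasiTransform (k + K) n γ (fun m => f * G m) i := by
  ext τ
  have hj := jFactor_ne_zero γ τ
  rw [Pi.mul_apply, quasiTransform, quasiTransform, slash_eq, Finset.mul_sum]
  refine Finset.sum_congr rfl fun m _ => ?_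
  rw [show (m + i - (k + K) : ℤ) = -k + (m + i - K) by ring, zpow_add₀ hj, Pi.mul_apply]
  ring

/-- The weight `w` projection of `∑ m ≤ n, h m / (τ - conj τ) ^ m`. -/
def projOp (w : ℤ) (n : ℕ) (h : ℕ → ℍ → ℂ) : ℍ → ℂ :=
  ∑ m ∈ Finset.range (n + 1), projCoeff w m • derivH m (h m)

theorem projOp_apply (w : ℤ) (n : ℕ) (h : ℕ → ℍ → ℂ) (τ : ℍ) :
    projOp w n h τ = ∑ m ∈ Finset.range (n + 1), projCoeff w m * derivH m (h m) τ := by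
  simp [projOp]

/-- In the expansion of the left side, the power of `c` and of the factor of automorphy multiplying
the `l`-th derivative of `h m` does not depend on `i`. The sum over `i` is therefore purely
numerical, and by `sum_projCoeff_mul_mobiusCoeff` only `l = m` remains. -/
theorem projOp_quasiTransform {w : ℤ} {n : ℕ} (hn : n ≤ (w - 2).toNat) (γ : SL(2, ℝ))
    {h : ℕ → ℍ → ℂ} (hh : ∀ m, MDiff (h m)) :
    projOp w n (quasiTransform w n γ h) = slash w γ (projOp w n h) := by
  ext τ
  have hj := jFactor_ne_zero γ τ
  set c : ℂ := -(γ 1 0 : ℂ) with hc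
  have h1 : ∀ i ∈ Finset.range (n + 1), projCoeff w i * derivH i (quasiTransform w n γ h i) τ =
      ∑ m ∈ Finset.range (n + 1), ∑ l ∈ Finset.range (n + 1), projCoeff w i * (m.choose i : ℂ) *
        mobiusCoeff (w - m - i : ℤ) i l *
          (c ^ (m - l) * jFactor γ τ ^ ((m : ℤ) - w - l) * derivH l (h m) (γ • τ)) := by
    intro i hi
    rw [quasiTransform_eq_sum, derivH_sum _ fun m _ => ?_, Finset.sum_apply, Finset.mul_sum]
    · refine Finset.sum_congr rfl fun m _ => ?_
      rw [derivH_smul, Pi.smul_apply, derivH_slash (hh m), smul_eq_mul, Finset.mul_sum,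
        Finset.mul_sum, ← Finset.sum_subset (Finset.range_mono (Finset.mem_range.1 hi))]
      · refine Finset.sum_congr rfl fun l hl => ?_
        rcases lt_or_ge m i with him | him
        · simp [Nat.choose_eq_zero_of_lt him]
        · have hl' : l ≤ i := Nat.lt_succ_iff.1 (Finset.mem_range.1 hl)
          rw [← hc, show (-(w - m - i : ℤ) - i - l : ℤ) = m - w - l by ring,
            show m - l = (m - i) + (i - l) by omega, pow_add]
          ring
      · intro l _ hl
        rw [mobiusCoeff_of_lt _ (by simpa using hl)]
        simp
    · exact (mdiff_slash (hh m) _ _).const_smul _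
  rw [projOp_apply, Finset.sum_congr rfl h1, Finset.sum_comm, slash_eq, projOp_apply,
    Finset.mul_sum]
  refine Finset.sum_congr rfl fun m hm => ?_
  have hm' : m ≤ n := Nat.lt_succ_iff.1 (Finset.mem_range.1 hm)
  rw [Finset.sum_comm]
  have h2 : ∀ l, ∑ i ∈ Finset.range (n + 1), projCoeff w i * (m.choose i : ℂ) *
      mobiusCoeff (w - m - i : ℤ) i l = if l = m then projCoeff w m else 0 := by
    intro l
    rw [← sum_projCoeff_mul_mobiusCoeff (hm'.trans hn) l,
      ← Finset.sum_subset (Finset.range_mono (Finset.mem_range.1 hm))]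
    intro i _ hi
    rw [Nat.choose_eq_zero_of_lt (by simpa using hi)]
    simp
  simp only [← Finset.sum_mul, h2]
  rw [Finset.sum_eq_single_of_mem m hm fun l _ hl => by rw [if_neg hl, zero_mul], if_pos rfl,
    Nat.sub_self, show ((m : ℤ) - w - m) = -w by ring]
  ring

/-! ### Test functions -/

/-- The holomorphic function `(z - τ₀) ^ r`. -/
def powHol (τ₀ : ℍ) (r : ℕ) : Hol :=
  ⟨fun z => ((z : ℂ) - τ₀) ^ r, (mdifferentiable_coe.sub mdifferentiable_const).pow r⟩

theorem derivH_powHol (τ₀ : ℍ) (r i : ℕ) :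
    derivH i (powHol τ₀ r : ℍ → ℂ) τ₀ = if i = r then (r.factorial : ℂ) else 0 := by
  have hev : ((powHol τ₀ r : ℍ → ℂ) ∘ ofComplex) =ᶠ[nhds (τ₀ : ℂ)] fun z => (z - τ₀) ^ r := by
    filter_upwards [isOpen_upperHalfPlaneSet.mem_nhds τ₀.im_pos] with u hu
    have hu' : 0 < u.im := hu
    simp [powHol, ofComplex_apply_of_im_pos hu']
  rw [derivH, hev.iteratedDeriv_eq, iteratedDeriv_comp_sub_const i (fun z : ℂ => z ^ r) (τ₀ : ℂ),
    iteratedDeriv_eq_iterate]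
  simp only [sub_self, iter_deriv_pow]
  rw [← descPochhammer_eval_eq_prod_range, descPochhammer_eval_eq_descFactorial]
  split_ifs with h
  · rw [h, Nat.descFactorial_self]
    simp
  · rcases lt_or_gt_of_ne h with h | h
    · rw [zero_pow (by omega), mul_zero]
    · rw [Nat.descFactorial_eq_zero_iff_lt.2 h]
      simp

/-! ### Differential operators in terms of the projection -/

theorem sum_derivH_powHol_mul (τ₀ : ℍ) (c : ℕ → ℂ) (n : ℕ) {G : ℕ → ℍ → ℂ}
    (hG : ∀ m, MDiff (G m)) :
    ∑ m ∈ Finset.range (n + 1), c m * derivH m ((powHol τ₀ n : ℍ → ℂ) * G m) τ₀ =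
      c n * (n.factorial * G n τ₀) := by
  rw [Finset.sum_range_succ, Finset.sum_eq_zero, zero_add, derivH_mul (powHol τ₀ n).2 (hG n),
    Finset.sum_range_succ, Finset.sum_eq_zero, zero_add, derivH_powHol, if_pos rfl, Nat.sub_self,
    derivH_zero, Nat.choose_self, Nat.cast_one, one_mul]
  · intro i hi
    rw [derivH_powHol, if_neg (Finset.mem_range.1 hi).ne, mul_zero, zero_mul]
  · intro m hm
    rw [derivH_mul (powHol τ₀ n).2 (hG m), Finset.sum_eq_zero, mul_zero]
    intro i hi
    have hi' : i ≤ m := Nat.lt_succ_iff.1 (Finset.mem_range.1 hi)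
    rw [derivH_powHol, if_neg (hi'.trans_lt (Finset.mem_range.1 hm)).ne, mul_zero, zero_mul]

/-- If `f ↦ ∑ m ≤ n, c m * (f * G m) ^ (m)` at every point depends only on the derivatives of `f` of
order less than `q`, then `G m = 0` for `q ≤ m ≤ n`. -/
theorem eq_zero_of_sum_derivH_eq_zero {c : ℕ → ℂ} {q n : ℕ} (hc : ∀ m ≤ n, c m ≠ 0)
    {G : ℕ → ℍ → ℂ} (hG : ∀ m, MDiff (G m))
    (h : ∀ (f : Hol) (τ : ℍ), (∀ i < q, derivH i (f : ℍ → ℂ) τ = 0) →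
      ∑ m ∈ Finset.range (n + 1), c m * derivH m ((f : ℍ → ℂ) * G m) τ = 0)
    {m : ℕ} (hq : q ≤ m) (hm : m ≤ n) : G m = 0 := by
  induction n with
  | zero =>
    obtain rfl : m = 0 := by omega
    ext τ
    have h1 := h (powHol τ 0) τ fun i hi => by omega
    rw [sum_derivH_powHol_mul τ c 0 hG] at h1
    simpa [hc 0 le_rfl] using h1
  | succ n ih =>
    -- Descending elimination: on `(z - τ) ^ (n + 1)` only the top term with all derivatives on the
    -- power survives at `τ`.
    have hn : G (n + 1) = 0 := by
      ext τ
      have h1 := h (powHol τ (n + 1)) τ fun i hi => by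
        rw [derivH_powHol, if_neg (by omega)]
      rw [sum_derivH_powHol_mul τ c (n + 1) hG] at h1
      have h2 : ((n + 1).factorial : ℂ) ≠ 0 := by exact_mod_cast Nat.factorial_ne_zero _
      exact ((mul_eq_zero.1 h1).resolve_left (hc _ le_rfl) |> mul_eq_zero.1).resolve_left h2
    rcases hm.eq_or_lt with rfl | hm
    · exact hn
    · refine ih (fun m hm => hc m (by omega)) (fun f τ hf => ?_) (by omega)
      have h1 := h f τ hf
      have h2 : derivH (n + 1) (0 : ℍ → ℂ) = 0 := by
        simpa using derivH_smul 0 (0 : ℍ → ℂ) (n + 1)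
      rwa [Finset.sum_range_succ, hn, mul_zero, h2, Pi.zero_apply, mul_zero, add_zero] at h1

/-- Triangular elimination: the leading coefficient fixes the top `G`, because `projCoeff` does not
vanish, and the lower Leibniz terms it creates are subtracted from the remaining `a r`. -/
theorem exists_eq_projOp {w : ℤ} {n : ℕ} (hn : n ≤ (w - 2).toNat) {a : ℕ → ℍ → ℂ}
    (ha : ∀ r, a r ∈ holGrowth) : ∃ G : ℕ → ℍ → ℂ, (∀ m, G m ∈ holGrowth) ∧
      ∀ (f : Hol), projOp w n (fun m => (f : ℍ → ℂ) * G m) =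
        ∑ r ∈ Finset.range (n + 1), a r * derivH r (f : ℍ → ℂ) := by
  induction n generalizing a with
  | zero =>
    refine ⟨a, ha, fun f => ?_⟩
    simp [projOp, projCoeff_zero, derivH_zero, mul_comm]
  | succ n ih =>
    have hc := projCoeff_ne_zero hn
    set g : ℍ → ℂ := (projCoeff w (n + 1))⁻¹ • a (n + 1) with hg
    have hgm : g ∈ holGrowth := Subalgebra.smul_mem _ (ha _) _
    obtain ⟨G, hG, hG'⟩ := ih (by omega) (a := fun r => a r -
      (projCoeff w (n + 1) * ((n + 1).choose r : ℂ)) • derivH (n + 1 - r) g) fun r =>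
        sub_mem (ha r) (Subalgebra.smul_mem _ (derivH_mem_holGrowth hgm _) _)
    refine ⟨fun m => if m = n + 1 then g else G m, fun m => ?_, fun f => ?_⟩
    · beta_reduce
      split_ifs
      exacts [hgm, hG m]
    · have h1 : projOp w (n + 1) (fun m => (f : ℍ → ℂ) * if m = n + 1 then g else G m) =
          projOp w n (fun m => (f : ℍ → ℂ) * G m) +
            projCoeff w (n + 1) • derivH (n + 1) ((f : ℍ → ℂ) * g) := by
        rw [projOp, Finset.sum_range_succ, if_pos rfl, projOp]
        congr 1
        refine Finset.sum_congr rfl fun m hm => ?_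
        rw [if_neg (Finset.mem_range.1 hm).ne]
      rw [h1, hG']
      ext τ
      have h2 : a (n + 1) τ = projCoeff w (n + 1) * g τ := by
        rw [hg, Pi.smul_apply, smul_eq_mul, mul_inv_cancel_left₀ hc]
      rw [Pi.add_apply, Pi.smul_apply, derivH_mul f.2 hgm.1, Finset.sum_apply, Finset.sum_apply,
        Finset.sum_range_succ _ (n + 1), Finset.sum_range_succ _ (n + 1), smul_eq_mul, mul_add,
        Finset.mul_sum, ← add_assoc, ← Finset.sum_add_distrib]
      congr 1
      · refine Finset.sum_congr rfl fun r _ => ?_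
        simp only [Pi.mul_apply, Pi.sub_apply, Pi.smul_apply, smul_eq_mul]
        ring
      · rw [Nat.sub_self, derivH_zero, Nat.choose_self, Pi.mul_apply, h2]
        push_cast
        ring

/-! ### Differential operators of bounded order -/

theorem derivH_const_zero (m : ℕ) : derivH m (0 : ℍ → ℂ) = 0 := by
  simpa using derivH_smul 0 (0 : ℍ → ℂ) m

theorem hasOrderLE_iff {n : ℕ} {L : Hol →ₗ[ℂ] Hol} :
    HasOrderLE n L ↔ ∃ a : ℕ → ℍ → ℂ, (∀ r, a r ∈ holGrowth) ∧
      ∀ f : Hol, (L f : ℍ → ℂ) = ∑ r ∈ Finset.range (n + 1), a r * derivH r (f : ℍ → ℂ) := by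
  have hpi := Complex.two_pi_I_ne_zero
  constructor
  · rintro ⟨a, ha, haL⟩
    refine ⟨fun r => (2 * Real.pi * Complex.I : ℂ)⁻¹ ^ r • a r,
      fun r => Subalgebra.smul_mem holGrowth (ha r) _, fun f => ?_⟩
    ext τ
    rw [haL, Finset.sum_apply]
    refine Finset.sum_congr rfl fun r _ => ?_
    rw [iterate_D_eq_derivH]
    simp only [Pi.smul_apply, Pi.mul_apply, smul_eq_mul]
    ring
  · rintro ⟨a, ha, haL⟩
    refine ⟨fun r => (2 * Real.pi * Complex.I : ℂ) ^ r • a r,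
      fun r => Subalgebra.smul_mem holGrowth (ha r) _, fun f τ => ?_⟩
    rw [haL, Finset.sum_apply]
    refine Finset.sum_congr rfl fun r _ => ?_
    rw [iterate_D_eq_derivH]
    simp only [Pi.smul_apply, Pi.mul_apply, smul_eq_mul, inv_pow]
    generalize (2 * Real.pi * Complex.I : ℂ) = p at *
    field_simp

theorem projOp_add (w : ℤ) (n : ℕ) {g h : ℕ → ℍ → ℂ} (hg : ∀ m, MDiff (g m))
    (hh : ∀ m, MDiff (h m)) :
    projOp w n (fun m => g m + h m) = projOp w n g + projOp w n h := by
  simp only [projOp, derivH_add (hg _) (hh _), smul_add, Finset.sum_add_distrib]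

theorem projOp_smul (w : ℤ) (n : ℕ) (c : ℂ) (h : ℕ → ℍ → ℂ) :
    projOp w n (fun m => c • h m) = c • projOp w n h := by
  simp only [projOp, derivH_smul, Finset.smul_sum, smul_comm c]

theorem mdiff_projOp (w : ℤ) (n : ℕ) {h : ℕ → ℍ → ℂ} (hh : ∀ m, MDiff (h m)) :
    MDiff (projOp w n h) :=
  Submodule.sum_mem Hol fun m _ => Submodule.smul_mem Hol _ (mdiff_derivH (hh m) m)

/-- The differential operator `f ↦ ∑ m ≤ n, c m * (f * G m) ^ (m)`, where `c m` is the coefficient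
of the weight `w` projection. -/
def diffOp (w : ℤ) (n : ℕ) : (ℕ → Hol) →ₗ[ℂ] Hol →ₗ[ℂ] Hol :=
  LinearMap.mk₂ ℂ
    (fun G f => ⟨projOp w n fun m => (f : ℍ → ℂ) * G m, mdiff_projOp w n fun m => f.2.mul (G m).2⟩)
    (fun G H f => Subtype.ext <| by
      simp only [Pi.add_apply, Submodule.coe_add, mul_add]
      exact projOp_add w n (fun m => f.2.mul (G m).2) fun m => f.2.mul (H m).2)
    (fun c G f => Subtype.ext <| by
      simp only [Pi.smul_apply, Submodule.coe_smul, mul_smul_comm]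
      exact projOp_smul w n c _)
    (fun G f g => Subtype.ext <| by
      simp only [Submodule.coe_add, add_mul]
      exact projOp_add w n (fun m => f.2.mul (G m).2) fun m => g.2.mul (G m).2)
    (fun c G f => Subtype.ext <| by
      simp only [Submodule.coe_smul, smul_mul_assoc]
      exact projOp_smul w n c _)

theorem coe_diffOp (w : ℤ) (n : ℕ) (G : ℕ → Hol) (f : Hol) :
    (diffOp w n G f : ℍ → ℂ) = projOp w n fun m => (f : ℍ → ℂ) * G m :=
  rfl

theorem hasOrderLE_diffOp (w : ℤ) {n N : ℕ} {G : ℕ → Hol} (hG : ∀ m, (G m : ℍ → ℂ) ∈ holGrowth)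
    (h0 : ∀ m, n < m → (G m : ℍ → ℂ) = 0) : HasOrderLE n (diffOp w N G) := by
  refine hasOrderLE_iff.2 ⟨fun r => ∑ m ∈ Finset.range (N + 1),
    (projCoeff w m * (m.choose r : ℂ)) • derivH (m - r) (G m), fun r => sum_mem fun m _ =>
      Subalgebra.smul_mem _ (derivH_mem_holGrowth (hG m) _) _, fun f => ?_⟩
  ext τ
  simp only [Finset.sum_mul]
  rw [coe_diffOp, projOp_apply, Finset.sum_comm, Finset.sum_apply]
  refine Finset.sum_congr rfl fun m _ => ?_
  rcases le_or_gt m n with hm | hm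
  · rw [derivH_mul f.2 (G m).2, Finset.sum_subset (Finset.range_mono (Nat.succ_le_succ hm)),
      Finset.mul_sum, Finset.sum_apply]
    · refine Finset.sum_congr rfl fun i _ => ?_
      simp only [Pi.mul_apply, Pi.smul_apply, smul_eq_mul]
      ring
    · intro i _ hi
      rw [Nat.choose_eq_zero_of_lt (by simpa using hi)]
      simp
  · simp [h0 m hm, derivH_const_zero]

/-! ### Modular differential operators -/

variable {k : ℤ}

theorem slash_slash_inv (k : ℤ) (γ : SL(2, ℝ)) (f : Hol) :
    holSlash k γ (holSlash k γ⁻¹ f) = f := by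
  ext τ
  have hj := jFactor_ne_zero γ τ
  change slash k γ (slash k γ⁻¹ f) τ = _
  rw [slash_eq, slash_eq, jFactor_inv, inv_smul_smul, inv_zpow, ← mul_assoc,
    mul_inv_cancel₀ (zpow_ne_zero _ hj), one_mul]

theorem diffOp_holSlash {w : ℤ} {n : ℕ} (hw : w = k + K) (hn : n ≤ (w - 2).toNat) {G : ℕ → Hol}
    {γ : SL(2, ℝ)} (hG : ∀ m ≤ n, (G m : ℍ → ℂ) = quasiTransform K n γ (fun m => G m) m) (f : Hol) :
    diffOp w n G (holSlash k γ f) = holSlash w γ (diffOp w n G f) := by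
  refine Subtype.ext ?_
  change projOp w n (fun m => slash k γ f * (G m : ℍ → ℂ)) =
    slash w γ (projOp w n fun m => (f : ℍ → ℂ) * G m)
  rw [← projOp_quasiTransform hn γ fun m => f.2.mul (G m).2, projOp, projOp]
  refine Finset.sum_congr rfl fun m hm => ?_
  rw [hw, ← slash_mul_quasiTransform, ← hG m (Nat.lt_succ_iff.1 (Finset.mem_range.1 hm))]

theorem sum_mul_derivH_powHol (a : ℕ → ℍ → ℂ) (n : ℕ) (τ : ℍ) :
    ∑ r ∈ Finset.range (n + 1), a r τ * derivH r (powHol τ n : ℍ → ℂ) τ =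
      a n τ * n.factorial := by
  rw [Finset.sum_range_succ, Finset.sum_eq_zero, zero_add, derivH_powHol, if_pos rfl]
  intro r hr
  rw [derivH_powHol, if_neg (Finset.mem_range.1 hr).ne, mul_zero]

theorem sum_mul_derivH_slash_powHol (k : ℤ) (γ : SL(2, ℝ)) (a : ℕ → ℍ → ℂ) (n : ℕ) (τ : ℍ) :
    ∑ r ∈ Finset.range (n + 1), a r τ * derivH r (slash k γ (powHol (γ • τ) n)) τ =
      a n τ * (jFactor γ τ ^ (-k - n - n) * n.factorial) := by
  rw [Finset.sum_range_succ, Finset.sum_eq_zero, zero_add, derivH_slash (powHol _ n).2,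
    Finset.sum_range_succ, Finset.sum_eq_zero, zero_add, derivH_powHol, if_pos rfl, Nat.sub_self]
  · simp [mobiusCoeff]
  · intro i hi
    rw [derivH_powHol, if_neg (Finset.mem_range.1 hi).ne, mul_zero]
  · intro m hm
    rw [derivH_slash (powHol _ n).2, Finset.sum_eq_zero, mul_zero]
    intro i hi
    have hi' : i ≤ m := Nat.lt_succ_iff.1 (Finset.mem_range.1 hi)
    rw [derivH_powHol, if_neg (hi'.trans_lt (Finset.mem_range.1 hm)).ne, mul_zero]

/-- The counterpart of `HasDepthLE.pred`: the leading coefficient of an equivariant operator is a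
modular form of weight `K - 2 (n + 1) < 0`. -/
theorem HasOrderLE.pred (hΓ : IsLattice Γ) {n : ℕ} {L : Hol →ₗ[ℂ] Hol} (hL : HasOrderLE (n + 1) L)
    (hL' : ∀ γ ∈ Γ, ∀ f : Hol, L (holSlash k γ f) = holSlash (k + K) γ (L f))
    (hn : K < 2 * (n + 1 : ℕ)) : HasOrderLE n L := by
  obtain ⟨a, ha, haL⟩ := hasOrderLE_iff.1 hL
  have h0 : a (n + 1) = 0 := by
    refine hΓ.eq_zero_of_neg_weight (m := (2 * (n + 1 : ℕ) - K).toNat) (by omega) (ha _).1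
      (ha _).2 ?_
    intro γ hγ τ
    have hj := jFactor_ne_zero γ τ
    have hfac : ((n + 1).factorial : ℂ) ≠ 0 := by exact_mod_cast Nat.factorial_ne_zero _
    -- A function vanishing to order `n + 1` at `γ τ` has a slash vanishing to the same order at
    -- `τ`, so both sides reduce to their leading terms.
    have h1 := congrFun (congrArg Subtype.val (hL' γ hγ (powHol (γ • τ) (n + 1)))) τ
    change (L _ : ℍ → ℂ) τ = slash (k + K) γ (L _) τ at h1
    rw [slash_eq, haL, haL, Finset.sum_apply, Finset.sum_apply] at h1
    simp only [Pi.mul_apply] at h1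
    rw [sum_mul_derivH_powHol] at h1
    have h2 := (sum_mul_derivH_slash_powHol k γ a (n + 1) τ).symm.trans h1
    rw [← mul_assoc, ← mul_assoc] at h2
    have h3 := mul_right_cancel₀ hfac h2
    rw [← zpow_natCast]
    change _ * jFactor γ τ ^ _ = _
    rw [show (((2 * (n + 1 : ℕ) - K).toNat : ℕ) : ℤ) =
      (k + (n + 1 : ℕ) + (n + 1 : ℕ)) + -(k + K) by omega, zpow_add₀ hj, mul_left_comm,
      mul_comm (a (n + 1) (γ • τ)), ← h3, mul_left_comm, ← zpow_add₀ hj]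
    simp
  refine hasOrderLE_iff.2 ⟨a, ha, fun f => ?_⟩
  rw [haL, Finset.sum_range_succ, h0, zero_mul, add_zero]

theorem HasOrderLE.of_weight (hΓ : IsLattice Γ) {n N : ℕ} {L : Hol →ₗ[ℂ] Hol} (hL : HasOrderLE n L)
    (hL' : ∀ γ ∈ Γ, ∀ f : Hol, L (holSlash k γ f) = holSlash (k + K) γ (L f))
    (hN : K < 2 * (N + 1 : ℕ)) : HasOrderLE N L := by
  induction n with
  | zero => exact hL.mono (Nat.zero_le N)
  | succ n ih =>
    rcases le_or_gt (n + 1) N with h | h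
    · exact hL.mono h
    · exact ih (hL.pred hΓ hL' (by omega))

/-- Equivariance of the projection says that `G` and its transform define operators with the same
values on all `f ∣ₖ γ`, hence on all holomorphic functions; the coefficients of such an operator are
unique. -/
theorem eq_quasiTransform_of_equivariant {n : ℕ} (hn : n ≤ (k + K - 2).toNat) {G : ℕ → Hol}
    {γ : SL(2, ℝ)} (h : ∀ f : Hol, diffOp (k + K) n G (holSlash k γ f) =
      holSlash (k + K) γ (diffOp (k + K) n G f)) {m : ℕ} (hm : m ≤ n) :
    (G m : ℍ → ℂ) = quasiTransform K n γ (fun m => G m) m := by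
  have hT := mdiff_quasiTransform K (n := n) γ fun m => (G m).2
  let H : ℕ → Hol := fun m => ⟨quasiTransform K n γ (fun m => G m) m, hT m⟩
  have h1 : diffOp (k + K) n (G - H) = 0 := by
    rw [map_sub, sub_eq_zero]
    ext1 f
    rw [← slash_slash_inv k γ f, h]
    generalize holSlash k γ⁻¹ f = f
    refine Subtype.ext ?_
    change slash (k + K) γ (projOp (k + K) n fun m => (f : ℍ → ℂ) * G m) =
      projOp (k + K) n (fun m => slash k γ f * quasiTransform K n γ (fun m => G m) m)
    simp only [slash_mul_quasiTransform]
    rw [← projOp_quasiTransform hn γ fun m => f.2.mul (G m).2]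
  have h2 := eq_zero_of_sum_derivH_eq_zero (c := projCoeff (k + K)) (q := 0)
    (fun m hm => projCoeff_ne_zero (hm.trans hn)) (fun m => ((G - H) m).2) (fun f τ _ => by
      have := congrFun (congrArg Subtype.val (LinearMap.congr_fun h1 f)) τ
      rwa [coe_diffOp, projOp_apply] at this) (Nat.zero_le m) hm
  exact sub_eq_zero.1 h2

/-! ### The isomorphism -/

theorem mem_quasimodularForms_iff : F ∈ QuasimodularForms Γ K ↔
    F ∈ holGrowth ∧ ∃ n, HasDepthLE Γ K n F :=
  and_assoc.symm

/-- The place where positivity of `k` enters: it puts `K / 2` within the admissible powers. The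
bound fails for `k = 0`, `K = 2`. -/
theorem depth_bound {k : ℕ} (hk : 0 < k) (K : ℤ) :
    K < 2 * (((k : ℤ) + K - 2).toNat + 1 : ℕ) := by
  omega

theorem quasimodularForms_hasDepthLE (hΓ : IsLattice Γ) {k : ℕ} (hk : 0 < k)
    (F : QuasimodularForms Γ K) : HasDepthLE Γ K ((k : ℤ) + K - 2).toNat (F : ℍ → ℂ) := by
  obtain ⟨hF, n, hn⟩ := mem_quasimodularForms_iff.1 F.2
  exact hn.of_weight hΓ hF (depth_bound hk K)

theorem quasimodularForms_qmCoeff_mem (hΓ : IsLattice Γ) (F : QuasimodularForms Γ K) (m : ℕ) :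
    qmCoeff Γ K (F : ℍ → ℂ) m ∈ holGrowth := by
  obtain ⟨hF, n, hn⟩ := mem_quasimodularForms_iff.1 F.2
  exact hn.qmCoeff_mem_holGrowth hΓ hF m

theorem quasimodularForms_isTransfPoly (hΓ : IsLattice Γ) (F : QuasimodularForms Γ K) (τ : ℍ) :
    IsTransfPoly Γ K F τ (transfPoly Γ K F τ) := by
  obtain ⟨-, n, hn⟩ := mem_quasimodularForms_iff.1 F.2
  exact hn.isTransfPoly hΓ τ

/-- The coefficients of the completion of a quasimodular form. -/
def qmCoeffs (hΓ : IsLattice Γ) (K : ℤ) : QuasimodularForms Γ K →ₗ[ℂ] ℕ → Hol where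
  toFun F m := ⟨qmCoeff Γ K F m, (quasimodularForms_qmCoeff_mem hΓ F m).1⟩
  map_add' F G := by
    funext m
    ext τ
    have h : transfPoly Γ K (F + G : QuasimodularForms Γ K) τ =
        transfPoly Γ K F τ + transfPoly Γ K G τ := by
      refine transfPoly_eq hΓ fun γ hγ => ?_
      rw [Polynomial.eval_add, ← quasimodularForms_isTransfPoly hΓ F τ γ hγ, ← quasimodularForms_isTransfPoly hΓ G τ γ hγ]
      simp [slash_apply, mul_add]
    change (transfPoly Γ K _ τ).coeff m / _ = (transfPoly Γ K _ τ).coeff m / _ +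
      (transfPoly Γ K _ τ).coeff m / _
    rw [h, Polynomial.coeff_add, add_div]
  map_smul' c F := by
    funext m
    ext τ
    have h : transfPoly Γ K (c • F : QuasimodularForms Γ K) τ = c • transfPoly Γ K F τ := by
      refine transfPoly_eq hΓ fun γ hγ => ?_
      rw [Polynomial.eval_smul, ← quasimodularForms_isTransfPoly hΓ F τ γ hγ]
      simp [slash_apply, mul_left_comm]
    change (transfPoly Γ K _ τ).coeff m / _ = c • ((transfPoly Γ K _ τ).coeff m / _)
    rw [h, Polynomial.coeff_smul, smul_eq_mul, smul_eq_mul, mul_div_assoc]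

theorem coe_qmCoeffs (hΓ : IsLattice Γ) (F : QuasimodularForms Γ K) (m : ℕ) :
    (qmCoeffs hΓ K F m : ℍ → ℂ) = qmCoeff Γ K F m :=
  rfl

/-- The operator `f ↦ π (f * completion F)`. -/
def quasiOp (hΓ : IsLattice Γ) (k : ℕ) (K : ℤ) : QuasimodularForms Γ K →ₗ[ℂ] Hol →ₗ[ℂ] Hol :=
  diffOp (k + K) (k + K - 2).toNat ∘ₗ qmCoeffs hΓ K

theorem quasiOp_apply (hΓ : IsLattice Γ) (k : ℕ) (F : QuasimodularForms Γ K) :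
    quasiOp hΓ k K F = diffOp (k + K) (k + K - 2).toNat (qmCoeffs hΓ K F) :=
  rfl

/-- An operator of order at most `n` kills, at a point, every function vanishing there to order `n +
1`; elimination with `q = n + 1` then removes all coefficients beyond `n`. -/
theorem hasDepthLE_iff_hasOrderLE_quasiOp (hΓ : IsLattice Γ) {k : ℕ} (hk : 0 < k)
    (F : QuasimodularForms Γ K) (n : ℕ) :
    HasDepthLE Γ K n F ↔ HasOrderLE n (quasiOp hΓ k K F) := by
  constructor
  · intro hF
    exact hasOrderLE_diffOp _ (quasimodularForms_qmCoeff_mem hΓ F) fun m hm => hF.qmCoeff_eq_zero hΓ hm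
  · intro hL
    have hF := quasimodularForms_hasDepthLE hΓ hk F
    obtain ⟨a, -, haL⟩ := hasOrderLE_iff.1 hL
    refine hF.of_qmCoeff_eq_zero hΓ fun m hm => ?_
    rcases lt_or_ge ((k : ℤ) + K - 2).toNat m with hmN | hmN
    · exact hF.qmCoeff_eq_zero hΓ hmN
    · refine eq_zero_of_sum_derivH_eq_zero (c := projCoeff (k + K)) (q := n + 1)
        (fun m hm => projCoeff_ne_zero hm) (fun m => (qmCoeffs hΓ K F m).2) (fun f τ hf => ?_)
        hm hmN
      rw [← projOp_apply, ← coe_diffOp, ← quasiOp_apply, haL, Finset.sum_apply]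
      refine Finset.sum_eq_zero fun r hr => ?_
      rw [Pi.mul_apply, hf r (Finset.mem_range.1 hr), mul_zero]

theorem quasiOp_mem (hΓ : IsLattice Γ) {k : ℕ} (hk : 0 < k) (F : QuasimodularForms Γ K) :
    quasiOp hΓ k K F ∈ MLDO Γ k K := by
  have hF := quasimodularForms_hasDepthLE hΓ hk F
  refine ⟨⟨_, (hasDepthLE_iff_hasOrderLE_quasiOp hΓ hk F _).1 hF⟩, fun γ hγ f => ?_⟩
  exact diffOp_holSlash rfl le_rfl (fun m _ => hF.qmCoeff_eq_quasiTransform hΓ hγ m) f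

theorem quasiOp_injective (hΓ : IsLattice Γ) {k : ℕ} (hk : 0 < k) (K : ℤ) :
    Function.Injective (quasiOp hΓ k K) := by
  refine (injective_iff_map_eq_zero _).2 fun F hF => ?_
  have h0 : qmCoeff Γ K F 0 = 0 :=
    eq_zero_of_sum_derivH_eq_zero (c := projCoeff (k + K)) (q := 0) (fun m hm => projCoeff_ne_zero hm)
      (fun m => (qmCoeffs hΓ K F m).2) (fun f τ _ => by
        rw [← projOp_apply, ← coe_diffOp, ← quasiOp_apply, hF]
        rfl) le_rfl (Nat.zero_le _)
  rw [(quasimodularForms_hasDepthLE hΓ hk F).qmCoeff_zero hΓ] at h0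
  exact Subtype.ext h0

/-- The preimage is the coefficient `G 0` in the normal form of `L`. The other `G m` are recovered
as its quasimodular coefficients. -/
theorem exists_quasiOp_eq (hΓ : IsLattice Γ) {k : ℕ} (hk : 0 < k) {L : Hol →ₗ[ℂ] Hol}
    (hL : L ∈ MLDO Γ k K) : ∃ F : QuasimodularForms Γ K, quasiOp hΓ k K F = L := by
  obtain ⟨⟨n, hn⟩, hL⟩ := hL
  obtain ⟨a, ha, haL⟩ := hasOrderLE_iff.1 (hn.of_weight hΓ hL (depth_bound hk K))
  obtain ⟨G, hG, hGa⟩ := exists_eq_projOp (w := k + K) le_rfl ha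
  let H : ℕ → Hol := fun m => ⟨G m, (hG m).1⟩
  have hLH : L = diffOp (k + K) (k + K - 2).toNat H := by
    ext1 f
    exact Subtype.ext ((haL f).trans (hGa f).symm)
  have hT : ∀ γ ∈ Γ, G 0 = quasiTransform K ((k : ℤ) + K - 2).toNat γ G 0 := fun γ hγ =>
    eq_quasiTransform_of_equivariant (G := H) le_rfl (fun f => hLH ▸ hL γ hγ f) (Nat.zero_le _)
  have hd : HasDepthLE Γ K ((k : ℤ) + K - 2).toNat (G 0) := fun τ =>
    ⟨_, Polynomial.natDegree_sum_le_of_forall_le _ _ fun m hm =>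
      (Polynomial.natDegree_C_mul_X_pow_le _ _).trans (Nat.lt_succ_iff.1 (Finset.mem_range.1 hm)),
      isTransfPoly_of_quasiTransform hT τ⟩
  refine ⟨⟨G 0, mem_quasimodularForms_iff.2 ⟨hG 0, _, hd⟩⟩, ?_⟩
  rw [hLH, quasiOp_apply]
  ext1 f
  refine Subtype.ext ?_
  rw [coe_diffOp, coe_diffOp, projOp, projOp]
  refine Finset.sum_congr rfl fun m hm => ?_
  rw [coe_qmCoeffs, qmCoeff_eq_of_quasiTransform hΓ hT (Nat.lt_succ_iff.1 (Finset.mem_range.1 hm))]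

/-- The isomorphism between quasimodular forms and modular linear differential operators. -/
def quasiEquiv (hΓ : IsLattice Γ) {k : ℕ} (hk : 0 < k) (K : ℤ) :
    QuasimodularForms Γ K ≃ₗ[ℂ] MLDO Γ k K :=
  LinearEquiv.ofBijective ((quasiOp hΓ k K).codRestrict (MLDO Γ k K) (quasiOp_mem hΓ hk)) <| by
    constructor
    · intro F G h
      exact quasiOp_injective hΓ hk K (congrArg Subtype.val h)
    · rintro ⟨L, hL⟩
      obtain ⟨F, hF⟩ := exists_quasiOp_eq hΓ hk hL
      exact ⟨F, Subtype.ext hF⟩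

/-! ### Holomorphic projection of almost holomorphic functions -/

theorem almostHolProj_eq (w : ℤ) (N : ℕ) (h : ℕ → Hol) :
    almostHolProj w N h = projOp w N fun m => h m := by
  ext τ
  rw [projOp_apply]
  rfl

/-- In any decomposition the integrable part is a difference of almost holomorphic functions, hence
itself almost holomorphic, and `bergmanProj_almostHol` evaluates its projection by the same formula.
The converse uses integrable part `0`. -/
theorem isHolProj_almostHol_iff (w : ℤ) (h : ℕ → Hol) (g : ℍ → ℂ) :
    IsHolProj w (almostHol (w - 2).toNat h) g ↔ g = projOp w (w - 2).toNat fun m => h m := by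
  constructor
  · rintro ⟨Ψ, h', hint, hΦ, hg⟩
    have hΨ : Ψ = almostHol (w - 2).toNat (h - h') := by
      ext τ
      rw [eq_sub_of_add_eq (hΦ τ).symm, almostHol, almostHol, almostHol, ← Finset.sum_sub_distrib]
      refine Finset.sum_congr rfl fun m _ => ?_
      rw [← sub_div]
      rfl
    subst hΨ
    ext τ
    rw [hg, bergmanProj_almostHol w _ hint, almostHolProj_eq, almostHolProj_eq, ← Pi.add_apply,
      ← projOp_add w _ (fun m => ((h - h') m).2) fun m => (h' m).2]
    simp
  · rintro rfl
    refine ⟨0, h, fun τ => ?_, fun τ => ?_, fun τ => ?_⟩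
    · have : bergmanIntegrand w 0 τ = 0 := by
        ext z
        simp [bergmanIntegrand]
      rw [this]
      exact integrable_zero _ _ _
    · simp
    · simp [bergmanProj, bergmanIntegrand, almostHolProj_eq]

theorem isHolProj_mul_completion_iff (hΓ : IsLattice Γ) {k : ℕ} (hk : 0 < k)
    (F : QuasimodularForms Γ K) (f : Hol) (g : ℍ → ℂ) :
    IsHolProj (k + K) (fun τ => (f : ℍ → ℂ) τ * completion Γ K F τ) g ↔
      g = quasiOp hΓ k K F f := by
  have h : (fun τ => (f : ℍ → ℂ) τ * completion Γ K F τ) = almostHol ((k : ℤ) + K - 2).toNat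
      fun m => ⟨(f : ℍ → ℂ) * qmCoeffs hΓ K F m, f.2.mul (qmCoeffs hΓ K F m).2⟩ := by
    ext τ
    rw [(quasimodularForms_hasDepthLE hΓ hk F).completion_eq hΓ, almostHol, Finset.mul_sum]
    refine Finset.sum_congr rfl fun m _ => ?_
    rw [← mul_div_assoc]
    rfl
  rw [h]
  exact isHolProj_almostHol_iff _ _ _

end ModularDiffOp

end

/-- The equivalence for `g` expresses two claims at once: from right to left, the product lies in
the domain of the projection; from left to right, the value is the same for all decompositions. -/
theorem mainTheorem6 (Γ : Subgroup SL(2, ℝ)) (hΓ : ModularDiffOp.IsLattice Γ) (k : ℕ) (hk : 0 < k) :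
    ∃ Λ : ∀ K : ℤ, ModularDiffOp.QuasimodularForms Γ K ≃ₗ[ℂ] ModularDiffOp.MLDO Γ k K,
      (∀ (K : ℤ) (F : ModularDiffOp.QuasimodularForms Γ K) (f : ModularDiffOp.Hol) (g : ℍ → ℂ),
        ModularDiffOp.IsHolProj (k + K)
            (fun τ => (f : ℍ → ℂ) τ * ModularDiffOp.completion Γ K (F : ℍ → ℂ) τ) g ↔
          g = ((Λ K F : ModularDiffOp.Hol →ₗ[ℂ] ModularDiffOp.Hol) f : ℍ → ℂ)) ∧
      ∀ (K : ℤ) (F : ModularDiffOp.QuasimodularForms Γ K) (n : ℕ),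
        ModularDiffOp.HasDepthLE Γ K n (F : ℍ → ℂ) ↔
          ModularDiffOp.HasOrderLE n (Λ K F : ModularDiffOp.Hol →ₗ[ℂ] ModularDiffOp.Hol) :=
  ⟨fun K => ModularDiffOp.quasiEquiv hΓ hk K,
    fun _ F f g => ModularDiffOp.isHolProj_mul_completion_iff hΓ hk F f g,
    fun _ F n => ModularDiffOp.hasDepthLE_iff_hasOrderLE_quasiOp hΓ hk F n⟩
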